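/- Let $\mathcal X_1,\mathcal X_2,\hat{\mathcal X}_1,\hat{\mathcal X}_2$ be finite alphabets, let $(X_1,X_2)$ have an arbitrary law on $\mathcal X_1\times\mathcal X_2$, let $d_i:\mathcal X_i\times\hat{\mathcal X}_i\to\mathbb R$ ($i=1,2$) be distortion measures, and let $K$ be a number of rounds. Put $i_l=1$ for odd $l$ and $i_l=2$ for even $l$. Entropic quantities are in bits. *The tradeoff region.* For random variables $(X_1,Y_1,X_2,Y_2)$ on finite alphabets ($X_i$ public, $Y_i$ private), let $\mathcal T_K$ be the set of all $(L_1,L_2,D_1,D_2)\in\mathbb R^4$ for which there are random variables $U_1,\dots,U_K$ with finite alphabets $\mathcal U_1,\dots,\mathcal U_K$, jointly distributed with $(X_1,Y_1,X_2,Y_2)$, and functions $\hat X_1=g_1(X_2,U_1,\dots,U_K)$, $\hat X_2=g_2(X_1,U_1,\dots,U_K)$ such that $$L_1\ge I(Y_1;U_1,\dots,U_K,X_2),\quad L_2\ge I(Y_2;U_1,\dots,U_K,X_1),\quad \mathbb E\,d_1(X_1,\hat X_1)\le D_1,\quad \mathbb E\,d_2(X_2,\hat X_2)\le D_2,$$ and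 such that the Markov chains $Y_1\leftrightarrow(U_1,\dots,U_{l-1},X_2)\leftrightarrow U_l$ for even $l\le K$ and $Y_2\leftrightarrow(U_1,\dots,U_{l-1},X_1)\leftrightarrow U_l$ for odd $l\le K$ hold. Let $\mathcal T_K^{\mathrm b}\subseteq\mathcal T_K$ be the subset obtained under the additional requirement $|\mathcal U_l|\le|\mathcal X_{i_l}|\prod_{j<l}|\mathcal U_j|+3$ for all $l\le K$. *Interactive source coding.* Terminal $i$ observes $X_i^n$, where the pairs $(X_{1i},X_{2i})$ are i.i.d. copies of $(X_1,X_2)$. A $K$-round code of block length $n$ consists of messages $m_l\in\{1,\dots,M_l\}$, $l=1,\dots,K$, where $m_l$ is a function of $X_{i_l}^n$ and $m_1,\dots,m_{l-1}$, together with reproductions $\hat X_1^n$, a function of $X_2^n$ and $m_1,\dots,m_K$, and $\hat X_2^n$, a function of $X_1^n$ and $m_1,\dots,m_K$. The tuple $(R_1,R_2,D_1,D_2)\in\mathbb R^4$ is achievable if there is a sequence of such codes, one for every $n$, with $$\limsup_{n\to\infty}\frac1n\sum_{l:\,i_l=i}\log_2 M_l\le R_i,\qquad \limsup_{n\to\infty}\frac1n\sum_{j=1}^n\mathbb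 E\,d_i(X_{ij},\hat X_{ij})\le D_i,\qquad i=1,2.$$ *Claim.* In the special case $Y_1=X_1$, $Y_2=X_2$, the set of all achievable sum-rate and distortion tuples of $K$-round interactive source coding is the image of the tradeoff region under $R_i=L_i-I(X_1;X_2)$: $$\{(R_1,R_2,D_1,D_2)\text{ achievable}\}=\{(L_1-I(X_1;X_2),\,L_2-I(X_1;X_2),\,D_1,\,D_2):(L_1,L_2,D_1,D_2)\in\mathcal T_K\},$$ and the same equality holds with $\mathcal T_K^{\mathrm b}$ in place of $\mathcal T_K$. -/

import Mathlib

open Filter Finset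

noncomputable section

namespace InteractiveCoding

/-! ### Finite probability: laws, mutual information, Markov chains

A finite probability space is a finite type `Ω` with a weight `q ∈ stdSimplex ℝ Ω`; a random
variable is a function on `Ω`. -/

open scoped Classical in
/-- The probability mass function of the random variable `f` under `q`. -/
def law {Ω α : Type*} [Fintype Ω] (q : Ω → ℝ) (f : Ω → α) (a : α) : ℝ :=
  ∑ ω, if f ω = a then q ω else 0

/-- The mutual information `I(f; g)` in bits:
the expectation of `log₂ (P(f, g) / (P(f) P(g)))`. -/
def mutualInfo {Ω α β : Type*} [Fintype Ω] (q : Ω → ℝ) (f : Ω → α) (g : Ω → β) : ℝ :=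
  ∑ ω, q ω * Real.logb 2
    (law q (fun ω' => (f ω', g ω')) (f ω, g ω) / (law q f (f ω) * law q g (g ω)))

/-- The Markov chain `f ↔ g ↔ h`: `f` and `h` are conditionally independent given `g`. -/
def IsMarkovChain {Ω α β γ : Type*} [Fintype Ω] (q : Ω → ℝ)
    (f : Ω → α) (g : Ω → β) (h : Ω → γ) : Prop :=
  ∀ a b c, law q (fun ω => (f ω, g ω, h ω)) (a, b, c) * law q g b =
    law q (fun ω => (f ω, g ω)) (a, b) * law q (fun ω => (g ω, h ω)) (b, c)

/-- The part of a `K`-tuple that strictly precedes index `l`. -/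
def past {K : ℕ} {U : Fin K → Type*} (l : Fin K) (u : (j : Fin K) → U j) :
    (j : {j : Fin K // j < l}) → U j :=
  fun j => u j

/-! ### The single-letter utility-privacy tradeoff region

Rounds are indexed by `Fin K`, starting from `0`: agent A (terminal 1) acts when the index is even
(first, third, ... round), agent B (terminal 2) when it is odd. -/

section Tradeoff

variable {X₁ Y₁ X₂ Y₂ X'₁ X'₂ : Type*} [Fintype X₁] [Fintype Y₁] [Fintype X₂] [Fintype Y₂]

/-- The tuples `(L₁, L₂, D₁, D₂)` obtained with auxiliary variables `U_l` whose alphabets have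
`m l` elements. Here `P` is the law of `(X₁, Y₁, X₂, Y₂)`, with `X` public and `Y` private, and
`q` is the joint law of these four variables and `U = (U_l)_l`. Agent B reconstructs `X₁` as
`g₁ (X₂, U)` and agent A reconstructs `X₂` as `g₂ (X₁, U)`. -/
def tradeoffTuples {K : ℕ} (P : X₁ × Y₁ × X₂ × Y₂ → ℝ) (d₁ : X₁ → X'₁ → ℝ) (d₂ : X₂ → X'₂ → ℝ)
    (m : Fin K → ℕ) : Set (ℝ × ℝ × ℝ × ℝ) :=
  {t | ∃ q ∈ stdSimplex ℝ ((X₁ × Y₁ × X₂ × Y₂) × ((l : Fin K) → Fin (m l))),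
    ∃ (g₁ : X₂ → ((l : Fin K) → Fin (m l)) → X'₁) (g₂ : X₁ → ((l : Fin K) → Fin (m l)) → X'₂),
      (∀ s, ∑ u, q (s, u) = P s) ∧
      (∀ l : Fin K, Odd (l : ℕ) →
        IsMarkovChain q (fun ω => ω.1.2.1) (fun ω => (past l ω.2, ω.1.2.2.1)) (fun ω => ω.2 l)) ∧
      (∀ l : Fin K, Even (l : ℕ) →
        IsMarkovChain q (fun ω => ω.1.2.2.2) (fun ω => (past l ω.2, ω.1.1)) (fun ω => ω.2 l)) ∧
      mutualInfo q (fun ω => ω.1.2.1) (fun ω => (ω.2, ω.1.2.2.1)) ≤ t.1 ∧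
      mutualInfo q (fun ω => ω.1.2.2.2) (fun ω => (ω.2, ω.1.1)) ≤ t.2.1 ∧
      ∑ ω, q ω * d₁ ω.1.1 (g₁ ω.1.2.2.1 ω.2) ≤ t.2.2.1 ∧
      ∑ ω, q ω * d₂ ω.1.2.2.1 (g₂ ω.1.1 ω.2) ≤ t.2.2.2}

/-- The tradeoff region of `K`-round interactive mechanisms, over all finite auxiliary alphabets. -/
def tradeoffRegion (K : ℕ) (P : X₁ × Y₁ × X₂ × Y₂ → ℝ) (d₁ : X₁ → X'₁ → ℝ)
    (d₂ : X₂ → X'₂ → ℝ) : Set (ℝ × ℝ × ℝ × ℝ) :=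
  ⋃ m : Fin K → ℕ, tradeoffTuples P d₁ d₂ m

/-- The cardinality bounds `|𝒰_l| ≤ |𝒳_{i_l}| ∏_{j < l} |𝒰_j| + 3`, where `i_l` is the terminal
that acts in round `l` and `n₁ = |𝒳₁|`, `n₂ = |𝒳₂|`. -/
def CardBound {K : ℕ} (n₁ n₂ : ℕ) (m : Fin K → ℕ) : Prop :=
  ∀ l : Fin K, m l ≤ (if Even (l : ℕ) then n₁ else n₂) * (∏ j ∈ univ.filter (· < l), m j) + 3

/-- The tradeoff region with the cardinality bounds on the auxiliary alphabets. -/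
def boundedTradeoffRegion (K : ℕ) (P : X₁ × Y₁ × X₂ × Y₂ → ℝ) (d₁ : X₁ → X'₁ → ℝ)
    (d₂ : X₂ → X'₂ → ℝ) : Set (ℝ × ℝ × ℝ × ℝ) :=
  ⋃ m ∈ {m : Fin K → ℕ | CardBound (Fintype.card X₁) (Fintype.card X₂) m},
    tradeoffTuples P d₁ d₂ m

end Tradeoff

open scoped Classical in
/-- The law of `(X₁, Y₁, X₂, Y₂)` with `Y₁ = X₁` and `Y₂ = X₂`, where `(X₁, X₂)` has law `p`. -/
def privateEqPublic {X₁ X₂ : Type*} (p : X₁ × X₂ → ℝ) : X₁ × X₁ × X₂ × X₂ → ℝ :=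
  fun s => if s.2.1 = s.1 ∧ s.2.2.2 = s.2.2.1 then p (s.1, s.2.2.1) else 0

/-! ### Interactive (two-way) source coding -/

/-- A `K`-round interactive source code of block length `n`. The message of round `l` takes `M l`
values and is a function of the sequence at the acting terminal and of all earlier messages. After
the last round, terminal 2 reproduces the first sequence and terminal 1 the second one. -/
structure InteractiveCode (K n : ℕ) (X₁ X₂ X'₁ X'₂ : Type*) where
  /-- sizes of the message sets -/
  M : Fin K → ℕ
  /-- encoders of terminal 1 -/
  enc₁ : (l : Fin K) → Even (l : ℕ) → (Fin n → X₁) →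
    ((j : {j : Fin K // j < l}) → Fin (M j)) → Fin (M l)
  /-- encoders of terminal 2 -/
  enc₂ : (l : Fin K) → ¬ Even (l : ℕ) → (Fin n → X₂) →
    ((j : {j : Fin K // j < l}) → Fin (M j)) → Fin (M l)
  /-- decoder at terminal 2, reproducing the first sequence -/
  dec₁ : (Fin n → X₂) → ((l : Fin K) → Fin (M l)) → Fin n → X'₁
  /-- decoder at terminal 1, reproducing the second sequence -/
  dec₂ : (Fin n → X₁) → ((l : Fin K) → Fin (M l)) → Fin n → X'₂

namespace InteractiveCode

variable {K n : ℕ} {X₁ X₂ X'₁ X'₂ : Type*}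

/-- The message sent in round `l` when the source sequences are `x₁` and `x₂`. -/
def message (c : InteractiveCode K n X₁ X₂ X'₁ X'₂) (x₁ : Fin n → X₁) (x₂ : Fin n → X₂)
    (l : Fin K) : Fin (c.M l) :=
  if h : Even (l : ℕ) then c.enc₁ l h x₁ (fun j => c.message x₁ x₂ j.1)
  else c.enc₂ l h x₂ (fun j => c.message x₁ x₂ j.1)
termination_by (l : ℕ)
decreasing_by all_goals exact j.2

/-- Sum rate of terminal 1 in bits per source symbol: the total over the rounds in which it acts. -/
def sumRate₁ (c : InteractiveCode K n X₁ X₂ X'₁ X'₂) : ℝ :=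
  (∑ l ∈ univ.filter (fun l : Fin K => Even (l : ℕ)), Real.logb 2 (c.M l)) / n

/-- Sum rate of terminal 2 in bits per source symbol: the total over the rounds in which it acts. -/
def sumRate₂ (c : InteractiveCode K n X₁ X₂ X'₁ X'₂) : ℝ :=
  (∑ l ∈ univ.filter (fun l : Fin K => ¬ Even (l : ℕ)), Real.logb 2 (c.M l)) / n

variable [Fintype X₁] [Fintype X₂]

/-- Expected average distortion of the first sequence, the pairs `(X₁ᵢ, X₂ᵢ)` being i.i.d. with
law `p`. -/
def distortion₁ (c : InteractiveCode K n X₁ X₂ X'₁ X'₂) (p : X₁ × X₂ → ℝ) (d₁ : X₁ → X'₁ → ℝ) :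
    ℝ :=
  ∑ x₁ : Fin n → X₁, ∑ x₂ : Fin n → X₂, (∏ i, p (x₁ i, x₂ i)) *
    ((∑ i, d₁ (x₁ i) (c.dec₁ x₂ (c.message x₁ x₂) i)) / n)

/-- Expected average distortion of the second sequence, the pairs `(X₁ᵢ, X₂ᵢ)` being i.i.d. with
law `p`. -/
def distortion₂ (c : InteractiveCode K n X₁ X₂ X'₁ X'₂) (p : X₁ × X₂ → ℝ) (d₂ : X₂ → X'₂ → ℝ) :
    ℝ :=
  ∑ x₁ : Fin n → X₁, ∑ x₂ : Fin n → X₂, (∏ i, p (x₁ i, x₂ i)) *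
    ((∑ i, d₂ (x₂ i) (c.dec₂ x₁ (c.message x₁ x₂) i)) / n)

end InteractiveCode

/-- The set of achievable sum-rate and distortion tuples `(R₁, R₂, D₁, D₂)` of `K`-round interactive
source coding: some sequence of codes, one for every block length `n`, has sum rates and expected
distortions whose upper limits as `n → ∞` are at most `R₁`, `R₂`, `D₁`, `D₂`. -/
def sourceCodingRegion {X₁ X₂ X'₁ X'₂ : Type*} [Fintype X₁] [Fintype X₂]
    (K : ℕ) (p : X₁ × X₂ → ℝ) (d₁ : X₁ → X'₁ → ℝ) (d₂ : X₂ → X'₂ → ℝ) :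
    Set (ℝ × ℝ × ℝ × ℝ) :=
  {r | ∃ c : (n : ℕ) → InteractiveCode K n X₁ X₂ X'₁ X'₂, ∀ ε > (0 : ℝ), ∀ᶠ n in atTop,
    (c n).sumRate₁ ≤ r.1 + ε ∧ (c n).sumRate₂ ≤ r.2.1 + ε ∧
    (c n).distortion₁ p d₁ ≤ r.2.2.1 + ε ∧ (c n).distortion₂ p d₂ ≤ r.2.2.2 + ε}

end InteractiveCoding

end

/-!
Write `S` for the achievable region, `T` for the tradeoff region with `Y₁ = X₁` and `Y₂ = X₂`, and
`T'` for its subset with the cardinality bounds. Up to the shift by `I(X₁; X₂)`, the inclusions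
`S ⊆ T' ⊆ T ⊆ S` hold.

*Converse, `S ⊆ T'`.* Given a code, let `i` be a uniform position in the block and let every `U_l`
consist of `i`, the first sequence before `i`, the second sequence after `i`, and the message of
round `l`. The source pairs that produce given messages form a rectangle, so two outcomes that agree
on the condition of a Markov chain can exchange their second sequences, or their first ones; by
`IsMarkovChain.of_swap` this gives all Markov chains. The chain rule, `ent_chain_le`, bounds the
information quantities by the rates, and a reconstruction that uses the rest of the block can be
replaced by one that does not (`IsMarkovChain.exists_reconstruction`). Hence a code with rates `R`
and distortions `D` gives a point of `T` (`InteractiveCode.mem_tradeoffRegion`). The points of `T`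
lie in `T'` (`tradeoffRegion_subset_bounded`): the values of `U_l` can be reweighted so that the law
of the acting source and the past, one mutual information and both distortions are kept and the
other mutual information does not grow; a basic solution of this linear program has at most
`|𝒳_{i_l}| ∏_{j < l} |𝒰_j| + 3` atoms. Since `T'` is a finite union of projections of closed sets
along compact ones, it is closed, and the achievable tuples, which are limits, lie in it.

*Direct part, `T ⊆ S`.* In one round the acting terminal chooses a sequence that looks like `U_l`
given its observation, and the other terminal, with side information, recovers it from a message of
rate `H(U_l | U_{<l}, W) - H(U_l | U_{<l}, V)`. The one-shot version is `exists_binning`: a random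
binning with two indices, one fixed in advance and the other one sent, makes the choice almost as
good as an ideal draw for any given bounded cost, and lets a list decoder succeed. On long blocks
this is `eventually_exists_round`. The rounds are combined backwards (`exists_rounds`): the cost in
round `l` is the probability that the later rounds, whose maps are already fixed, do not end in a
tuple with the right empirical distortions, so no joint typicality of the actual sequences is
needed. The rates add up to `I(V; U, W) - I(V; W)` by the chain rule (`sum_roundRate`).
-/

noncomputable section

namespace InteractiveCoding

open scoped Classical

/-! ### Laws, entropy and Markov chains on a finite probability space -/

section Basics

variable {Ω α β γ α' β' γ' : Type*} [Fintype Ω] {q : Ω → ℝ}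

theorem sum_law_mul [Fintype α] (q : Ω → ℝ) (f : Ω → α) (F : α → ℝ) :
    ∑ a, law q f a * F a = ∑ ω, q ω * F (f ω) := by
  simp_rw [law, sum_mul, ite_mul, zero_mul]
  rw [sum_comm]
  simp

theorem law_law [Fintype α] (q : Ω → ℝ) (f : Ω → α) (g : α → β) (b : β) :
    law (law q f) g b = law q (fun ω => g (f ω)) b := by
  have := sum_law_mul q f (fun a => if g a = b then (1 : ℝ) else 0)
  simpa [law] using this

theorem law_congr {f : Ω → α} {f' : Ω → α'} {a : α} {a' : α'}
    (h : ∀ ω, q ω ≠ 0 → (f ω = a ↔ f' ω = a')) : law q f a = law q f' a' := by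
  unfold law
  refine sum_congr rfl fun ω _ => ?_
  by_cases hω : q ω = 0
  · simp [hω]
  · simp [h ω hω]

theorem law_eq_zero {f : Ω → α} {a : α} (h : ∀ ω, q ω ≠ 0 → f ω ≠ a) : law q f a = 0 := by
  unfold law
  refine sum_eq_zero fun ω _ => ?_
  by_cases hω : q ω = 0
  · simp [hω]
  · simp [h ω hω]

theorem exists_of_law_ne_zero {f : Ω → α} {a : α} (h : law q f a ≠ 0) :
    ∃ ω, q ω ≠ 0 ∧ f ω = a := by
  by_contra hc
  push Not at hc
  exact h (law_eq_zero hc)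

theorem law_nonneg (hq : ∀ ω, 0 ≤ q ω) (f : Ω → α) (a : α) : 0 ≤ law q f a :=
  sum_nonneg fun ω _ => by split_ifs <;> simp [hq]

theorem le_law (hq : ∀ ω, 0 ≤ q ω) (f : Ω → α) (ω : Ω) : q ω ≤ law q f (f ω) := by
  unfold law
  have := single_le_sum (f := fun ω' => if f ω' = f ω then q ω' else 0)
    (fun ω' _ => by split_ifs <;> simp [hq]) (mem_univ ω)
  simpa using this

theorem law_pos (hq : ∀ ω, 0 ≤ q ω) (f : Ω → α) {ω : Ω} (hω : q ω ≠ 0) :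
    0 < law q f (f ω) :=
  lt_of_lt_of_le (lt_of_le_of_ne (hq ω) hω.symm) (le_law hq f ω)

theorem sum_law [Fintype α] (q : Ω → ℝ) (f : Ω → α) : ∑ a, law q f a = ∑ ω, q ω := by
  simpa using sum_law_mul q f (fun _ => 1)

theorem law_mem_stdSimplex [Fintype α] (hq : q ∈ stdSimplex ℝ Ω) (f : Ω → α) :
    law q f ∈ stdSimplex ℝ α :=
  ⟨law_nonneg hq.1 f, by rw [sum_law, hq.2]⟩

theorem law_fst_eq_sum [Fintype β] (q : Ω → ℝ) (f : Ω → α) (g : Ω → β) (a : α) :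
    law q f a = ∑ b, law q (fun ω => (f ω, g ω)) (a, b) := by
  simp_rw [law, Prod.mk.injEq, ite_and]
  rw [sum_comm]
  refine sum_congr rfl fun ω _ => ?_
  by_cases h : f ω = a <;> simp [h]

theorem law_snd_eq_sum [Fintype α] (q : Ω → ℝ) (f : Ω → α) (g : Ω → β) (b : β) :
    law q g b = ∑ a, law q (fun ω => (f ω, g ω)) (a, b) := by
  rw [law_fst_eq_sum q g f b]
  refine sum_congr rfl fun a _ => law_congr fun ω _ => ?_
  simp [and_comm]

theorem law_mono (hq : ∀ ω, 0 ≤ q ω) {f : Ω → α} {g : Ω → β} {a : α} {b : β}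
    (h : ∀ ω, f ω = a → g ω = b) : law q f a ≤ law q g b := by
  unfold law
  refine sum_le_sum fun ω _ => ?_
  by_cases hf : f ω = a
  · simp [hf, h ω hf]
  · simp only [hf, if_false]
    split_ifs
    exacts [hq ω, le_rfl]

/-- Two random variables carry the same information: on the support of `q` they have the same
level sets. Mutual information, entropy and the Markov property only depend on level sets. -/
def SameLevels (q : Ω → ℝ) (f : Ω → α) (f' : Ω → α') : Prop :=
  ∀ ω ω', q ω ≠ 0 → q ω' ≠ 0 → (f ω = f ω' ↔ f' ω = f' ω')

theorem SameLevels.refl {Ω : Type*} (q : Ω → ℝ) (f : Ω → α) : SameLevels q f f :=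
  fun _ _ _ _ => Iff.rfl

theorem SameLevels.prodMk {Ω : Type*} {q : Ω → ℝ} {f : Ω → α} {f' : Ω → α'} {g : Ω → β}
    {g' : Ω → β'}    (hf : SameLevels q f f') (hg : SameLevels q g g') :
    SameLevels q (fun ω => (f ω, g ω)) (fun ω => (f' ω, g' ω)) := fun ω ω' h h' => by
  simp [hf ω ω' h h', hg ω ω' h h']

theorem SameLevels.law_eq {f : Ω → α} {f' : Ω → α'} (h : SameLevels q f f') {ω : Ω}
    (hω : q ω ≠ 0) : law q f (f ω) = law q f' (f' ω) :=
  law_congr fun ω' hω' => h ω' ω hω' hω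

theorem mutualInfo_congr {f : Ω → α} {f' : Ω → α'} {g : Ω → β} {g' : Ω → β'}
    (hf : SameLevels q f f') (hg : SameLevels q g g') :
    mutualInfo q f g = mutualInfo q f' g' := by
  unfold mutualInfo
  refine sum_congr rfl fun ω _ => ?_
  by_cases hω : q ω = 0
  · simp [hω]
  · rw [hf.law_eq hω, hg.law_eq hω, (hf.prodMk hg).law_eq hω]

theorem isMarkovChain_iff {f : Ω → α} {g : Ω → β} {h : Ω → γ} :
    IsMarkovChain q f g h ↔ ∀ ω₁ ω₂ ω₃, q ω₁ ≠ 0 → q ω₂ ≠ 0 → q ω₃ ≠ 0 →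
      law q (fun ω => (f ω, g ω, h ω)) (f ω₁, g ω₂, h ω₃) * law q g (g ω₂) =
        law q (fun ω => (f ω, g ω)) (f ω₁, g ω₂) * law q (fun ω => (g ω, h ω)) (g ω₂, h ω₃) := by
  constructor
  · intro H ω₁ ω₂ ω₃ _ _ _
    exact H _ _ _
  · intro H a b c
    by_cases ha : ∃ ω, q ω ≠ 0 ∧ f ω = a
    · by_cases hb : ∃ ω, q ω ≠ 0 ∧ g ω = b
      · by_cases hc : ∃ ω, q ω ≠ 0 ∧ h ω = c
        · obtain ⟨ω₁, h₁, rfl⟩ := ha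
          obtain ⟨ω₂, h₂, rfl⟩ := hb
          obtain ⟨ω₃, h₃, rfl⟩ := hc
          exact H _ _ _ h₁ h₂ h₃
        · push Not at hc
          rw [law_eq_zero (fun ω hω e => hc ω hω (by simp_all)),
            law_eq_zero (f := fun ω => (g ω, h ω)) (fun ω hω e => hc ω hω (by simp_all))]
          simp
      · push Not at hb
        rw [law_eq_zero (f := g) hb,
          law_eq_zero (f := fun ω => (g ω, h ω)) (fun ω hω e => hb ω hω (by simp_all))]
        simp
    · push Not at ha
      rw [law_eq_zero (fun ω hω e => ha ω hω (by simp_all)),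
        law_eq_zero (f := fun ω => (f ω, g ω)) (fun ω hω e => ha ω hω (by simp_all))]
      simp

theorem IsMarkovChain.congr {f : Ω → α} {g : Ω → β} {h : Ω → γ}
    {f' : Ω → α'} {g' : Ω → β'} {h' : Ω → γ'} (H : IsMarkovChain q f g h)
    (hf : SameLevels q f f') (hg : SameLevels q g g') (hh : SameLevels q h h') :
    IsMarkovChain q f' g' h' := by
  rw [isMarkovChain_iff] at H ⊢
  intro ω₁ ω₂ ω₃ h₁ h₂ h₃
  have := H ω₁ ω₂ ω₃ h₁ h₂ h₃
  rw [law_congr (f := fun ω => (f ω, g ω, h ω)) (f' := fun ω => (f' ω, g' ω, h' ω))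
      (a' := (f' ω₁, g' ω₂, h' ω₃))
      (fun ω hω => by simp [hf ω ω₁ hω h₁, hg ω ω₂ hω h₂, hh ω ω₃ hω h₃]),
    law_congr (f := g) (f' := g') (a' := g' ω₂) (fun ω hω => hg ω ω₂ hω h₂),
    law_congr (f := fun ω => (f ω, g ω)) (f' := fun ω => (f' ω, g' ω)) (a' := (f' ω₁, g' ω₂))
      (fun ω hω => by simp [hf ω ω₁ hω h₁, hg ω ω₂ hω h₂]),
    law_congr (f := fun ω => (g ω, h ω)) (f' := fun ω => (g' ω, h' ω)) (a' := (g' ω₂, h' ω₃))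
      (fun ω hω => by simp [hg ω ω₂ hω h₂, hh ω ω₃ hω h₃])] at this
  exact this

theorem isMarkovChain_law [Fintype α'] (F : Ω → α') (f : α' → α) (g : α' → β) (h : α' → γ) :
    IsMarkovChain (law q F) f g h ↔
      IsMarkovChain q (fun ω => f (F ω)) (fun ω => g (F ω)) (fun ω => h (F ω)) := by
  simp only [IsMarkovChain, law_law]

theorem mutualInfo_law [Fintype α'] (F : Ω → α') (f : α' → α) (g : α' → β) :
    mutualInfo (law q F) f g = mutualInfo q (fun ω => f (F ω)) (fun ω => g (F ω)) := by
  simp only [mutualInfo, law_law]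
  rw [sum_law_mul q F (fun a => Real.logb 2 (law q (fun ω => (f (F ω), g (F ω))) (f a, g a) /
    (law q (fun ω => f (F ω)) (f a) * law q (fun ω => g (F ω)) (g a))))]

/-- Exchange criterion for conditional independence: given two outcomes on which `g` agrees, one
can exchange the values of `h` without changing `f`, `g` and the product of the weights. -/
theorem IsMarkovChain.of_swap {f : Ω → α} {g : Ω → β} {h : Ω → γ} (σ : Ω → Ω → Ω)
    (hw : ∀ ω ω', g ω = g ω' → q (σ ω ω') * q (σ ω' ω) = q ω * q ω')
    (hf : ∀ ω ω', g ω = g ω' → f (σ ω ω') = f ω)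
    (hg : ∀ ω ω', g ω = g ω' → g (σ ω ω') = g ω)
    (hh : ∀ ω ω', g ω = g ω' → h (σ ω ω') = h ω')
    (hσ : ∀ ω ω', g ω = g ω' → σ (σ ω ω') (σ ω' ω) = ω) :
    IsMarkovChain q f g h := by
  intro a b c
  have key : ∀ (u v : Ω → Prop), (∑ ω, if u ω then q ω else 0) * (∑ ω, if v ω then q ω else 0) =
      ∑ z : Ω × Ω with u z.1 ∧ v z.2, q z.1 * q z.2 := by
    intro u v
    rw [sum_mul_sum, sum_filter, Fintype.sum_prod_type]
    refine sum_congr rfl fun x _ => sum_congr rfl fun y _ => ?_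
    by_cases hu : u x <;> by_cases hv : v y <;> simp [hu, hv]
  simp only [law]
  rw [key, key]
  refine sum_bij' (fun z _ => (σ z.1 z.2, σ z.2 z.1)) (fun z _ => (σ z.1 z.2, σ z.2 z.1))
    ?_ ?_ ?_ ?_ ?_
  · rintro ⟨x, y⟩ hz
    simp only [mem_filter, mem_univ, true_and, Prod.mk.injEq] at hz ⊢
    obtain ⟨⟨h1, h2, h3⟩, h4⟩ := hz
    have e : g x = g y := by rw [h2, h4]
    refine ⟨⟨?_, ?_⟩, ?_, ?_⟩
    · rw [hf _ _ e, h1]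
    · rw [hg _ _ e, h2]
    · rw [hg _ _ e.symm, h4]
    · rw [hh _ _ e.symm, h3]
  · rintro ⟨x, y⟩ hz
    simp only [mem_filter, mem_univ, true_and, Prod.mk.injEq] at hz ⊢
    obtain ⟨⟨h1, h2⟩, h3, h4⟩ := hz
    have e : g x = g y := by rw [h2, h3]
    refine ⟨⟨?_, ?_, ?_⟩, ?_⟩
    · rw [hf _ _ e, h1]
    · rw [hg _ _ e, h2]
    · rw [hh _ _ e, h4]
    · rw [hg _ _ e.symm, h3]
  · rintro ⟨x, y⟩ hz
    simp only [mem_filter, mem_univ, true_and, Prod.mk.injEq] at hz ⊢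
    obtain ⟨⟨h1, h2, h3⟩, h4⟩ := hz
    have e : g x = g y := by rw [h2, h4]
    exact ⟨hσ _ _ e, hσ _ _ e.symm⟩
  · rintro ⟨x, y⟩ hz
    simp only [mem_filter, mem_univ, true_and, Prod.mk.injEq] at hz ⊢
    obtain ⟨⟨h1, h2⟩, h3, h4⟩ := hz
    have e : g x = g y := by rw [h2, h3]
    exact ⟨hσ _ _ e, hσ _ _ e.symm⟩
  · rintro ⟨x, y⟩ hz
    simp only [mem_filter, mem_univ, true_and, Prod.mk.injEq] at hz ⊢
    obtain ⟨⟨h1, h2, h3⟩, h4⟩ := hz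
    have e : g x = g y := by rw [h2, h4]
    exact (hw _ _ e).symm

/-- The entropy of the random variable `f`, in bits. -/
def ent (q : Ω → ℝ) (f : Ω → α) : ℝ := -∑ ω, q ω * Real.logb 2 (law q f (f ω))

theorem ent_congr {f : Ω → α} {f' : Ω → α'} (h : SameLevels q f f') : ent q f = ent q f' := by
  unfold ent
  congr 1
  refine sum_congr rfl fun ω _ => ?_
  by_cases hω : q ω = 0
  · simp [hω]
  · rw [h.law_eq hω]

theorem mutualInfo_eq_ent (hq : ∀ ω, 0 ≤ q ω) (f : Ω → α) (g : Ω → β) :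
    mutualInfo q f g = ent q f + ent q g - ent q (fun ω => (f ω, g ω)) := by
  have : ∀ ω, q ω * Real.logb 2 (law q (fun ω' => (f ω', g ω')) (f ω, g ω) /
      (law q f (f ω) * law q g (g ω))) = -(q ω * Real.logb 2 (law q f (f ω))) -
      q ω * Real.logb 2 (law q g (g ω)) +
      q ω * Real.logb 2 (law q (fun ω' => (f ω', g ω')) (f ω, g ω)) := by
    intro ω
    by_cases hω : q ω = 0
    · simp [hω]
    · have h1 := (law_pos hq f hω).ne'
      have h2 := (law_pos hq g hω).ne'
      have h3 := (law_pos hq (fun ω' => (f ω', g ω')) hω).ne'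
      rw [Real.logb_div h3 (mul_ne_zero h1 h2), Real.logb_mul h1 h2]
      ring
  unfold mutualInfo ent
  rw [sum_congr rfl fun ω _ => this ω, sum_add_distrib, sum_sub_distrib, sum_neg_distrib]
  ring

theorem ent_eq_sum_negMulLog [Fintype α] (q : Ω → ℝ) (f : Ω → α) :
    ent q f = (∑ a, Real.negMulLog (law q f a)) / Real.log 2 := by
  unfold ent
  rw [← sum_law_mul q f (fun a => Real.logb 2 (law q f a)), ← sum_neg_distrib, sum_div]
  refine sum_congr rfl fun a _ => ?_
  rw [Real.negMulLog, Real.logb]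
  ring

/-- Gibbs' inequality: replacing the law of `f` by another subprobability weight inside the
logarithm can only increase the entropy. -/
theorem ent_le_of_sum_le_one [Fintype α] (hq : q ∈ stdSimplex ℝ Ω) (f : Ω → α) (r : α → ℝ)
    (hr0 : ∀ a, 0 ≤ r a) (hr1 : ∑ a, r a ≤ 1) (hr : ∀ ω, q ω ≠ 0 → r (f ω) ≠ 0) :
    ent q f ≤ -∑ ω, q ω * Real.logb 2 (r (f ω)) := by
  unfold ent
  rw [neg_le_neg_iff, ← sub_nonpos, ← sum_sub_distrib]
  have h2 : 0 < Real.log 2 := Real.log_pos one_lt_two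
  have key : ∀ ω, q ω * Real.logb 2 (r (f ω)) - q ω * Real.logb 2 (law q f (f ω)) ≤
      (q ω * (r (f ω) / law q f (f ω)) - q ω) / Real.log 2 := by
    intro ω
    by_cases hω : q ω = 0
    · simp [hω]
    · have h1 := law_pos hq.1 f hω
      have h3 : 0 < r (f ω) := lt_of_le_of_ne (hr0 _) (hr ω hω).symm
      rw [← mul_sub, ← Real.logb_div h3.ne' h1.ne', Real.logb, ← mul_div_assoc]
      refine div_le_div_of_nonneg_right ?_ h2.le
      have := Real.log_le_sub_one_of_pos (div_pos h3 h1)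
      nlinarith [hq.1 ω]
  refine (sum_le_sum fun ω _ => key ω).trans ?_
  rw [← sum_div, sum_sub_distrib, hq.2, ← sum_law_mul q f (fun a => r a / law q f a)]
  refine div_nonpos_of_nonpos_of_nonneg ?_ h2.le
  have : ∑ a, law q f a * (r a / law q f a) ≤ ∑ a, r a := by
    refine sum_le_sum fun a _ => ?_
    by_cases ha : law q f a = 0
    · simp [ha, hr0 a]
    · rw [mul_div_cancel₀ _ ha]
  linarith

theorem ent_le_logb_card [Fintype α] (hq : q ∈ stdSimplex ℝ Ω) (f : Ω → α) :
    ent q f ≤ Real.logb 2 (Fintype.card α) := by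
  have hΩ : Nonempty Ω := by
    by_contra h
    rw [not_nonempty_iff] at h
    simpa using hq.2
  have hα : Nonempty α := ⟨f hΩ.some⟩
  have hc : (0 : ℝ) < Fintype.card α := by exact_mod_cast Fintype.card_pos
  refine (ent_le_of_sum_le_one hq f (fun _ => (Fintype.card α : ℝ)⁻¹) (fun _ => by positivity)
    ?_ (fun _ _ => by positivity)).trans ?_
  · simp [hc.ne']
  · rw [← sum_mul, hq.2, Real.logb_inv]
    simp

/-- Conditioning reduces entropy: `H(f | g, h) ≤ H(f | g)`. -/
theorem ent_submodular [Fintype α] [Fintype β] [Fintype γ] (hq : q ∈ stdSimplex ℝ Ω)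
    (f : Ω → α) (g : Ω → β) (h : Ω → γ) :
    ent q (fun ω => (f ω, g ω, h ω)) + ent q g ≤
      ent q (fun ω => (f ω, g ω)) + ent q (fun ω => (g ω, h ω)) := by
  have H := ent_le_of_sum_le_one hq (fun ω => (f ω, g ω, h ω))
    (fun z => law q (fun ω => (f ω, g ω)) (z.1, z.2.1) * law q (fun ω => (g ω, h ω)) z.2 /
      law q g z.2.1) (fun z => div_nonneg (mul_nonneg (law_nonneg hq.1 _ _) (law_nonneg hq.1 _ _))
        (law_nonneg hq.1 _ _)) ?_ ?_
  · have : ∀ ω, q ω * Real.logb 2 (law q (fun ω => (f ω, g ω)) (f ω, g ω) *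
        law q (fun ω => (g ω, h ω)) (g ω, h ω) / law q g (g ω)) =
        q ω * Real.logb 2 (law q (fun ω => (f ω, g ω)) (f ω, g ω)) +
        q ω * Real.logb 2 (law q (fun ω => (g ω, h ω)) (g ω, h ω)) -
        q ω * Real.logb 2 (law q g (g ω)) := by
      intro ω
      by_cases hω : q ω = 0
      · simp [hω]
      · have h1 := (law_pos hq.1 (fun ω => (f ω, g ω)) hω).ne'
        have h2 := (law_pos hq.1 g hω).ne'
        have h3 := (law_pos hq.1 (fun ω => (g ω, h ω)) hω).ne'
        rw [Real.logb_div (mul_ne_zero h1 h3) h2, Real.logb_mul h1 h3]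
        ring
    rw [sum_congr rfl fun ω _ => this ω, sum_sub_distrib, sum_add_distrib] at H
    simp only [ent] at H ⊢
    linarith
  · rw [Fintype.sum_prod_type, sum_comm, Fintype.sum_prod_type]
    have : ∀ b, ∑ c, ∑ a, law q (fun ω => (f ω, g ω)) (a, b) * law q (fun ω => (g ω, h ω)) (b, c) /
        law q g b ≤ law q g b := by
      intro b
      simp_rw [← sum_div, ← sum_mul]
      rw [← law_snd_eq_sum, ← mul_sum, ← law_fst_eq_sum]
      by_cases hb : law q g b = 0
      · simp [hb]
      · rw [mul_div_cancel_right₀ _ hb]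
    refine (sum_le_sum fun b _ => this b).trans ?_
    rw [sum_law, hq.2]
  · intro ω hω
    have h1 := (law_pos hq.1 (fun ω => (f ω, g ω)) hω).ne'
    have h2 := (law_pos hq.1 g hω).ne'
    have h3 := (law_pos hq.1 (fun ω => (g ω, h ω)) hω).ne'
    exact div_ne_zero (mul_ne_zero h1 h3) h2

/-- Equality holds in `ent_submodular` for a Markov chain. -/
theorem IsMarkovChain.ent_eq {f : Ω → α} {g : Ω → β} {h : Ω → γ} (hq : ∀ ω, 0 ≤ q ω)
    (H : IsMarkovChain q f g h) :
    ent q (fun ω => (f ω, g ω, h ω)) + ent q g =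
      ent q (fun ω => (f ω, g ω)) + ent q (fun ω => (g ω, h ω)) := by
  unfold ent
  rw [← neg_add, ← neg_add, ← sum_add_distrib, ← sum_add_distrib]
  congr 1
  refine sum_congr rfl fun ω _ => ?_
  by_cases hω : q ω = 0
  · simp [hω]
  · have h1 := (law_pos hq (fun ω => (f ω, g ω)) hω).ne'
    have h2 := (law_pos hq g hω).ne'
    have h3 := (law_pos hq (fun ω => (g ω, h ω)) hω).ne'
    have h4 := (law_pos hq (fun ω => (f ω, g ω, h ω)) hω).ne'
    rw [← mul_add, ← mul_add, ← Real.logb_mul h4 h2, ← Real.logb_mul h1 h3, H]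

theorem ent_const (hq : ∑ ω, q ω = 1) (a : α) : ent q (fun _ => a) = 0 := by
  simp [ent, law, hq]

theorem ent_pair_le [Fintype α] [Fintype β] (hq : q ∈ stdSimplex ℝ Ω) (f : Ω → α) (g : Ω → β) :
    ent q (fun ω => (f ω, g ω)) ≤ ent q f + ent q g := by
  have := ent_submodular hq f (fun _ => ()) g
  rw [ent_const hq.2, ent_congr (f := fun ω => (f ω, (), g ω)) (f' := fun ω => (f ω, g ω))
    (fun _ _ _ _ => by simp), ent_congr (f := fun ω => (f ω, ())) (f' := f)
    (fun _ _ _ _ => by simp), ent_congr (f := fun ω => ((), g ω)) (f' := g)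
    (fun _ _ _ _ => by simp)] at this
  linarith

end Basics

/-! ### Product weights -/

section Product

variable {ι Ω α : Type*} [Fintype ι] [DecidableEq ι] [Fintype Ω]

/-- The law of a family of independent outcomes, each with law `q`. -/
def iid (ι : Type*) [Fintype ι] (q : Ω → ℝ) (x : ι → Ω) : ℝ := ∏ i, q (x i)

theorem sum_iid_mul_prod (q : Ω → ℝ) (G : ι → Ω → ℝ) :
    ∑ x, iid ι q x * ∏ i, G i (x i) = ∏ i, ∑ ω, q ω * G i ω := by
  rw [prod_univ_sum, Fintype.piFinset_univ]
  refine sum_congr rfl fun x _ => ?_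
  rw [iid, prod_mul_distrib]

theorem iid_mem_stdSimplex {q : Ω → ℝ} (hq : q ∈ stdSimplex ℝ Ω) :
    iid ι q ∈ stdSimplex ℝ (ι → Ω) := by
  refine ⟨fun x => prod_nonneg fun i _ => hq.1 _, ?_⟩
  have := sum_iid_mul_prod (ι := ι) q (fun _ _ => 1)
  simpa [hq.2] using this

theorem sum_iid_mul_apply {q : Ω → ℝ} (hq : q ∈ stdSimplex ℝ Ω) (i : ι) (F : Ω → ℝ) :
    ∑ x, iid ι q x * F (x i) = ∑ ω, q ω * F ω := by
  have := sum_iid_mul_prod (ι := ι) q (fun j ω => if j = i then F ω else 1)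
  simp only [prod_ite_eq' univ i, mem_univ, if_true] at this
  rw [this, prod_eq_single i]
  · simp
  · intro j _ hj
    simp [hj, hq.2]
  · simp

theorem sum_iid_mul_apply_mul {q : Ω → ℝ} (hq : q ∈ stdSimplex ℝ Ω) {i j : ι} (hij : i ≠ j)
    (F G : Ω → ℝ) :
    ∑ x, iid ι q x * (F (x i) * G (x j)) = (∑ ω, q ω * F ω) * ∑ ω, q ω * G ω := by
  have := sum_iid_mul_prod (ι := ι) q
    (fun k ω => (if k = i then F ω else 1) * (if k = j then G ω else 1))
  simp only [prod_mul_distrib, prod_ite_eq' univ, mem_univ, if_true] at this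
  rw [this, ← mul_prod_erase univ _ (mem_univ i),
    ← mul_prod_erase (univ.erase i) _ (mem_erase.2 ⟨hij.symm, mem_univ j⟩), prod_eq_one]
  · simp [hij, hij.symm]
  · intro k hk
    simp only [mem_erase, mem_univ, and_true] at hk
    simp [hk.1, hk.2, hq.2]

theorem law_iid (q : Ω → ℝ) (f : Ω → α) (a : ι → α) :
    law (iid ι q) (fun x i => f (x i)) a = iid ι (law q f) a := by
  have := sum_iid_mul_prod (ι := ι) q (fun i ω => if f ω = a i then 1 else 0)
  simp only [mul_ite, mul_one, mul_zero] at this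
  rw [iid]
  simp only [law]
  rw [← this]
  refine sum_congr rfl fun x _ => ?_
  by_cases h : (fun i => f (x i)) = a
  · subst h
    simp
  · rw [if_neg h]
    obtain ⟨i, hi⟩ := Function.ne_iff.1 h
    rw [prod_eq_zero (mem_univ i) (by simp [hi]), mul_zero]

theorem law_iid_apply {q : Ω → ℝ} (hq : q ∈ stdSimplex ℝ Ω) (i : ι) (f : Ω → α) (a : α) :
    law (iid ι q) (fun x => f (x i)) a = law q f a := by
  have := sum_iid_mul_apply hq i (fun ω => if f ω = a then 1 else 0)
  simpa [law] using this

theorem ent_iid {q : Ω → ℝ} (hq : q ∈ stdSimplex ℝ Ω) (f : Ω → α) :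
    ent (iid ι q) (fun x i => f (x i)) = Fintype.card ι * ent q f := by
  have key : ∀ x : ι → Ω, iid ι q x * Real.logb 2 (law (iid ι q) (fun x i => f (x i))
      (fun i => f (x i))) = ∑ i, iid ι q x * Real.logb 2 (law q f (f (x i))) := by
    intro x
    rw [law_iid, ← mul_sum]
    by_cases hx : iid ι q x = 0
    · simp [hx]
    · congr 1
      rw [iid, Real.logb, Real.log_prod, sum_div]
      · rfl
      · intro i _
        exact (law_pos hq.1 f (prod_ne_zero_iff.1 hx i (mem_univ i))).ne'
  unfold ent
  rw [sum_congr rfl fun x _ => key x, sum_comm]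
  simp_rw [sum_iid_mul_apply hq _ (fun ω => Real.logb 2 (law q f (f ω)))]
  simp

end Product

/-! ### Test channels on arbitrary finite probability spaces -/

section TestChannel

variable {Ω X₁ X₂ X'₁ X'₂ : Type*} [Fintype Ω] {K : ℕ} {A B : Fin K → Type*}

/-- The conditions that define the tradeoff region for `Y₁ = X₁ = V`, `Y₂ = X₂ = W`, for auxiliary
variables `U` with arbitrary alphabets that live on an arbitrary finite probability space. -/
structure IsTestChannel (p : X₁ × X₂ → ℝ) (d₁ : X₁ → X'₁ → ℝ) (d₂ : X₂ → X'₂ → ℝ)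
    (q : Ω → ℝ) (V : Ω → X₁) (W : Ω → X₂) (U : Ω → (l : Fin K) → A l) (t : ℝ × ℝ × ℝ × ℝ) :
    Prop where
  mem : q ∈ stdSimplex ℝ Ω
  law_eq : ∀ s, law q (fun ω => (V ω, W ω)) s = p s
  markov_odd : ∀ l : Fin K, Odd (l : ℕ) →
    IsMarkovChain q V (fun ω => (past l (U ω), W ω)) (fun ω => U ω l)
  markov_even : ∀ l : Fin K, Even (l : ℕ) →
    IsMarkovChain q W (fun ω => (past l (U ω), V ω)) (fun ω => U ω l)
  info₁ : mutualInfo q V (fun ω => (U ω, W ω)) ≤ t.1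
  info₂ : mutualInfo q W (fun ω => (U ω, V ω)) ≤ t.2.1
  dist₁ : ∃ g₁ : X₂ → ((l : Fin K) → A l) → X'₁, ∑ ω, q ω * d₁ (V ω) (g₁ (W ω) (U ω)) ≤ t.2.2.1
  dist₂ : ∃ g₂ : X₁ → ((l : Fin K) → A l) → X'₂, ∑ ω, q ω * d₂ (W ω) (g₂ (V ω) (U ω)) ≤ t.2.2.2

variable {p : X₁ × X₂ → ℝ} {d₁ : X₁ → X'₁ → ℝ} {d₂ : X₂ → X'₂ → ℝ}
  {q : Ω → ℝ} {V : Ω → X₁} {W : Ω → X₂} {U : Ω → (l : Fin K) → A l} {t : ℝ × ℝ × ℝ × ℝ}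

/-- Relabelling the auxiliary alphabets injectively, as far as the support of `q` is concerned. -/
theorem IsTestChannel.relabel (h : IsTestChannel p d₁ d₂ q V W U t) (e : (l : Fin K) → A l → B l)
    (e' : (l : Fin K) → B l → A l) (he : ∀ ω, q ω ≠ 0 → ∀ l, e' l (e l (U ω l)) = U ω l) :
    IsTestChannel p d₁ d₂ q V W (fun ω l => e l (U ω l)) t := by
  have h1 : ∀ l, SameLevels q (fun ω => U ω l) (fun ω => e l (U ω l)) := fun l ω ω' hω hω' =>
    ⟨fun H => by simp only [H], fun H => by
      dsimp only at H ⊢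
      rw [← he ω hω l, ← he ω' hω' l, H]⟩
  have h2 : SameLevels q U (fun ω l => e l (U ω l)) := fun ω ω' hω hω' =>
    ⟨fun H => by simp only [H], fun H => funext fun l => (h1 l ω ω' hω hω').2 (congrFun H l)⟩
  have h3 : ∀ l, SameLevels q (fun ω => past l (U ω)) (fun ω => past l (fun l => e l (U ω l))) :=
    fun l ω ω' hω hω' =>
    ⟨fun H => funext fun j => (h1 j ω ω' hω hω').1 (congrFun H j),
      fun H => funext fun j => (h1 j ω ω' hω hω').2 (congrFun H j)⟩
  refine ⟨h.mem, h.law_eq, fun l hl => ?_, fun l hl => ?_, ?_, ?_, ?_, ?_⟩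
  · exact (h.markov_odd l hl).congr (.refl _ _) ((h3 l).prodMk (.refl _ _)) (h1 l)
  · exact (h.markov_even l hl).congr (.refl _ _) ((h3 l).prodMk (.refl _ _)) (h1 l)
  · rw [← mutualInfo_congr (.refl _ _) (h2.prodMk (.refl _ _))]
    exact h.info₁
  · rw [← mutualInfo_congr (.refl _ _) (h2.prodMk (.refl _ _))]
    exact h.info₂
  · obtain ⟨g, hg⟩ := h.dist₁
    refine ⟨fun x u => g x (fun l => e' l (u l)), le_of_eq_of_le (sum_congr rfl fun ω _ => ?_) hg⟩
    by_cases hω : q ω = 0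
    · simp [hω]
    · simp only [he ω hω]
  · obtain ⟨g, hg⟩ := h.dist₂
    refine ⟨fun x u => g x (fun l => e' l (u l)), le_of_eq_of_le (sum_congr rfl fun ω _ => ?_) hg⟩
    by_cases hω : q ω = 0
    · simp [hω]
    · simp only [he ω hω]

theorem law_duplicate (hV : ∀ s, law q (fun ω => (V ω, W ω)) s = p s) (s : X₁ × X₁ × X₂ × X₂) :
    law q (fun ω => (V ω, V ω, W ω, W ω)) s = privateEqPublic p s := by
  obtain ⟨a, b, c, d⟩ := s
  unfold privateEqPublic
  dsimp only
  split_ifs with h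
  · obtain ⟨rfl, rfl⟩ := h
    rw [← hV]
    exact law_congr fun ω _ => by simp
  · refine law_eq_zero fun ω _ e => h ?_
    simp only [Prod.mk.injEq] at e
    obtain ⟨h1, h2, h3, h4⟩ := e
    exact ⟨h2.symm.trans h1, h4.symm.trans h3⟩

variable [Fintype X₁] [Fintype X₂]

theorem IsTestChannel.mem_tradeoffTuples {m : Fin K → ℕ} {U : Ω → (l : Fin K) → Fin (m l)}
    (h : IsTestChannel p d₁ d₂ q V W U t) :
    t ∈ tradeoffTuples (privateEqPublic p) d₁ d₂ m := by
  obtain ⟨g₁, hg₁⟩ := h.dist₁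
  obtain ⟨g₂, hg₂⟩ := h.dist₂
  refine ⟨law q (fun ω => ((V ω, V ω, W ω, W ω), U ω)), law_mem_stdSimplex h.mem _, g₁, g₂,
    fun s => ?_, fun l hl => ?_, fun l hl => ?_, ?_, ?_, ?_, ?_⟩
  · rw [← law_fst_eq_sum, law_duplicate h.law_eq]
  · rw [isMarkovChain_law]
    exact h.markov_odd l hl
  · rw [isMarkovChain_law]
    exact h.markov_even l hl
  · rw [mutualInfo_law]
    exact h.info₁
  · rw [mutualInfo_law]
    exact h.info₂
  · rw [sum_law_mul q _ (fun z : (X₁ × X₁ × X₂ × X₂) × ((l : Fin K) → Fin (m l)) =>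
      d₁ z.1.1 (g₁ z.1.2.2.1 z.2))]
    exact hg₁
  · rw [sum_law_mul q _ (fun z : (X₁ × X₁ × X₂ × X₂) × ((l : Fin K) → Fin (m l)) =>
      d₂ z.1.2.2.1 (g₂ z.1.1 z.2))]
    exact hg₂

theorem isTestChannel_of_mem_tradeoffTuples {m : Fin K → ℕ}
    (h : t ∈ tradeoffTuples (privateEqPublic p) d₁ d₂ m) :
    ∃ q : (X₁ × X₁ × X₂ × X₂) × ((l : Fin K) → Fin (m l)) → ℝ,
      IsTestChannel p d₁ d₂ q (fun ω => ω.1.1) (fun ω => ω.1.2.2.1) (fun ω => ω.2) t := by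
  obtain ⟨q, hq, g₁, g₂, hP, hodd, heven, h1, h2, h3, h4⟩ := h
  have hsupp : ∀ ω, q ω ≠ 0 → ω.1.2.1 = ω.1.1 ∧ ω.1.2.2.2 = ω.1.2.2.1 := by
    rintro ⟨s, u⟩ hω
    by_contra hc
    have h0 := hP s
    rw [privateEqPublic, if_neg hc, sum_eq_zero_iff_of_nonneg (fun _ _ => hq.1 _)] at h0
    exact hω (h0 u (mem_univ u))
  have e1 : SameLevels q (fun ω => ω.1.2.1) (fun ω => ω.1.1) := fun ω ω' hω hω' => by
    dsimp only
    rw [(hsupp ω hω).1, (hsupp ω' hω').1]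
  have e2 : SameLevels q (fun ω => ω.1.2.2.2) (fun ω => ω.1.2.2.1) := fun ω ω' hω hω' => by
    dsimp only
    rw [(hsupp ω hω).2, (hsupp ω' hω').2]
  refine ⟨q, hq, ?_, fun l hl => ?_, fun l hl => ?_, ?_, ?_, ⟨g₁, h3⟩, ⟨g₂, h4⟩⟩
  · rintro ⟨a, b⟩
    have : p (a, b) = privateEqPublic p (a, a, b, b) := by simp [privateEqPublic]
    rw [this, ← hP]
    rw [law_congr (f' := fun ω => ω.1) (a' := (a, a, b, b)), law_fst_eq_sum q _ (fun ω => ω.2)]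
    · refine sum_congr rfl fun u _ => ?_
      simp [law]
    · intro ω hω
      obtain ⟨⟨a', b', c', d'⟩, u⟩ := ω
      have := hsupp _ hω
      dsimp only at this
      obtain ⟨rfl, rfl⟩ := this
      simp
  · exact (hodd l hl).congr e1 (.refl _ _) (.refl _ _)
  · exact (heven l hl).congr e2 (.refl _ _) (.refl _ _)
  · rw [← mutualInfo_congr e1 (.refl _ _)]
    exact h1
  · rw [← mutualInfo_congr e2 (.refl _ _)]
    exact h2

theorem IsTestChannel.mem_tradeoffRegion [∀ l, Fintype (A l)]
    (h : IsTestChannel p d₁ d₂ q V W U t) :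
    t ∈ tradeoffRegion K (privateEqPublic p) d₁ d₂ :=
  Set.mem_iUnion.2 ⟨fun l => Fintype.card (A l),
    (h.relabel (fun l => Fintype.equivFin (A l)) (fun l => (Fintype.equivFin (A l)).symm)
      (fun ω _ l => by simp)).mem_tradeoffTuples⟩

/-- The alphabet sizes may be taken to be the sizes of sets that support the auxiliary
variables. -/
theorem IsTestChannel.mem_tradeoffTuples_card (h : IsTestChannel p d₁ d₂ q V W U t)
    (T : (l : Fin K) → Finset (A l)) (hT : ∀ ω, q ω ≠ 0 → ∀ l, U ω l ∈ T l) :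
    t ∈ tradeoffTuples (privateEqPublic p) d₁ d₂ (fun l => (T l).card) := by
  obtain ⟨ω₀, hω₀⟩ : ∃ ω, q ω ≠ 0 := by
    by_contra hc
    push Not at hc
    simpa [hc] using h.mem.2
  refine (h.relabel (B := fun l => Fin (T l).card)
    (fun l a => (T l).equivFin (if ha : a ∈ T l then ⟨a, ha⟩ else ⟨U ω₀ l, hT ω₀ hω₀ l⟩))
    (fun l b => ((T l).equivFin.symm b : T l)) (fun ω hω l => ?_)).mem_tradeoffTuples
  simp [hT ω hω l]

end TestChannel

/-! ### Cardinality bounds on the auxiliary alphabets -/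

/-- Basic solutions of linear programs: a nonnegative vector can be replaced by one whose support
has at most as many elements as there are equality constraints, without increasing the objective.
The weights `y` combine the constraints into one that bounds the feasible set. -/
theorem exists_basic_solution {ι κ : Type*} [Fintype ι] [Fintype κ] (A : κ → ι → ℝ) (c : ι → ℝ)
    (y : κ → ℝ) (r₀ : ι → ℝ) (h0 : ∀ i, 0 ≤ r₀ i)
    (hy : ∀ i, r₀ i ≠ 0 → 0 < ∑ k, y k * A k i) :
    ∃ r : ι → ℝ, (∀ i, 0 ≤ r i) ∧ (∀ i, r i ≠ 0 → r₀ i ≠ 0) ∧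
      (∀ k, ∑ i, A k i * r i = ∑ i, A k i * r₀ i) ∧ ∑ i, c i * r i ≤ ∑ i, c i * r₀ i ∧
      (univ.filter fun i => r i ≠ 0).card ≤ Fintype.card κ := by
  induction hN : (univ.filter fun i => r₀ i ≠ 0).card using Nat.strong_induction_on
    generalizing r₀ with
  | _ N ih =>
  by_cases hle : N ≤ Fintype.card κ
  · exact ⟨r₀, h0, fun _ h => h, fun _ => rfl, le_rfl, hN ▸ hle⟩
  push Not at hle
  -- more variables than constraints: a direction that keeps the constraints and, up to its sign,
  -- does not increase the objective
  obtain ⟨v, hv0, hvA, hvs, hvc⟩ : ∃ v : ι → ℝ, v ≠ 0 ∧ (∀ k, ∑ i, A k i * v i = 0) ∧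
      (∀ i, r₀ i = 0 → v i = 0) ∧ ∑ i, c i * v i ≤ 0 := by
    set S := univ.filter fun i => r₀ i ≠ 0 with hS
    let L : (S → ℝ) →ₗ[ℝ] (κ → ℝ) :=
      LinearMap.pi fun k => ∑ i : S, A k i • LinearMap.proj (R := ℝ) (φ := fun _ : S => ℝ) i
    have hL : ∀ w k, L w k = ∑ i : S, A k i * w i := by
      intro w k
      simp [L]
    have hker : LinearMap.ker L ≠ ⊥ := LinearMap.ker_ne_bot_of_finrank_lt (by simpa [hN] using hle)
    obtain ⟨w, hw, hw0⟩ := (Submodule.ne_bot_iff _).1 hker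
    let v : ι → ℝ := fun i => if h : i ∈ S then w ⟨i, h⟩ else 0
    have hsum : ∀ a : ι → ℝ, ∑ i, a i * v i = ∑ i : S, a i * w i := by
      intro a
      rw [← sum_subset (subset_univ S) (fun i _ hi => by simp [v, hi]),
        ← sum_attach, univ_eq_attach]
      exact sum_congr rfl fun i _ => by simp [v]
    have hv0 : v ≠ 0 := by
      intro h
      apply hw0
      funext i
      have := congrFun h i
      simpa [v] using this
    have hvA : ∀ k, ∑ i, A k i * v i = 0 := fun k => by
      rw [hsum, ← hL, LinearMap.mem_ker.1 hw]
      rfl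
    have hvs : ∀ i, r₀ i = 0 → v i = 0 := fun i hi => by simp [v, S, hi]
    rcases le_total (∑ i, c i * v i) 0 with h | h
    · exact ⟨v, hv0, hvA, hvs, h⟩
    · exact ⟨-v, neg_ne_zero.2 hv0, fun k => by simp [hvA], fun i hi => by simp [hvs i hi],
        by simpa using h⟩
  -- since the feasible set is bounded, moving along `v` eventually makes a coordinate vanish
  have hneg : ∃ i, v i < 0 := by
    by_contra hc
    push Not at hc
    have h1 : ∑ i, v i * ∑ k, y k * A k i = 0 := by
      simp_rw [mul_sum]
      rw [sum_comm]
      refine sum_eq_zero fun k _ => ?_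
      rw [← mul_zero (y k), ← hvA k, mul_sum]
      exact sum_congr rfl fun i _ => by ring
    have hnn : ∀ i ∈ univ, 0 ≤ v i * ∑ k, y k * A k i := fun i _ => by
      by_cases hi : r₀ i = 0
      · simp [hvs i hi]
      · exact mul_nonneg (hc i) (hy i hi).le
    refine hv0 (funext fun i => ?_)
    have h2 := (sum_eq_zero_iff_of_nonneg hnn).1 h1 i (mem_univ i)
    by_cases hi : r₀ i = 0
    · exact hvs i hi
    · exact (mul_eq_zero.1 h2).resolve_right (hy i hi).ne'
  obtain ⟨i₀, hi₀, hmin⟩ := exists_min_image (univ.filter fun i => v i < 0)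
    (fun i => r₀ i / -v i) (by obtain ⟨i, hi⟩ := hneg; exact ⟨i, by simp [hi]⟩)
  simp only [mem_filter, mem_univ, true_and] at hi₀ hmin
  set s := r₀ i₀ / -v i₀ with hs
  have hs0 : 0 ≤ s := div_nonneg (h0 _) (by linarith)
  have hr : ∀ i, 0 ≤ r₀ i + s * v i := by
    intro i
    by_cases hi : v i < 0
    · have := (le_div_iff₀ (by linarith : 0 < -v i)).1 (hmin i hi)
      linarith
    · push Not at hi
      have := h0 i
      positivity
  have hz : r₀ i₀ + s * v i₀ = 0 := by
    rw [hs, div_neg, neg_mul, div_mul_cancel₀ _ hi₀.ne]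
    ring
  have hsub : ∀ i, r₀ i + s * v i ≠ 0 → r₀ i ≠ 0 := fun i h h' => h (by simp [h', hvs i h'])
  have hlt : (univ.filter fun i => r₀ i + s * v i ≠ 0).card < N := by
    rw [← hN]
    refine card_lt_card ⟨fun i hi => ?_, fun h => ?_⟩
    · simp only [mem_filter, mem_univ, true_and] at hi ⊢
      exact hsub i hi
    · have h1 : i₀ ∈ univ.filter fun i => r₀ i ≠ 0 := by
        simp only [mem_filter, mem_univ, true_and]
        intro h'
        rw [hvs i₀ h'] at hi₀
        exact lt_irrefl _ hi₀
      have := h h1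
      simp [hz] at this
  obtain ⟨r, h1, h2, h3, h4, h5⟩ := ih _ hlt (fun i => r₀ i + s * v i) hr
    (fun i hi => hy i (hsub i hi)) rfl
  have e : ∀ a : ι → ℝ, ∑ i, a i * (r₀ i + s * v i) = ∑ i, a i * r₀ i + s * ∑ i, a i * v i := by
    intro a
    rw [mul_sum, ← sum_add_distrib]
    exact sum_congr rfl fun i _ => by ring
  refine ⟨r, h1, fun i hi => hsub i (h2 i hi), fun k => ?_, h4.trans ?_, h5⟩
  · rw [h3, e, hvA, mul_zero, add_zero]
  · rw [e]
    nlinarith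

section Reweight

variable {Ω α β γ ζ : Type*} [Fintype Ω] {q : Ω → ℝ}

theorem law_reweight {F : Ω → α} {a : α} {h : Ω → γ} {r : γ → ℝ} {c : γ}
    (hF : ∀ ω, F ω = a → h ω = c) : law (fun ω => q ω * r (h ω)) F a = law q F a * r c := by
  unfold law
  rw [sum_mul]
  refine sum_congr rfl fun ω _ => ?_
  by_cases hω : F ω = a
  · simp [hω, hF ω hω]
  · simp [hω]

/-- If `g` determines the variable `h` that is reweighted, the Markov property persists. -/
theorem IsMarkovChain.reweight_of_determined {h : Ω → γ} {r : γ → ℝ} {f : Ω → α} {g : Ω → β}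
    {f' : Ω → ζ} (H : IsMarkovChain q f g f') (hg : ∀ ω ω', g ω = g ω' → h ω = h ω') :
    IsMarkovChain (fun ω => q ω * r (h ω)) f g f' := by
  rw [isMarkovChain_iff]
  intro ω₁ ω₂ ω₃ _ _ _
  rw [law_reweight (F := fun ω => (f ω, g ω, f' ω)) (c := h ω₂)
      (fun ω hω => hg _ _ (by simp_all)),
    law_reweight (F := g) (c := h ω₂) (fun ω hω => hg _ _ hω),
    law_reweight (F := fun ω => (f ω, g ω)) (c := h ω₂) (fun ω hω => hg _ _ (by simp_all)),
    law_reweight (F := fun ω => (g ω, f' ω)) (c := h ω₂) (fun ω hω => hg _ _ (by simp_all))]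
  linear_combination (r (h ω₂)) ^ 2 * H (f ω₁) (g ω₂) (f' ω₃)

/-- The mutual information is linear in the weights `r` of a variable determined by `g`. -/
theorem mutualInfo_reweight {f : Ω → α} {g : Ω → β} {h : Ω → γ} {r : γ → ℝ}
    (hf : ∀ a, law (fun ω => q ω * r (h ω)) f a = law q f a)
    (hg : ∀ ω ω', g ω = g ω' → h ω = h ω') :
    mutualInfo (fun ω => q ω * r (h ω)) f g = ∑ ω, q ω * r (h ω) *
      Real.logb 2 (law q (fun ω' => (f ω', g ω')) (f ω, g ω) /
        (law q f (f ω) * law q g (g ω))) := by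
  unfold mutualInfo
  refine sum_congr rfl fun ω _ => ?_
  by_cases hω : q ω * r (h ω) = 0
  · simp [hω]
  · rw [hf, law_reweight (F := fun ω => (f ω, g ω)) (c := h ω) (fun ω hω => hg _ _ (by simp_all)),
      law_reweight (F := g) (c := h ω) (fun ω hω => hg _ _ hω), ← mul_assoc,
      mul_div_mul_right _ _ (right_ne_zero_of_mul hω)]

variable [Fintype γ]

/-- Reweighting the end point `h` of a Markov chain `f ↔ g ↔ h` without changing the law of `g`
does not change the joint law of `f` and `g`. -/
theorem law_reweight_of_markov (hq : ∀ ω, 0 ≤ q ω) {f : Ω → α} {g : Ω → β} {h : Ω → γ} {r : γ → ℝ}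
    (H : IsMarkovChain q f g h)
    (hr : ∀ b, ∑ c, law q (fun ω => (g ω, h ω)) (b, c) * r c = law q g b) (a : α) (b : β) :
    law (fun ω => q ω * r (h ω)) (fun ω => (f ω, g ω)) (a, b) =
      law q (fun ω => (f ω, g ω)) (a, b) := by
  rw [law_fst_eq_sum _ _ h]
  have h1 : ∀ c, law (fun ω => q ω * r (h ω)) (fun ω => ((f ω, g ω), h ω)) ((a, b), c) =
      law q (fun ω => (f ω, g ω, h ω)) (a, b, c) * r c := by
    intro c
    rw [law_reweight (c := c) (fun ω hω => (Prod.mk.inj hω).2)]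
    congr 1
    exact law_congr fun ω _ => by simp [and_assoc]
  simp_rw [h1]
  by_cases hb : law q g b = 0
  · have h2 : law q (fun ω => (f ω, g ω)) (a, b) = 0 :=
      le_antisymm (hb ▸ law_mono hq (fun ω hω => (Prod.mk.inj hω).2)) (law_nonneg hq _ _)
    have h3 : ∀ c, law q (fun ω => (f ω, g ω, h ω)) (a, b, c) = 0 := fun c =>
      le_antisymm (hb ▸ law_mono hq (fun ω hω => by simp_all)) (law_nonneg hq _ _)
    simp [h2, h3]
  · apply mul_right_cancel₀ hb
    rw [sum_mul]
    have h4 : ∀ c, law q (fun ω => (f ω, g ω, h ω)) (a, b, c) * r c * law q g b =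
        law q (fun ω => (f ω, g ω)) (a, b) *
          (law q (fun ω => (g ω, h ω)) (b, c) * r c) := fun c => by
      linear_combination r c * H a b c
    rw [sum_congr rfl fun c _ => h4 c, ← mul_sum, hr]

theorem IsMarkovChain.reweight_self (hq : ∀ ω, 0 ≤ q ω) {f : Ω → α} {g : Ω → β} {h : Ω → γ}
    {r : γ → ℝ} (H : IsMarkovChain q f g h)
    (hr : ∀ b, ∑ c, law q (fun ω => (g ω, h ω)) (b, c) * r c = law q g b) :
    IsMarkovChain (fun ω => q ω * r (h ω)) f g h := by
  intro a b c
  have h1 : law (fun ω => q ω * r (h ω)) g b = law q g b := by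
    rw [law_fst_eq_sum _ _ h, ← hr]
    exact sum_congr rfl fun c _ => law_reweight fun ω hω => (Prod.mk.inj hω).2
  rw [law_reweight (c := c) (fun ω hω => by simp_all), law_reweight_of_markov hq H hr, h1,
    law_reweight (F := fun ω => (g ω, h ω)) (c := c) (fun ω hω => by simp_all)]
  linear_combination r c * H a b c

/-- Weights on the alphabet of `h` with few atoms that keep the law of `g`, the expectations of
three functions, and do not increase the expectation of a fourth one. -/
theorem exists_reweight (hq : ∀ ω, 0 ≤ q ω) (g : Ω → β) (h : Ω → γ) (G : Finset β)
    (hG : ∀ ω, q ω ≠ 0 → g ω ∈ G) (φ : Fin 3 → Ω → ℝ) (ψ : Ω → ℝ) :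
    ∃ r : γ → ℝ, (∀ c, 0 ≤ r c) ∧
      (∀ b, ∑ c, law q (fun ω => (g ω, h ω)) (b, c) * r c = law q g b) ∧
      (∀ k, ∑ ω, q ω * r (h ω) * φ k ω = ∑ ω, q ω * φ k ω) ∧
      ∑ ω, q ω * r (h ω) * ψ ω ≤ ∑ ω, q ω * ψ ω ∧
      (univ.filter fun c => r c ≠ 0).card ≤ G.card + 3 ∧
      ∀ c, r c ≠ 0 → ∃ ω, q ω ≠ 0 ∧ h ω = c := by
  have lin : ∀ (r : γ → ℝ) (F : Ω → ℝ), ∑ ω, q ω * r (h ω) * F ω =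
      ∑ c, (∑ ω, if h ω = c then q ω * F ω else 0) * r c := by
    intro r F
    simp_rw [sum_mul]
    rw [sum_comm]
    refine sum_congr rfl fun ω _ => ?_
    simp only [ite_mul, zero_mul, sum_ite_eq, mem_univ, if_true]
    ring
  set r₀ : γ → ℝ := fun c => if law q h c = 0 then 0 else 1 with hr₀
  have hr₀1 : ∀ ω, q ω ≠ 0 → r₀ (h ω) = 1 := fun ω hω => by
    simp [hr₀, (law_pos hq h hω).ne']
  have lin₀ : ∀ F : Ω → ℝ, ∑ c, (∑ ω, if h ω = c then q ω * F ω else 0) * r₀ c =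
      ∑ ω, q ω * F ω := by
    intro F
    rw [← lin]
    refine sum_congr rfl fun ω _ => ?_
    by_cases hω : q ω = 0
    · simp [hω]
    · rw [hr₀1 ω hω, mul_one]
  have hy : ∀ c, r₀ c ≠ 0 → 0 < ∑ k : G ⊕ Fin 3, Sum.elim (fun _ => (1 : ℝ)) (fun _ => 0) k *
      Sum.elim (fun (b : G) c => law q (fun ω => (g ω, h ω)) (b.1, c))
        (fun k c => ∑ ω, if h ω = c then q ω * φ k ω else 0) k c := by
    intro c hc
    simp only [hr₀, ne_eq, ite_eq_left_iff, one_ne_zero, imp_false, not_not] at hc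
    simp only [Fintype.sum_sum_type, Sum.elim_inl, Sum.elim_inr, one_mul, zero_mul,
      sum_const_zero, add_zero]
    obtain ⟨ω, hω, rfl⟩ := exists_of_law_ne_zero hc
    refine lt_of_lt_of_le (law_pos hq (fun ω => (g ω, h ω)) hω) ?_
    exact single_le_sum (f := fun b : G => law q (fun ω => (g ω, h ω)) (b.1, h ω))
      (fun b _ => law_nonneg hq _ _) (mem_univ (⟨g ω, hG ω hω⟩ : G))
  obtain ⟨r, h1, h2, h3, h4, h5⟩ := exists_basic_solution (κ := G ⊕ Fin 3)
    (Sum.elim (fun b c => law q (fun ω => (g ω, h ω)) (b.1, c))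
      (fun k c => ∑ ω, if h ω = c then q ω * φ k ω else 0))
    (fun c => ∑ ω, if h ω = c then q ω * ψ ω else 0) (Sum.elim (fun _ => 1) fun _ => 0) r₀
    (fun c => by simp only [hr₀]; split_ifs <;> simp) hy
  refine ⟨r, h1, fun b => ?_, fun k => ?_, ?_, ?_, fun c hc => ?_⟩
  · by_cases hb : b ∈ G
    · have := h3 (Sum.inl ⟨b, hb⟩)
      simp only [Sum.elim_inl] at this
      rw [this, law_fst_eq_sum q g h b]
      refine sum_congr rfl fun c _ => ?_
      by_cases hc : law q h c = 0
      · have h0 : law q (fun ω => (g ω, h ω)) (b, c) = 0 :=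
          le_antisymm (hc ▸ law_mono hq (fun ω hω => (Prod.mk.inj hω).2)) (law_nonneg hq _ _)
        simp [h0]
      · simp [hr₀, hc]
    · have h0 : law q g b = 0 := law_eq_zero fun ω hω e => hb (e ▸ hG ω hω)
      have h0' : ∀ c, law q (fun ω => (g ω, h ω)) (b, c) = 0 := fun c =>
        law_eq_zero fun ω hω e => hb ((Prod.mk.inj e).1 ▸ hG ω hω)
      simp [h0, h0']
  · rw [lin, ← lin₀]
    exact h3 (Sum.inr k)
  · rw [lin, ← lin₀]
    exact h4
  · simpa using h5
  · have := h2 c hc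
    simp only [hr₀, ne_eq, ite_eq_left_iff, one_ne_zero, imp_false, not_not] at this
    exact exists_of_law_ne_zero this

end Reweight

section CardinalityBound

variable {Ω X₁ X₂ X'₁ X'₂ : Type*} [Fintype Ω] [Fintype X₁] [Fintype X₂] {K : ℕ}
  {A : Fin K → Type*} [∀ l, Fintype (A l)]
  {p : X₁ × X₂ → ℝ} {d₁ : X₁ → X'₁ → ℝ} {d₂ : X₂ → X'₂ → ℝ}
  {q : Ω → ℝ} {V : Ω → X₁} {W : Ω → X₂} {U : Ω → (l : Fin K) → A l} {t : ℝ × ℝ × ℝ × ℝ}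

/-- The integrand of `mutualInfo`. -/
def infoDensity {α β : Type*} (q : Ω → ℝ) (f : Ω → α) (g : Ω → β) (ω : Ω) : ℝ :=
  Real.logb 2 (law q (fun ω' => (f ω', g ω')) (f ω, g ω) / (law q f (f ω) * law q g (g ω)))

/-- Reweighting the outcomes according to the value of `U_l` yields a test channel again if the law
of the sources and the past of round `l` and the Markov chain of round `l` are preserved. -/
theorem IsTestChannel.reweight (h : IsTestChannel p d₁ d₂ q V W U t) (l : Fin K) (r : A l → ℝ)
    (hr : ∀ c, 0 ≤ r c)
    (hlaw : ∀ z, law (fun ω => q ω * r (U ω l)) (fun ω => (V ω, W ω, past l (U ω))) z =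
      law q (fun ω => (V ω, W ω, past l (U ω))) z)
    (hodd : Odd (l : ℕ) → IsMarkovChain (fun ω => q ω * r (U ω l)) V
      (fun ω => (past l (U ω), W ω)) (fun ω => U ω l))
    (heven : Even (l : ℕ) → IsMarkovChain (fun ω => q ω * r (U ω l)) W
      (fun ω => (past l (U ω), V ω)) (fun ω => U ω l))
    (h₁ : ∑ ω, q ω * r (U ω l) * infoDensity q V (fun ω => (U ω, W ω)) ω ≤
      ∑ ω, q ω * infoDensity q V (fun ω => (U ω, W ω)) ω)
    (h₂ : ∑ ω, q ω * r (U ω l) * infoDensity q W (fun ω => (U ω, V ω)) ω ≤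
      ∑ ω, q ω * infoDensity q W (fun ω => (U ω, V ω)) ω)
    {g₁ : X₂ → ((l : Fin K) → A l) → X'₁} {g₂ : X₁ → ((l : Fin K) → A l) → X'₂}
    (h₃ : ∑ ω, q ω * r (U ω l) * d₁ (V ω) (g₁ (W ω) (U ω)) ≤ t.2.2.1)
    (h₄ : ∑ ω, q ω * r (U ω l) * d₂ (W ω) (g₂ (V ω) (U ω)) ≤ t.2.2.2) :
    IsTestChannel p d₁ d₂ (fun ω => q ω * r (U ω l)) V W U t := by
  set q' : Ω → ℝ := fun ω => q ω * r (U ω l) with hq'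
  set Z : Ω → X₁ × X₂ × ((j : {j : Fin K // j < l}) → A j) :=
    fun ω => (V ω, W ω, past l (U ω)) with hZ
  have hZlaw : law q' Z = law q Z := funext hlaw
  have hV : ∀ a, law q' V a = law q V a := fun a => by
    have := law_law q' Z (fun z => z.1) a
    rw [hZlaw, law_law] at this
    exact this.symm
  have hW : ∀ a, law q' W a = law q W a := fun a => by
    have := law_law q' Z (fun z => z.2.1) a
    rw [hZlaw, law_law] at this
    exact this.symm
  have hVW : ∀ a, law q' (fun ω => (V ω, W ω)) a = law q (fun ω => (V ω, W ω)) a := fun a => by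
    have := law_law q' Z (fun z => (z.1, z.2.1)) a
    rw [hZlaw, law_law] at this
    exact this.symm
  have hpast : ∀ (j : Fin K) (_ : l < j) (ω ω' : Ω), past j (U ω) = past j (U ω') →
      U ω l = U ω' l := fun j hj ω ω' e => congrFun e ⟨l, hj⟩
  refine ⟨⟨fun ω => mul_nonneg (h.mem.1 ω) (hr _), ?_⟩, fun s => ?_, fun j hj => ?_, fun j hj => ?_,
    ?_, ?_, ⟨g₁, h₃⟩, ⟨g₂, h₄⟩⟩
  · rw [← sum_law q' V, sum_congr rfl fun a _ => hV a, sum_law, h.mem.2]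
  · rw [hVW, h.law_eq]
  · rcases lt_trichotomy j l with hjl | rfl | hjl
    · have := (isMarkovChain_law (q := q) Z (fun z => z.1)
        (fun z => ((fun i => z.2.2 ⟨i.1, i.2.trans hjl⟩ : (i : {i : Fin K // i < j}) → A i), z.2.1))
        (fun z => z.2.2 ⟨j, hjl⟩)).2 (h.markov_odd j hj)
      rw [← hZlaw, isMarkovChain_law] at this
      exact this
    · exact hodd hj
    · exact (h.markov_odd j hj).reweight_of_determined (h := fun ω => U ω l)
        fun ω ω' e => hpast j hjl ω ω' (Prod.mk.inj e).1
  · rcases lt_trichotomy j l with hjl | rfl | hjl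
    · have := (isMarkovChain_law (q := q) Z (fun z => z.2.1)
        (fun z => ((fun i => z.2.2 ⟨i.1, i.2.trans hjl⟩ : (i : {i : Fin K // i < j}) → A i), z.1))
        (fun z => z.2.2 ⟨j, hjl⟩)).2 (h.markov_even j hj)
      rw [← hZlaw, isMarkovChain_law] at this
      exact this
    · exact heven hj
    · exact (h.markov_even j hj).reweight_of_determined (h := fun ω => U ω l)
        fun ω ω' e => hpast j hjl ω ω' (Prod.mk.inj e).1
  · rw [mutualInfo_reweight (h := fun ω => U ω l) hV
      fun ω ω' e => congrFun (Prod.mk.inj e).1 l]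
    exact h₁.trans h.info₁
  · rw [mutualInfo_reweight (h := fun ω => U ω l) hW
      fun ω ω' e => congrFun (Prod.mk.inj e).1 l]
    exact h₂.trans h.info₂

/-- The alphabet of round `l` can be reduced. The weights on it have to keep the law of the source
of the acting terminal together with the past, one mutual information and both distortions; the
other mutual information is minimized. -/
theorem IsTestChannel.exists_reduce_round (h : IsTestChannel p d₁ d₂ q V W U t)
    (T : (l : Fin K) → Finset (A l)) (hT : ∀ ω, q ω ≠ 0 → ∀ l, U ω l ∈ T l) (l : Fin K) :
    ∃ (q' : Ω → ℝ) (S : Finset (A l)), IsTestChannel p d₁ d₂ q' V W U t ∧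
      (∀ ω, q' ω ≠ 0 → q ω ≠ 0 ∧ U ω l ∈ S) ∧
      S.card ≤ (if Even (l : ℕ) then Fintype.card X₁ else Fintype.card X₂) *
        (∏ j ∈ univ.filter (· < l), (T j).card) + 3 := by
  obtain ⟨g₁, hg₁⟩ := h.dist₁
  obtain ⟨g₂, hg₂⟩ := h.dist₂
  let φ : Fin 3 → Ω → ℝ := ![infoDensity q W (fun ω => (U ω, V ω)),
    fun ω => d₁ (V ω) (g₁ (W ω) (U ω)), fun ω => d₂ (W ω) (g₂ (V ω) (U ω))]
  let P : Finset ((j : {j : Fin K // j < l}) → A j) := Fintype.piFinset fun j => T j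
  have hP : ∀ ω, q ω ≠ 0 → past l (U ω) ∈ P := fun ω hω =>
    Fintype.mem_piFinset.2 fun j => hT ω hω j
  have hPc : P.card = ∏ j ∈ univ.filter (· < l), (T j).card := by
    rw [Fintype.card_piFinset]
    exact (prod_subtype (univ.filter (· < l)) (by simp) fun j => (T j).card).symm
  by_cases hl : Even (l : ℕ)
  · obtain ⟨r, hr0, hr1, hr2, hr3, hr4, hr5⟩ := exists_reweight h.mem.1
      (fun ω => (past l (U ω), V ω)) (fun ω => U ω l) (P ×ˢ univ)
      (fun ω hω => by simp [hP ω hω]) φ (infoDensity q V (fun ω => (U ω, W ω)))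
    refine ⟨_, univ.filter fun c => r c ≠ 0, h.reweight l r hr0 (fun z => ?_)
      (fun ho => absurd hl (Nat.not_even_iff_odd.2 ho))
      (fun _ => (h.markov_even l hl).reweight_self h.mem.1 hr1) hr3 (hr2 0).le
      (g₁ := g₁) (g₂ := g₂) ((hr2 1).trans_le hg₁) ((hr2 2).trans_le hg₂), fun ω hω => ?_, ?_⟩
    · obtain ⟨a, b, c⟩ := z
      have := law_reweight_of_markov h.mem.1 (h.markov_even l hl) hr1 b (c, a)
      rw [law_congr (f' := fun ω => (V ω, W ω, past l (U ω))) (a' := (a, b, c))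
        (fun ω _ => by simp; tauto), law_congr (q := q) (f' := fun ω => (V ω, W ω, past l (U ω)))
        (a' := (a, b, c)) (fun ω _ => by simp; tauto)] at this
      exact this
    · exact ⟨left_ne_zero_of_mul hω, by simpa using right_ne_zero_of_mul hω⟩
    · rw [if_pos hl, ← hPc]
      rw [card_product, card_univ, mul_comm] at hr4
      exact hr4
  · have hl' := Nat.not_even_iff_odd.1 hl
    obtain ⟨r, hr0, hr1, hr2, hr3, hr4, hr5⟩ := exists_reweight h.mem.1
      (fun ω => (past l (U ω), W ω)) (fun ω => U ω l) (P ×ˢ univ)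
      (fun ω hω => by simp [hP ω hω]) φ (infoDensity q V (fun ω => (U ω, W ω)))
    refine ⟨_, univ.filter fun c => r c ≠ 0, h.reweight l r hr0 (fun z => ?_)
      (fun _ => (h.markov_odd l hl').reweight_self h.mem.1 hr1)
      (fun he => absurd he hl) hr3 (hr2 0).le
      (g₁ := g₁) (g₂ := g₂) ((hr2 1).trans_le hg₁) ((hr2 2).trans_le hg₂), fun ω hω => ?_, ?_⟩
    · obtain ⟨a, b, c⟩ := z
      have := law_reweight_of_markov h.mem.1 (h.markov_odd l hl') hr1 a (c, b)
      rw [law_congr (f' := fun ω => (V ω, W ω, past l (U ω))) (a' := (a, b, c))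
        (fun ω _ => by simp; tauto), law_congr (q := q) (f' := fun ω => (V ω, W ω, past l (U ω)))
        (a' := (a, b, c)) (fun ω _ => by simp; tauto)] at this
      exact this
    · exact ⟨left_ne_zero_of_mul hω, by simpa using right_ne_zero_of_mul hω⟩
    · rw [if_neg hl, ← hPc]
      rw [card_product, card_univ, mul_comm] at hr4
      exact hr4

/-- The rounds are reduced one after the other, starting from the first one: the bound for round `l`
refers to the alphabets of the earlier rounds, and reducing a round only shrinks supports. -/
theorem IsTestChannel.exists_cardBound (h : IsTestChannel p d₁ d₂ q V W U t) (k : ℕ) :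
    ∃ (q' : Ω → ℝ) (T : (l : Fin K) → Finset (A l)), IsTestChannel p d₁ d₂ q' V W U t ∧
      (∀ ω, q' ω ≠ 0 → ∀ l, U ω l ∈ T l) ∧
      ∀ l : Fin K, (l : ℕ) < k →
        (T l).card ≤ (if Even (l : ℕ) then Fintype.card X₁ else Fintype.card X₂) *
          (∏ j ∈ univ.filter (· < l), (T j).card) + 3 := by
  induction k with
  | zero => exact ⟨q, fun _ => univ, h, fun _ _ _ => mem_univ _, by simp⟩
  | succ k ih =>
    obtain ⟨q', T, h', hT, hb⟩ := ih
    by_cases hk : k < K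
    · obtain ⟨q'', S, h'', hS, hc⟩ := h'.exists_reduce_round T hT ⟨k, hk⟩
      refine ⟨q'', Function.update T ⟨k, hk⟩ S, h'', fun ω hω l => ?_, fun l hl => ?_⟩
      · by_cases hlk : l = ⟨k, hk⟩
        · subst hlk
          simpa using (hS ω hω).2
        · simpa [hlk] using hT ω (hS ω hω).1 l
      · have hprod : ∏ j ∈ univ.filter (· < l), (Function.update T ⟨k, hk⟩ S j).card =
            ∏ j ∈ univ.filter (· < l), (T j).card := by
          refine prod_congr rfl fun j hj => ?_
          have hj' : j < l := by simpa using hj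
          have : j ≠ ⟨k, hk⟩ := fun e => by
            have : (j : ℕ) < l := hj'
            rw [e] at this
            dsimp only at this
            omega
          rw [Function.update_of_ne this]
        rw [hprod]
        by_cases hlk : l = ⟨k, hk⟩
        · subst hlk
          simpa using hc
        · rw [Function.update_of_ne hlk]
          refine hb l (lt_of_le_of_ne (Nat.lt_succ_iff.1 hl) fun e => hlk (Fin.ext e))
    · exact ⟨q', T, h', hT, fun l hl => hb l (by have := l.2; omega)⟩

theorem tradeoffRegion_subset_bounded :
    tradeoffRegion K (privateEqPublic p) d₁ d₂ ⊆
      boundedTradeoffRegion K (privateEqPublic p) d₁ d₂ := by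
  intro t ht
  obtain ⟨m, hm⟩ := Set.mem_iUnion.1 ht
  obtain ⟨q, hq⟩ := isTestChannel_of_mem_tradeoffTuples hm
  obtain ⟨q', T, h', hT, hb⟩ := hq.exists_cardBound K
  refine Set.mem_biUnion (x := fun l => (T l).card) (fun l => ?_)
    (h'.mem_tradeoffTuples_card T hT)
  exact hb l l.2

theorem bounded_subset_tradeoffRegion :
    boundedTradeoffRegion K (privateEqPublic p) d₁ d₂ ⊆
      tradeoffRegion K (privateEqPublic p) d₁ d₂ :=
  Set.iUnion₂_subset fun m _ => Set.subset_iUnion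
    (fun m => tradeoffTuples (privateEqPublic p) d₁ d₂ m) m

end CardinalityBound

/-! ### Compactness: the region with cardinality bounds is closed -/

section Closed

variable {Ω X₁ X₂ X'₁ X'₂ : Type*} [Fintype Ω] [Fintype X₁] [Fintype X₂] {K : ℕ}

/-- The cardinality bounds determine bounds for all rounds, by recursion on the round. -/
theorem finite_cardBound (n₁ n₂ : ℕ) : {m : Fin K → ℕ | CardBound n₁ n₂ m}.Finite := by
  have key : ∀ k : ℕ, ∃ B : ℕ, ∀ m : Fin K → ℕ, CardBound n₁ n₂ m →
      ∀ j : Fin K, (j : ℕ) < k → m j ≤ B := by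
    intro k
    induction k with
    | zero => exact ⟨0, by simp⟩
    | succ k ih =>
      obtain ⟨B, hB⟩ := ih
      refine ⟨B + ((n₁ + n₂) * (B + 1) ^ K + 3), fun m hm j hj => ?_⟩
      rcases Nat.lt_succ_iff_lt_or_eq.1 hj with hj | hj
      · exact (hB m hm j hj).trans (Nat.le_add_right _ _)
      · refine ((hm j).trans ?_).trans (Nat.le_add_left _ _)
        gcongr
        · split_ifs <;> omega
        · calc ∏ i ∈ univ.filter (· < j), m i ≤ ∏ i ∈ univ.filter (· < j), (B + 1) := by
                refine prod_le_prod' fun i hi => ?_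
                have : (i : ℕ) < j := by simpa using hi
                exact (hB m hm i (by omega)).trans (Nat.le_succ _)
            _ = (B + 1) ^ (univ.filter (· < j)).card := by rw [prod_const]
            _ ≤ (B + 1) ^ K := Nat.pow_le_pow_right (Nat.succ_pos _)
                ((card_le_univ _).trans (by simp))
  obtain ⟨B, hB⟩ := key K
  exact (Set.finite_Iic (fun _ : Fin K => B)).subset fun m hm j => hB m hm j j.2

theorem continuous_law {α : Type*} (f : Ω → α) (a : α) : Continuous fun q : Ω → ℝ => law q f a := by
  unfold law
  refine continuous_finsetSum _ fun ω _ => ?_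
  split_ifs
  · exact continuous_apply ω
  · exact continuous_const

theorem continuous_ent {α : Type*} [Fintype α] (f : Ω → α) :
    Continuous fun q : Ω → ℝ => ent q f := by
  simp_rw [ent_eq_sum_negMulLog]
  exact (continuous_finsetSum _ fun a _ =>
    Real.continuous_negMulLog.comp (continuous_law f a)).div_const _

theorem continuous_mutualInfo {α β : Type*} [Fintype α] [Fintype β] (f : Ω → α) (g : Ω → β) :
    Continuous fun q : stdSimplex ℝ Ω => mutualInfo q.1 f g := by
  simp_rw [fun q : stdSimplex ℝ Ω => mutualInfo_eq_ent q.2.1 f g]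
  exact (((continuous_ent f).comp continuous_subtype_val).add
    ((continuous_ent g).comp continuous_subtype_val)).sub
    ((continuous_ent fun ω => (f ω, g ω)).comp continuous_subtype_val)

theorem isClosed_isMarkovChain {α β γ : Type*} (f : Ω → α) (g : Ω → β) (h : Ω → γ) :
    IsClosed {q : Ω → ℝ | IsMarkovChain q f g h} := by
  simp only [IsMarkovChain, Set.ofPred_forall]
  refine isClosed_iInter fun a => isClosed_iInter fun b => isClosed_iInter fun c => ?_
  exact isClosed_eq ((continuous_law _ _).mul (continuous_law _ _))
    ((continuous_law _ _).mul (continuous_law _ _))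

theorem isClosed_tradeoffTuples {Y₁ Y₂ : Type*} [Fintype Y₁] [Fintype Y₂] [Fintype X'₁]
    [Fintype X'₂] (P : X₁ × Y₁ × X₂ × Y₂ → ℝ) (d₁ : X₁ → X'₁ → ℝ) (d₂ : X₂ → X'₂ → ℝ)
    (m : Fin K → ℕ) : IsClosed (tradeoffTuples P d₁ d₂ m) := by
  let Q := (X₁ × Y₁ × X₂ × Y₂) × ((l : Fin K) → Fin (m l))
  let C : (X₂ → ((l : Fin K) → Fin (m l)) → X'₁) → (X₁ → ((l : Fin K) → Fin (m l)) → X'₂) →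
      Set (stdSimplex ℝ Q × (ℝ × ℝ × ℝ × ℝ)) := fun g₁ g₂ =>
    {z | (∀ s, ∑ u, z.1.1 (s, u) = P s) ∧
      (∀ l : Fin K, Odd (l : ℕ) → IsMarkovChain z.1.1
        (fun ω => ω.1.2.1) (fun ω => (past l ω.2, ω.1.2.2.1)) (fun ω => ω.2 l)) ∧
      (∀ l : Fin K, Even (l : ℕ) → IsMarkovChain z.1.1
        (fun ω => ω.1.2.2.2) (fun ω => (past l ω.2, ω.1.1)) (fun ω => ω.2 l)) ∧
      mutualInfo z.1.1 (fun ω => ω.1.2.1) (fun ω => (ω.2, ω.1.2.2.1)) ≤ z.2.1 ∧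
      mutualInfo z.1.1 (fun ω => ω.1.2.2.2) (fun ω => (ω.2, ω.1.1)) ≤ z.2.2.1 ∧
      ∑ ω, z.1.1 ω * d₁ ω.1.1 (g₁ ω.1.2.2.1 ω.2) ≤ z.2.2.2.1 ∧
      ∑ ω, z.1.1 ω * d₂ ω.1.2.2.1 (g₂ ω.1.1 ω.2) ≤ z.2.2.2.2}
  have hC : ∀ g₁ g₂, IsClosed (C g₁ g₂) := by
    intro g₁ g₂
    have hc : Continuous fun z : stdSimplex ℝ Q × (ℝ × ℝ × ℝ × ℝ) => z.1.1 :=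
      continuous_subtype_val.comp continuous_fst
    have hca : ∀ ω, Continuous fun z : stdSimplex ℝ Q × (ℝ × ℝ × ℝ × ℝ) => z.1.1 ω :=
      fun ω => (continuous_apply ω).comp hc
    simp only [C, Set.ofPred_and, Set.ofPred_forall]
    refine IsClosed.inter ?_ (IsClosed.inter ?_ (IsClosed.inter ?_ (IsClosed.inter ?_
      (IsClosed.inter ?_ (IsClosed.inter ?_ ?_)))))
    · exact isClosed_iInter fun s =>
        isClosed_eq (continuous_finsetSum _ fun u _ => hca _) continuous_const
    · exact isClosed_iInter fun l => isClosed_iInter fun _ =>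
        (isClosed_isMarkovChain _ _ _).preimage hc
    · exact isClosed_iInter fun l => isClosed_iInter fun _ =>
        (isClosed_isMarkovChain _ _ _).preimage hc
    · exact isClosed_le ((continuous_mutualInfo (fun ω : Q => ω.1.2.1)
        (fun ω => (ω.2, ω.1.2.2.1))).comp continuous_fst) (continuous_fst.comp continuous_snd)
    · exact isClosed_le ((continuous_mutualInfo (fun ω : Q => ω.1.2.2.2)
        (fun ω => (ω.2, ω.1.1))).comp continuous_fst)
        (continuous_fst.comp (continuous_snd.comp continuous_snd))
    · exact isClosed_le (continuous_finsetSum _ fun ω _ => (hca ω).mul continuous_const)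
        (continuous_fst.comp (continuous_snd.comp (continuous_snd.comp continuous_snd)))
    · exact isClosed_le (continuous_finsetSum _ fun ω _ => (hca ω).mul continuous_const)
        (continuous_snd.comp (continuous_snd.comp (continuous_snd.comp continuous_snd)))
  -- there are finitely many reconstruction functions, and the weight `q` ranges over a compact set
  have hcompact : CompactSpace (stdSimplex ℝ Q) :=
    isCompact_iff_compactSpace.1 (isCompact_stdSimplex ℝ Q)
  have : tradeoffTuples P d₁ d₂ m = ⋃ g₁, ⋃ g₂, Prod.snd '' C g₁ g₂ := by
    ext t
    simp only [tradeoffTuples, Set.mem_ofPred_eq, Set.mem_iUnion, Set.mem_image, C]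
    constructor
    · rintro ⟨q, hq, g₁, g₂, H⟩
      exact ⟨g₁, g₂, (⟨q, hq⟩, t), H, rfl⟩
    · rintro ⟨g₁, g₂, ⟨⟨q, hq⟩, t'⟩, H, rfl⟩
      exact ⟨q, hq, g₁, g₂, H⟩
  rw [this]
  exact isClosed_iUnion_of_finite fun g₁ => isClosed_iUnion_of_finite fun g₂ =>
    isClosedMap_snd_of_compactSpace _ (hC g₁ g₂)

theorem isClosed_boundedTradeoffRegion {Y₁ Y₂ : Type*} [Fintype Y₁] [Fintype Y₂] [Fintype X'₁]
    [Fintype X'₂] (P : X₁ × Y₁ × X₂ × Y₂ → ℝ) (d₁ : X₁ → X'₁ → ℝ) (d₂ : X₂ → X'₂ → ℝ) :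
    IsClosed (boundedTradeoffRegion K P d₁ d₂) :=
  (finite_cardBound _ _).isClosed_biUnion fun m _ => isClosed_tradeoffTuples P d₁ d₂ m

end Closed

/-! ### Entropy inequalities for the converse -/

section Converse

variable {Ω : Type*} [Fintype Ω] {q : Ω → ℝ}

/-- The coordinates of `x` that satisfy `P`. -/
def mask {ι α : Type*} (P : ι → Prop) (x : ι → α) (j : ι) : Option α :=
  if P j then some (x j) else none

theorem mask_eq_mask_iff {ι α : Type*} {P : ι → Prop} {x y : ι → α} :
    mask P x = mask P y ↔ ∀ j, P j → x j = y j := by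
  constructor
  · intro h j hj
    simpa [mask, hj] using congrFun h j
  · intro h
    funext j
    by_cases hj : P j <;> simp [mask, hj, h]

/-- The chain rule for `H(x | z, y)` along the ordering of the coordinates given by `e`, where in
the term of coordinate `i` only the coordinates of `y` from `i` on are kept in the condition. -/
theorem ent_chain_le {n : ℕ} {X Y Z : Type*} [Fintype X] [Fintype Y] [Fintype Z]
    (hq : q ∈ stdSimplex ℝ Ω) (e : Fin n ≃ Fin n) (x : Ω → Fin n → X) (y : Ω → Fin n → Y)
    (z : Ω → Z) :
    ent q (fun ω => (x ω, z ω, y ω)) - ent q (fun ω => (z ω, y ω)) ≤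
      ∑ i, (ent q (fun ω => (x ω i, mask (e · < e i) (x ω), z ω, mask (¬ e · < e i) (y ω))) -
        ent q (fun ω => (mask (e · < e i) (x ω), z ω, mask (¬ e · < e i) (y ω)))) := by
  let H : ℕ → ℝ := fun k => ent q (fun ω => (mask (fun j => (e j : ℕ) < k) (x ω), z ω, y ω))
  have h0 : H 0 = ent q (fun ω => (z ω, y ω)) :=
    ent_congr fun ω ω' _ _ => by simp [mask_eq_mask_iff]
  have hn : H n = ent q (fun ω => (x ω, z ω, y ω)) :=
    ent_congr fun ω ω' _ _ => by
      simp only [Prod.mk.injEq, mask_eq_mask_iff]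
      simp [funext_iff]
  have hs : ∑ i, (H (e i + 1) - H (e i)) = H n - H 0 := by
    rw [Equiv.sum_comp e (fun k : Fin n => H (k + 1) - H k),
      Fin.sum_univ_eq_sum_range (fun k => H (k + 1) - H k), sum_range_sub]
  rw [← h0, ← hn, ← hs]
  refine sum_le_sum fun i _ => ?_
  have := ent_submodular hq (fun ω => x ω i)
    (fun ω => (mask (e · < e i) (x ω), z ω, mask (¬ e · < e i) (y ω))) y
  have e1 : ent q (fun ω => (x ω i, (mask (e · < e i) (x ω), z ω, mask (¬ e · < e i) (y ω)), y ω)) =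
      H (e i + 1) := by
    refine ent_congr fun ω ω' _ _ => ?_
    simp only [Prod.mk.injEq, mask_eq_mask_iff, Nat.lt_succ_iff]
    constructor
    · rintro ⟨h1, ⟨h2, h3, -⟩, h4⟩
      refine ⟨fun j hj => ?_, h3, h4⟩
      rcases hj.lt_or_eq with hj | hj
      · exact h2 j hj
      · rw [e.injective (Fin.ext hj), h1]
    · rintro ⟨h1, h2, h3⟩
      exact ⟨h1 i le_rfl, ⟨fun j hj => h1 j (le_of_lt hj), h2, fun j _ => congrFun h3 j⟩, h3⟩
  have e2 : ent q (fun ω => ((mask (e · < e i) (x ω), z ω, mask (¬ e · < e i) (y ω)), y ω)) =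
      H (e i) := by
    refine ent_congr fun ω ω' _ _ => ?_
    simp only [Prod.mk.injEq, mask_eq_mask_iff]
    constructor
    · rintro ⟨⟨h2, h3, -⟩, h4⟩
      exact ⟨fun j hj => h2 j hj, h3, h4⟩
    · rintro ⟨h1, h2, h3⟩
      exact ⟨⟨fun j hj => h1 j hj, h2, fun j _ => congrFun h3 j⟩, h3⟩
  rw [e1, e2] at this
  linarith

/-- A reconstruction of `f` from `g` and `h`, where `f ↔ g ↔ h` is a Markov chain, can be replaced
by one that only uses `g`. -/
theorem IsMarkovChain.exists_reconstruction {α β γ δ : Type*} [Fintype α] [Fintype β] [Fintype γ]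
    {f : Ω → α} {g : Ω → β} {h : Ω → γ} (hq : q ∈ stdSimplex ℝ Ω) (H : IsMarkovChain q f g h)
    (d : α → δ → ℝ) (ρ : β → γ → δ) :
    ∃ ρ' : β → δ, ∑ ω, q ω * d (f ω) (ρ' (g ω)) ≤ ∑ ω, q ω * d (f ω) (ρ (g ω) (h ω)) := by
  have hΩ : Nonempty Ω := by
    by_contra hc
    rw [not_nonempty_iff] at hc
    simpa using hq.2
  have hγ : Nonempty γ := ⟨h hΩ.some⟩
  let D : β → γ → ℝ := fun b c => ∑ a, law q (fun ω => (f ω, g ω)) (a, b) * d a (ρ b c)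
  have hmin : ∀ b, ∃ c, ∀ c', D b c ≤ D b c' := fun b => Finite.exists_min (D b)
  choose c₀ hc₀ using hmin
  -- given the value `b` of `g`, the best value of `h` beats the average over `h`
  refine ⟨fun b => ρ b (c₀ b), ?_⟩
  have e1 : ∑ ω, q ω * d (f ω) (ρ (g ω) (c₀ (g ω))) = ∑ b, D b (c₀ b) := by
    rw [← sum_law_mul q (fun ω => (f ω, g ω)) (fun z => d z.1 (ρ z.2 (c₀ z.2))),
      Fintype.sum_prod_type, sum_comm]
  have e2 : ∑ ω, q ω * d (f ω) (ρ (g ω) (h ω)) =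
      ∑ b, ∑ c, ∑ a, law q (fun ω => (f ω, g ω, h ω)) (a, b, c) * d a (ρ b c) := by
    rw [← sum_law_mul q (fun ω => (f ω, g ω, h ω)) (fun z => d z.1 (ρ z.2.1 z.2.2)),
      Fintype.sum_prod_type, sum_comm, Fintype.sum_prod_type]
  rw [e1, e2]
  refine sum_le_sum fun b _ => ?_
  by_cases hb : law q g b = 0
  · have h2 : ∀ a, law q (fun ω => (f ω, g ω)) (a, b) = 0 := fun a =>
      le_antisymm (hb ▸ law_mono hq.1 (fun ω hω => (Prod.mk.inj hω).2)) (law_nonneg hq.1 _ _)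
    have h3 : ∀ a c, law q (fun ω => (f ω, g ω, h ω)) (a, b, c) = 0 := fun a c =>
      le_antisymm (hb ▸ law_mono hq.1 (fun ω hω => by simp_all)) (law_nonneg hq.1 _ _)
    simp [D, h2, h3]
  · have e3 : ∀ c, ∑ a, law q (fun ω => (f ω, g ω, h ω)) (a, b, c) * d a (ρ b c) =
        law q (fun ω => (g ω, h ω)) (b, c) / law q g b * D b c := by
      intro c
      rw [mul_sum]
      refine sum_congr rfl fun a _ => ?_
      field_simp
      linear_combination d a (ρ b c) * H a b c
    simp_rw [e3]
    calc D b (c₀ b) = ∑ c, law q (fun ω => (g ω, h ω)) (b, c) / law q g b * D b (c₀ b) := by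
          rw [← sum_mul, ← sum_div, ← law_fst_eq_sum, div_self hb, one_mul]
      _ ≤ _ := sum_le_sum fun c _ => mul_le_mul_of_nonneg_left (hc₀ b c)
          (div_nonneg (law_nonneg hq.1 _ _) (law_nonneg hq.1 _ _))

/-! ### Time sharing -/

/-- An index `i`, uniform on `Fin n`, together with an independent outcome of law `q`. -/
def timeShare (n : ℕ) (q : Ω → ℝ) (z : Fin n × Ω) : ℝ := (n : ℝ)⁻¹ * q z.2

theorem sum_timeShare_mul {n : ℕ} (q : Ω → ℝ) (F : Fin n → Ω → ℝ) :
    ∑ z, timeShare n q z * F z.1 z.2 = (n : ℝ)⁻¹ * ∑ i, ∑ ω, q ω * F i ω := by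
  rw [Fintype.sum_prod_type, mul_sum]
  refine sum_congr rfl fun i _ => ?_
  rw [mul_sum]
  exact sum_congr rfl fun ω _ => by simp [timeShare, mul_assoc]

theorem timeShare_mem_stdSimplex {n : ℕ} (hn : n ≠ 0) (hq : q ∈ stdSimplex ℝ Ω) :
    timeShare n q ∈ stdSimplex ℝ (Fin n × Ω) := by
  refine ⟨fun z => mul_nonneg (by positivity) (hq.1 _), ?_⟩
  have := sum_timeShare_mul (n := n) q (fun _ _ => 1)
  simpa [hq.2, hn] using this

theorem law_timeShare {n : ℕ} {α : Type*} (q : Ω → ℝ) (F : Fin n → Ω → α) (a : α) :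
    law (timeShare n q) (fun z => F z.1 z.2) a = (n : ℝ)⁻¹ * ∑ i, law q (F i) a := by
  have := sum_timeShare_mul q (fun i ω => if F i ω = a then 1 else 0)
  simpa [law] using this

theorem ent_timeShare {n : ℕ} {α : Type*} (hn : n ≠ 0) (hq : q ∈ stdSimplex ℝ Ω)
    (F : Fin n → Ω → α) :
    ent (timeShare n q) (fun z => (z.1, F z.1 z.2)) =
      Real.logb 2 n + (n : ℝ)⁻¹ * ∑ i, ent q (F i) := by
  have hl : ∀ i ω, law (timeShare n q) (fun z => (z.1, F z.1 z.2)) (i, F i ω) =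
      (n : ℝ)⁻¹ * law q (F i) (F i ω) := by
    intro i ω
    rw [law_timeShare q (fun i ω => (i, F i ω)), sum_eq_single i]
    · congr 1
      exact law_congr fun ω' _ => by simp
    · intro j _ hj
      exact law_eq_zero fun ω' _ => by simp [hj]
    · simp
  have hn' : (n : ℝ) ≠ 0 := by exact_mod_cast hn
  have key : ∀ i ω, q ω * Real.logb 2 ((n : ℝ)⁻¹ * law q (F i) (F i ω)) =
      q ω * (-Real.logb 2 n) + q ω * Real.logb 2 (law q (F i) (F i ω)) := by
    intro i ω
    by_cases hω : q ω = 0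
    · simp [hω]
    · rw [Real.logb_mul (inv_ne_zero hn') (law_pos hq.1 (F i) hω).ne', Real.logb_inv]
      ring
  unfold ent
  have := sum_timeShare_mul q (fun i ω => Real.logb 2
    (law (timeShare n q) (fun z => (z.1, F z.1 z.2)) (i, F i ω)))
  rw [this]
  simp_rw [hl, key, sum_add_distrib, ← sum_mul, hq.2]
  simp only [sum_const, card_univ, Fintype.card_fin, nsmul_eq_mul, sum_neg_distrib]
  field_simp
  ring

end Converse

/-! ### Converse: every code yields a test channel -/

namespace InteractiveCode

section Messages

variable {K n : ℕ} {X₁ X₂ X'₁ X'₂ : Type*} (c : InteractiveCode K n X₁ X₂ X'₁ X'₂)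

theorem message_of_even {l : Fin K} (h : Even (l : ℕ)) (x₁ : Fin n → X₁) (x₂ : Fin n → X₂) :
    c.message x₁ x₂ l = c.enc₁ l h x₁ (past l (c.message x₁ x₂)) := by
  rw [message, dif_pos h]
  rfl

theorem message_of_not_even {l : Fin K} (h : ¬ Even (l : ℕ)) (x₁ : Fin n → X₁)
    (x₂ : Fin n → X₂) :
    c.message x₁ x₂ l = c.enc₂ l h x₂ (past l (c.message x₁ x₂)) := by
  rw [message, dif_neg h]
  rfl

/-- The source pairs that produce given messages form a rectangle. -/
theorem message_exchange {x₁ x₁' : Fin n → X₁} {x₂ x₂' : Fin n → X₂} (k : ℕ)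
    (h : ∀ j : Fin K, (j : ℕ) < k → c.message x₁ x₂ j = c.message x₁' x₂' j) (j : Fin K)
    (hj : (j : ℕ) < k) : c.message x₁ x₂' j = c.message x₁ x₂ j := by
  induction hN : (j : ℕ) using Nat.strong_induction_on generalizing j with
  | _ N ih =>
  have hp : past j (c.message x₁ x₂') = past j (c.message x₁ x₂) := by
    funext i
    have hi : (i.1 : ℕ) < j := i.2
    exact ih i.1 (hN ▸ hi) i.1 (hi.trans hj) rfl
  by_cases he : Even (j : ℕ)
  · rw [message_of_even c he, message_of_even c he, hp]
  · have hp' : past j (c.message x₁ x₂) = past j (c.message x₁' x₂') := by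
      funext i
      have hi : (i.1 : ℕ) < j := i.2
      exact h i.1 (hi.trans hj)
    rw [h j hj, message_of_not_even c he, message_of_not_even c he, hp, hp']

theorem message_ext_even {x₁ x₁' : Fin n → X₁} {x₂ : Fin n → X₂}
    (h : ∀ l : Fin K, Even (l : ℕ) → c.message x₁ x₂ l = c.message x₁' x₂ l) :
    c.message x₁ x₂ = c.message x₁' x₂ := by
  funext j
  induction hN : (j : ℕ) using Nat.strong_induction_on generalizing j with
  | _ N ih =>
  by_cases he : Even (j : ℕ)
  · exact h j he
  · rw [message_of_not_even c he, message_of_not_even c he]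
    congr 1
    funext i
    have hi : (i.1 : ℕ) < j := i.2
    exact ih i.1 (hN ▸ hi) i.1 rfl

theorem message_ext_odd {x₁ : Fin n → X₁} {x₂ x₂' : Fin n → X₂}
    (h : ∀ l : Fin K, ¬ Even (l : ℕ) → c.message x₁ x₂ l = c.message x₁ x₂' l) :
    c.message x₁ x₂ = c.message x₁ x₂' := by
  funext j
  induction hN : (j : ℕ) using Nat.strong_induction_on generalizing j with
  | _ N ih =>
  by_cases he : Even (j : ℕ)
  · rw [message_of_even c he, message_of_even c he]
    congr 1
    funext i
    have hi : (i.1 : ℕ) < j := i.2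
    exact ih i.1 (hN ▸ hi) i.1 rfl
  · exact h j he

end Messages

section Rates

variable {K n : ℕ} {X₁ X₂ X'₁ X'₂ : Type*} (c : InteractiveCode K n X₁ X₂ X'₁ X'₂)

/-- The messages as a function of the block of source pairs. -/
def msg (x : Fin n → X₁ × X₂) : (l : Fin K) → Fin (c.M l) :=
  c.message (fun j => (x j).1) (fun j => (x j).2)

variable [Fintype X₁] [Fintype X₂] {Q : (Fin n → X₁ × X₂) → ℝ}

theorem ent_le_sum_logb {Ω : Type*} [Fintype Ω] {q : Ω → ℝ} (hq : q ∈ stdSimplex ℝ Ω) {ι : Type*}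
    [Fintype ι] (P : ι → Prop) [DecidablePred P] (M : ι → ℕ)
    (f : Ω → (i : {i // P i}) → Fin (M i)) :
    ent q f ≤ ∑ i ∈ univ.filter P, Real.logb 2 (M i) := by
  obtain ⟨ω⟩ : Nonempty Ω := by
    by_contra h
    rw [not_nonempty_iff] at h
    simpa using hq.2
  have hM : ∀ i, P i → (M i : ℝ) ≠ 0 := fun i hi => by
    have := (f ω ⟨i, hi⟩).pos
    positivity
  refine (ent_le_logb_card hq f).trans_eq ?_
  rw [Fintype.card_pi]
  simp only [Fintype.card_fin, Nat.cast_prod]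
  rw [Real.logb, Real.log_prod (fun (i : {i // P i}) _ => hM i i.2), sum_div,
    Finset.sum_subtype (p := P) (univ.filter P) (by simp) (fun i => Real.logb 2 (M i))]
  rfl

/-- Given the second sequence, the messages of terminal 1 determine all messages. -/
theorem ent_msg_le₁ (hQ : Q ∈ stdSimplex ℝ (Fin n → X₁ × X₂)) :
    ent Q (fun x => (c.msg x, fun j => (x j).2)) - ent Q (fun x j => (x j).2) ≤
      ∑ l ∈ univ.filter (fun l : Fin K => Even (l : ℕ)), Real.logb 2 (c.M l) := by
  have h1 : ent Q (fun x => (c.msg x, fun j => (x j).2)) =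
      ent Q (fun x => ((fun l : {l : Fin K // Even (l : ℕ)} => c.msg x l), fun j => (x j).2)) := by
    refine ent_congr fun x x' _ _ => ?_
    simp only [Prod.mk.injEq]
    refine and_congr_left fun h => ⟨fun e => by rw [e], fun e => ?_⟩
    have := c.message_ext_even (x₁ := fun j => (x j).1) (x₁' := fun j => (x' j).1)
      (x₂ := fun j => (x j).2) (fun l hl => by
        have := congrFun e ⟨l, hl⟩
        simp only [msg] at this
        rw [this, ← h])
    simp only [msg]
    rw [this, ← h]
  have h2 := ent_pair_le hQ (fun x => (fun l : {l : Fin K // Even (l : ℕ)} => c.msg x l))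
    (fun x j => (x j).2)
  have h3 := ent_le_sum_logb hQ (fun l : Fin K => Even (l : ℕ)) c.M (fun x l => c.msg x l)
  linarith

theorem ent_msg_le₂ (hQ : Q ∈ stdSimplex ℝ (Fin n → X₁ × X₂)) :
    ent Q (fun x => (c.msg x, fun j => (x j).1)) - ent Q (fun x j => (x j).1) ≤
      ∑ l ∈ univ.filter (fun l : Fin K => ¬ Even (l : ℕ)), Real.logb 2 (c.M l) := by
  have h1 : ent Q (fun x => (c.msg x, fun j => (x j).1)) =
      ent Q (fun x => ((fun l : {l : Fin K // ¬ Even (l : ℕ)} => c.msg x l),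
        fun j => (x j).1)) := by
    refine ent_congr fun x x' _ _ => ?_
    simp only [Prod.mk.injEq]
    refine and_congr_left fun h => ⟨fun e => by rw [e], fun e => ?_⟩
    have := c.message_ext_odd (x₂ := fun j => (x j).2) (x₂' := fun j => (x' j).2)
      (x₁ := fun j => (x j).1) (fun l hl => by
        have := congrFun e ⟨l, hl⟩
        simp only [msg] at this
        rw [this, ← h])
    simp only [msg]
    rw [this, ← h]
  have h2 := ent_pair_le hQ (fun x => (fun l : {l : Fin K // ¬ Even (l : ℕ)} => c.msg x l))
    (fun x j => (x j).1)
  have h3 := ent_le_sum_logb hQ (fun l : Fin K => ¬ Even (l : ℕ)) c.M (fun x l => c.msg x l)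
  linarith

end Rates

/-! ### The single-letter variables of a code -/

section SingleLetter

variable {K n : ℕ} {X₁ X₂ X'₁ X'₂ : Type*} (c : InteractiveCode K n X₁ X₂ X'₁ X'₂)

/-- The auxiliary variables of the converse, for a position `i` of the block: every one of them
contains `i`, the first sequence before `i` and the second sequence after `i`. With `K = 0` rounds
there is no auxiliary variable to carry this information, so that case is treated separately
below. -/
def aux (z : Fin n × (Fin n → X₁ × X₂)) (l : Fin K) :
    (Fin n × (Fin n → Option X₁) × (Fin n → Option X₂)) × Fin (c.M l) :=
  ((z.1, mask (· < z.1) (fun j => (z.2 j).1), mask (z.1 < ·) (fun j => (z.2 j).2)), c.msg z.2 l)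

theorem aux_eq_aux_iff {z z' : Fin n × (Fin n → X₁ × X₂)} {l : Fin K} :
    c.aux z l = c.aux z' l ↔ z.1 = z'.1 ∧ (∀ j < z.1, (z.2 j).1 = (z'.2 j).1) ∧
      (∀ j, z.1 < j → (z.2 j).2 = (z'.2 j).2) ∧ c.msg z.2 l = c.msg z'.2 l := by
  obtain ⟨i, x⟩ := z
  obtain ⟨i', x'⟩ := z'
  simp only [aux, Prod.mk.injEq]
  constructor
  · rintro ⟨⟨rfl, h1, h2⟩, h3⟩
    exact ⟨rfl, mask_eq_mask_iff.1 h1, mask_eq_mask_iff.1 h2, h3⟩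
  · rintro ⟨rfl, h1, h2, h3⟩
    exact ⟨⟨rfl, mask_eq_mask_iff.2 h1, mask_eq_mask_iff.2 h2⟩, h3⟩

/-- The block with first sequence from `x` and second sequence from `x'`. -/
def comb (x x' : Fin n → X₁ × X₂) (j : Fin n) : X₁ × X₂ := ((x j).1, (x' j).2)

theorem msg_comb {x x' : Fin n → X₁ × X₂} (k : ℕ)
    (h : ∀ j : Fin K, (j : ℕ) < k → c.msg x j = c.msg x' j) (j : Fin K) (hj : (j : ℕ) < k) :
    c.msg (comb x x') j = c.msg x j :=
  c.message_exchange k h j hj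

variable {p : X₁ × X₂ → ℝ}

theorem iid_comb_mul {x x' : Fin n → X₁ × X₂}
    (h : ∀ j, (x j).1 = (x' j).1 ∨ (x j).2 = (x' j).2) :
    iid (Fin n) p (comb x x') * iid (Fin n) p (comb x' x) =
      iid (Fin n) p x * iid (Fin n) p x' := by
  simp only [iid, ← prod_mul_distrib]
  refine prod_congr rfl fun j _ => ?_
  rcases h j with h | h
  · have e1 : comb x x' j = x' j := Prod.ext h rfl
    have e2 : comb x' x j = x j := Prod.ext h.symm rfl
    rw [e1, e2, mul_comm]
  · have e1 : comb x x' j = x j := Prod.ext rfl h.symm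
    have e2 : comb x' x j = x' j := Prod.ext rfl h
    rw [e1, e2]

theorem iid_update_mul (x x' : Fin n → X₁ × X₂) (i i' : Fin n) :
    iid (Fin n) p (Function.update x' i' (x i)) * iid (Fin n) p (Function.update x i (x' i')) =
      iid (Fin n) p x * iid (Fin n) p x' := by
  have h : ∀ (x : Fin n → X₁ × X₂) (i : Fin n) (a : X₁ × X₂),
      iid (Fin n) p (Function.update x i a) = p a * ∏ j ∈ univ.erase i, p (x j) := by
    intro x i a
    rw [iid, ← mul_prod_erase univ _ (mem_univ i), Function.update_self]
    congr 1
    exact prod_congr rfl fun j hj => by rw [Function.update_of_ne (ne_of_mem_erase hj)]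
  have h' : ∀ (x : Fin n → X₁ × X₂) (i : Fin n),
      iid (Fin n) p x = p (x i) * ∏ j ∈ univ.erase i, p (x j) := by
    intro x i
    rw [iid, ← mul_prod_erase univ _ (mem_univ i)]
  rw [h, h, h' x i, h' x' i']
  ring

/-- If two outcomes share the position `i`, the first sequence before `i`, the second one after `i`
and one of the symbols at `i`, then `comb` preserves the product of the weights. -/
theorem timeShare_comb_mul {z z' : Fin n × (Fin n → X₁ × X₂)}
    (h1 : ∀ j < z.1, (z.2 j).1 = (z'.2 j).1) (h2 : ∀ j, z.1 < j → (z.2 j).2 = (z'.2 j).2)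
    (h3 : (z.2 z.1).1 = (z'.2 z.1).1 ∨ (z.2 z.1).2 = (z'.2 z.1).2) :
    timeShare n (iid (Fin n) p) (z.1, comb z.2 z'.2) *
      timeShare n (iid (Fin n) p) (z'.1, comb z'.2 z.2) =
      timeShare n (iid (Fin n) p) z * timeShare n (iid (Fin n) p) z' := by
  have := iid_comb_mul (p := p) (x := z.2) (x' := z'.2) fun j => by
    rcases lt_trichotomy j z.1 with hj | rfl | hj
    exacts [Or.inl (h1 j hj), h3, Or.inr (h2 j hj)]
  simp only [timeShare]
  linear_combination (n : ℝ)⁻¹ ^ 2 * this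

variable [Fintype X₁] [Fintype X₂]

/-- Exchange with the first sequence taken from the first outcome. -/
theorem isMarkovChain_comb₁ {β γ : Type*} {g : Fin n × (Fin n → X₁ × X₂) → β}
    {h : Fin n × (Fin n → X₁ × X₂) → γ}
    (H : ∀ z z', g z = g z' → z.1 = z'.1 ∧ (∀ j < z.1, (z.2 j).1 = (z'.2 j).1) ∧
      (∀ j, z.1 < j → (z.2 j).2 = (z'.2 j).2) ∧ (z.2 z.1).2 = (z'.2 z.1).2 ∧
      g (z.1, comb z.2 z'.2) = g z ∧ h (z.1, comb z.2 z'.2) = h z') :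
    IsMarkovChain (timeShare n (iid (Fin n) p)) (fun z => (z.2 z.1).1) g h := by
  refine .of_swap (fun z z' => (z.1, comb z.2 z'.2)) (fun z z' e => ?_) (fun z z' e => rfl)
    (fun z z' e => (H z z' e).2.2.2.2.1) (fun z z' e => (H z z' e).2.2.2.2.2) (fun z z' e => ?_)
  · obtain ⟨h0, h1, h2, h3, -⟩ := H z z' e
    exact timeShare_comb_mul h1 h2 (Or.inr h3)
  · rfl

/-- Exchange with the second sequence taken from the first outcome. -/
theorem isMarkovChain_comb₂ {β γ : Type*} {g : Fin n × (Fin n → X₁ × X₂) → β}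
    {h : Fin n × (Fin n → X₁ × X₂) → γ}
    (H : ∀ z z', g z = g z' → z.1 = z'.1 ∧ (∀ j < z.1, (z.2 j).1 = (z'.2 j).1) ∧
      (∀ j, z.1 < j → (z.2 j).2 = (z'.2 j).2) ∧ (z.2 z.1).1 = (z'.2 z.1).1 ∧
      g (z.1, comb z'.2 z.2) = g z ∧ h (z.1, comb z'.2 z.2) = h z') :
    IsMarkovChain (timeShare n (iid (Fin n) p)) (fun z => (z.2 z.1).2) g h := by
  refine .of_swap (fun z z' => (z.1, comb z'.2 z.2)) (fun z z' e => ?_) (fun z z' e => rfl)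
    (fun z z' e => (H z z' e).2.2.2.2.1) (fun z z' e => (H z z' e).2.2.2.2.2) (fun z z' e => ?_)
  · obtain ⟨h0, h1, h2, h3, -⟩ := H z z' e
    have := timeShare_comb_mul (p := p) h1 h2 (Or.inl h3)
    rw [← this, mul_comm]
    dsimp only [timeShare]
  · rfl

/-- Exchange of the symbols at the two positions. -/
theorem isMarkovChain_update {α β γ : Type*} {f : X₁ × X₂ → α} {g : X₁ × X₂ → β}
    {h : Fin n × (Fin n → X₁ × X₂) → γ}
    (H : ∀ (z : Fin n × (Fin n → X₁ × X₂)) a, g a = g (z.2 z.1) →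
      h (z.1, Function.update z.2 z.1 a) = h z) :
    IsMarkovChain (timeShare n (iid (Fin n) p)) (fun z => f (z.2 z.1)) (fun z => g (z.2 z.1))
      h := by
  refine .of_swap (fun z z' => (z'.1, Function.update z'.2 z'.1 (z.2 z.1))) (fun z z' e => ?_)
    (fun z z' e => ?_) (fun z z' e => ?_) (fun z z' e => ?_) (fun z z' e => ?_)
  · have := iid_update_mul (p := p) z.2 z'.2 z.1 z'.1
    simp only [timeShare]
    linear_combination (n : ℝ)⁻¹ ^ 2 * this
  · simp
  · simp
  · exact H z' _ e
  · simp

theorem aux_markov_odd (l : Fin K) (hl : Odd (l : ℕ)) :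
    IsMarkovChain (timeShare n (iid (Fin n) p)) (fun z => (z.2 z.1).1)
      (fun z => (past l (c.aux z), (z.2 z.1).2)) (fun z => c.aux z l) := by
  have hl0 : 0 < (l : ℕ) := hl.pos
  have hl' : ¬ Even (l : ℕ) := Nat.not_even_iff_odd.2 hl
  refine isMarkovChain_comb₁ fun z z' e => ?_
  obtain ⟨e1, e2⟩ := Prod.mk.inj e
  have e3 : ∀ j, j < l → c.aux z j = c.aux z' j := fun j hj => congrFun e1 ⟨j, hj⟩
  have h0 := c.aux_eq_aux_iff.1 (e3 ⟨0, hl0.trans l.2⟩ hl0)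
  obtain ⟨h1, h2, h3, -⟩ := h0
  have hm : ∀ j : Fin K, (j : ℕ) < l → c.msg z.2 j = c.msg z'.2 j := fun j hj =>
    (c.aux_eq_aux_iff.1 (e3 j hj)).2.2.2
  have hmc := c.msg_comb l hm
  refine ⟨h1, h2, h3, by rw [e2, h1], Prod.ext (funext fun j => ?_) ?_, ?_⟩
  · exact c.aux_eq_aux_iff.2 ⟨rfl, fun _ _ => rfl, fun i hi => (h3 i hi).symm, hmc j.1 j.2⟩
  · exact (e2.trans (by rw [h1]; rfl)).symm
  · refine c.aux_eq_aux_iff.2 ⟨h1, h2, fun _ _ => rfl, ?_⟩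
    refine (c.message_of_not_even hl' _ _).trans ((congrArg _ ?_).trans
      (c.message_of_not_even hl' _ _).symm)
    funext j
    exact (hmc j.1 j.2).trans (hm j.1 j.2)

/-- For `l = 0` nothing is shared but the symbol of terminal 1, and the symbols at the two positions
are exchanged instead of whole sequences. -/
theorem aux_markov_even (l : Fin K) (hl : Even (l : ℕ)) :
    IsMarkovChain (timeShare n (iid (Fin n) p)) (fun z => (z.2 z.1).2)
      (fun z => (past l (c.aux z), (z.2 z.1).1)) (fun z => c.aux z l) := by
  by_cases hl0 : (l : ℕ) = 0
  · have hsub : IsEmpty {j : Fin K // j < l} :=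
      ⟨fun j => by have : (j.1 : ℕ) < l := j.2; omega⟩
    have := isMarkovChain_update (p := p) (f := Prod.snd) (g := Prod.fst)
      (h := fun z => c.aux z l) (fun z a ha => ?_)
    · refine this.congr (.refl _ _) (fun z z' _ _ => ?_) (.refl _ _)
      simp only [Prod.mk.injEq, eq_iff_true_of_subsingleton, true_and]
    · have hx : ∀ j, (Function.update z.2 z.1 a j).1 = (z.2 j).1 := fun j => by
        by_cases hj : j = z.1
        · subst hj
          simpa using ha
        · rw [Function.update_of_ne hj]
      refine c.aux_eq_aux_iff.2 ⟨rfl, fun j _ => hx j,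
        fun j hj => by dsimp only at hj ⊢; rw [Function.update_of_ne hj.ne'], ?_⟩
      simp only [msg]
      rw [c.message_of_even hl, c.message_of_even hl]
      congr 1
      · exact funext hx
      · exact Subsingleton.elim _ _
  · have hl0 : 0 < (l : ℕ) := Nat.pos_of_ne_zero hl0
    refine isMarkovChain_comb₂ fun z z' e => ?_
    obtain ⟨e1, e2⟩ := Prod.mk.inj e
    have e3 : ∀ j, j < l → c.aux z j = c.aux z' j := fun j hj => congrFun e1 ⟨j, hj⟩
    have h0 := c.aux_eq_aux_iff.1 (e3 ⟨0, hl0.trans l.2⟩ hl0)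
    obtain ⟨h1, h2, h3, -⟩ := h0
    have hm : ∀ j : Fin K, (j : ℕ) < l → c.msg z'.2 j = c.msg z.2 j := fun j hj =>
      (c.aux_eq_aux_iff.1 (e3 j hj)).2.2.2.symm
    have hmc := c.msg_comb l hm
    refine ⟨h1, h2, h3, by rw [e2, h1], Prod.ext (funext fun j => ?_) ?_, ?_⟩
    · exact c.aux_eq_aux_iff.2 ⟨rfl, fun i hi => (h2 i hi).symm, fun _ _ => rfl,
        (hmc j.1 j.2).trans (hm j.1 j.2)⟩
    · exact (e2.trans (by rw [h1]; rfl)).symm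
    · refine c.aux_eq_aux_iff.2 ⟨h1, fun _ _ => rfl, h3, ?_⟩
      refine (c.message_of_even hl _ _).trans ((congrArg _ ?_).trans
        (c.message_of_even hl _ _).symm)
      funext j
      exact hmc j.1 j.2

/-- Given all auxiliary variables and its own symbol, what else terminal 2 knows is independent of
the symbol of terminal 1. -/
theorem aux_markov_dec₁ :
    IsMarkovChain (timeShare n (iid (Fin n) p)) (fun z => (z.2 z.1).1)
      (fun z => ((z.2 z.1).2, c.aux z)) (fun z => (z.1, fun j => (z.2 j).2)) := by
  rcases Nat.eq_zero_or_pos K with rfl | hK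
  · have := isMarkovChain_update (p := p) (f := Prod.fst) (g := Prod.snd)
      (h := fun z : Fin n × (Fin n → X₁ × X₂) => (z.1, fun j => (z.2 j).2)) (fun z a ha => ?_)
    · refine this.congr (.refl _ _) (fun z z' _ _ => ?_) (.refl _ _)
      simp only [Prod.mk.injEq, eq_iff_true_of_subsingleton, and_true]
    · refine Prod.ext rfl (funext fun j => ?_)
      by_cases hj : j = z.1
      · subst hj
        simpa using ha
      · simp [hj]
  · refine isMarkovChain_comb₁ fun z z' e => ?_
    obtain ⟨e2, e1⟩ := Prod.mk.inj e
    obtain ⟨h1, h2, h3, -⟩ := c.aux_eq_aux_iff.1 (congrFun e1 ⟨0, hK⟩)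
    have hm : ∀ j : Fin K, (j : ℕ) < K → c.msg z.2 j = c.msg z'.2 j := fun j _ =>
      (c.aux_eq_aux_iff.1 (congrFun e1 j)).2.2.2
    refine ⟨h1, h2, h3, by rw [e2, h1], Prod.ext ?_ (funext fun j => ?_), Prod.ext h1 rfl⟩
    · exact (e2.trans (by rw [h1]; rfl)).symm
    · exact c.aux_eq_aux_iff.2 ⟨rfl, fun _ _ => rfl, fun i hi => (h3 i hi).symm,
        c.msg_comb K hm j j.2⟩

theorem aux_markov_dec₂ :
    IsMarkovChain (timeShare n (iid (Fin n) p)) (fun z => (z.2 z.1).2)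
      (fun z => ((z.2 z.1).1, c.aux z)) (fun z => (z.1, fun j => (z.2 j).1)) := by
  rcases Nat.eq_zero_or_pos K with rfl | hK
  · have := isMarkovChain_update (p := p) (f := Prod.snd) (g := Prod.fst)
      (h := fun z : Fin n × (Fin n → X₁ × X₂) => (z.1, fun j => (z.2 j).1)) (fun z a ha => ?_)
    · refine this.congr (.refl _ _) (fun z z' _ _ => ?_) (.refl _ _)
      simp only [Prod.mk.injEq, eq_iff_true_of_subsingleton, and_true]
    · refine Prod.ext rfl (funext fun j => ?_)
      by_cases hj : j = z.1
      · subst hj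
        simpa using ha
      · simp [hj]
  · refine isMarkovChain_comb₂ fun z z' e => ?_
    obtain ⟨e2, e1⟩ := Prod.mk.inj e
    obtain ⟨h1, h2, h3, -⟩ := c.aux_eq_aux_iff.1 (congrFun e1 ⟨0, hK⟩)
    have hm : ∀ j : Fin K, (j : ℕ) < K → c.msg z'.2 j = c.msg z.2 j := fun j _ =>
      (c.aux_eq_aux_iff.1 (congrFun e1 j)).2.2.2.symm
    refine ⟨h1, h2, h3, by rw [e2, h1], Prod.ext ?_ (funext fun j => ?_), Prod.ext h1 rfl⟩
    · exact (e2.trans (by rw [h1]; rfl)).symm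
    · exact c.aux_eq_aux_iff.2 ⟨rfl, fun i hi => (h2 i hi).symm, fun _ _ => rfl,
        (c.msg_comb K hm j j.2).trans (hm j j.2)⟩

end SingleLetter

end InteractiveCode

namespace InteractiveCode

section Converse

variable {K n : ℕ} {X₁ X₂ X'₁ X'₂ : Type*} [Fintype X₁] [Fintype X₂]
  (c : InteractiveCode K n X₁ X₂ X'₁ X'₂) {p : X₁ × X₂ → ℝ}

theorem ent_timeShare_iid {α : Type*} (hn : n ≠ 0) (hp : p ∈ stdSimplex ℝ (X₁ × X₂))
    (f : X₁ × X₂ → α) :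
    ent (timeShare n (iid (Fin n) p)) (fun z => f (z.2 z.1)) = ent p f := by
  have hl : ∀ a, law (timeShare n (iid (Fin n) p)) (fun z => f (z.2 z.1)) a = law p f a := by
    intro a
    rw [law_timeShare (iid (Fin n) p) (fun i x => f (x i))]
    simp_rw [law_iid_apply hp]
    simp [hn]
  unfold ent
  simp_rw [hl]
  rw [sum_timeShare_mul (iid (Fin n) p) (fun i x => Real.logb 2 (law p f (f (x i))))]
  simp_rw [sum_iid_mul_apply hp _ (fun a => Real.logb 2 (law p f (f a)))]
  simp [hn]

theorem law_timeShare_iid (hn : n ≠ 0) (hp : p ∈ stdSimplex ℝ (X₁ × X₂)) (a : X₁ × X₂) :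
    law (timeShare n (iid (Fin n) p)) (fun z => ((z.2 z.1).1, (z.2 z.1).2)) a = p a := by
  rw [law_timeShare (iid (Fin n) p) (fun i x => x i)]
  simp_rw [law_iid_apply hp _ (fun a => a)]
  have : law p (fun a => a) a = p a := by
    unfold law
    exact (sum_eq_single a (fun b _ hb => if_neg hb)
      (fun h => absurd (mem_univ a) h)).trans (if_pos rfl)
  simp [hn, this]

/-- In single-letter form, `H(X₁ | U, X₂) ≥ H(X₁ | X₂) - R₁`. The chain rule for the first sequence
runs forwards, so that the condition on its symbol at `i` is the first sequence before `i`, the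
second one from `i` on, and the messages. -/
theorem ent_aux_le₁ (hn : n ≠ 0) (hp : p ∈ stdSimplex ℝ (X₁ × X₂)) :
    ent (timeShare n (iid (Fin n) p)) (fun z => (c.aux z, (z.2 z.1).2)) -
      ent (timeShare n (iid (Fin n) p)) (fun z => ((z.2 z.1).1, c.aux z, (z.2 z.1).2)) ≤
      c.sumRate₁ + ent p Prod.snd - ent p (fun a => (a.1, a.2)) := by
  set q := timeShare n (iid (Fin n) p) with hq
  have hQ : iid (Fin n) p ∈ stdSimplex ℝ (Fin n → X₁ × X₂) := iid_mem_stdSimplex hp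
  have hqs := timeShare_mem_stdSimplex hn hQ
  rcases Nat.eq_zero_or_pos K with rfl | hK
  · have e1 : ent q (fun z => (c.aux z, (z.2 z.1).2)) = ent p Prod.snd := by
      rw [← ent_timeShare_iid hn hp]
      exact ent_congr fun z z' _ _ => by simp [eq_iff_true_of_subsingleton]
    have e2 : ent q (fun z => ((z.2 z.1).1, c.aux z, (z.2 z.1).2)) =
        ent p (fun a => (a.1, a.2)) := by
      rw [← ent_timeShare_iid hn hp]
      exact ent_congr fun z z' _ _ => by
        simp [eq_iff_true_of_subsingleton, Prod.ext_iff]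
    rw [e1, e2]
    simp [sumRate₁]
  · have e1 : ent q (fun z => (c.aux z, (z.2 z.1).2)) = ent q (fun z => (z.1,
        mask (· < z.1) (fun j => (z.2 j).1), c.msg z.2,
        mask (¬ · < z.1) (fun j => (z.2 j).2))) := by
      refine ent_congr fun z z' _ _ => ?_
      obtain ⟨i, x⟩ := z
      obtain ⟨i', x'⟩ := z'
      simp only [Prod.mk.injEq]
      constructor
      · rintro ⟨h1, h2⟩
        have h3 := fun l => c.aux_eq_aux_iff.1 (congrFun h1 l)
        obtain ⟨rfl, h5, h6, -⟩ := h3 ⟨0, hK⟩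
        refine ⟨rfl, mask_eq_mask_iff.2 h5, funext fun l => (h3 l).2.2.2,
          mask_eq_mask_iff.2 fun j hj => ?_⟩
        rcases (not_lt.1 hj).lt_or_eq with hj | rfl
        exacts [h6 j hj, h2]
      · rintro ⟨rfl, h1, h2, h3⟩
        rw [mask_eq_mask_iff] at h1 h3
        exact ⟨funext fun l => c.aux_eq_aux_iff.2 ⟨rfl, h1, fun j hj => h3 j (not_lt.2 hj.le),
          congrFun h2 l⟩, h3 i (lt_irrefl _)⟩
    have e2 : ent q (fun z => ((z.2 z.1).1, c.aux z, (z.2 z.1).2)) = ent q (fun z => (z.1,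
        (z.2 z.1).1, mask (· < z.1) (fun j => (z.2 j).1), c.msg z.2,
        mask (¬ · < z.1) (fun j => (z.2 j).2))) := by
      refine ent_congr fun z z' _ _ => ?_
      obtain ⟨i, x⟩ := z
      obtain ⟨i', x'⟩ := z'
      simp only [Prod.mk.injEq]
      constructor
      · rintro ⟨h0, h1, h2⟩
        have h3 := fun l => c.aux_eq_aux_iff.1 (congrFun h1 l)
        obtain ⟨rfl, h5, h6, -⟩ := h3 ⟨0, hK⟩
        refine ⟨rfl, h0, mask_eq_mask_iff.2 h5, funext fun l => (h3 l).2.2.2,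
          mask_eq_mask_iff.2 fun j hj => ?_⟩
        rcases (not_lt.1 hj).lt_or_eq with hj | rfl
        exacts [h6 j hj, h2]
      · rintro ⟨rfl, h0, h1, h2, h3⟩
        rw [mask_eq_mask_iff] at h1 h3
        exact ⟨h0, funext fun l => c.aux_eq_aux_iff.2 ⟨rfl, h1, fun j hj => h3 j (not_lt.2 hj.le),
          congrFun h2 l⟩, h3 i (lt_irrefl _)⟩
    have hchain := ent_chain_le hQ (Equiv.refl (Fin n)) (fun x j => (x j).1) (fun x j => (x j).2)
      c.msg
    simp only [Equiv.refl_apply] at hchain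
    rw [sum_sub_distrib] at hchain
    have h1 : ent (iid (Fin n) p) (fun x => ((fun j => (x j).1), c.msg x, fun j => (x j).2)) =
        n * ent p (fun a => (a.1, a.2)) := by
      have := ent_iid (ι := Fin n) hp (fun a => (a.1, a.2))
      rw [Fintype.card_fin] at this
      rw [← this]
      refine ent_congr fun x x' _ _ => ?_
      simp only [Prod.mk.injEq, funext_iff]
      constructor
      · rintro ⟨h1, -, h2⟩
        exact fun j => ⟨h1 j, h2 j⟩
      · intro h
        have : x = x' := funext fun j => Prod.ext (h j).1 (h j).2
        subst this
        simp
    have h2 : ent (iid (Fin n) p) (fun x j => (x j).2) = n * ent p Prod.snd := by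
      have := ent_iid (ι := Fin n) hp Prod.snd
      rwa [Fintype.card_fin] at this
    have h3 := c.ent_msg_le₁ hQ
    rw [e1, e2, hq, ent_timeShare hn hQ (fun i x => (mask (· < i) (fun j => (x j).1), c.msg x,
        mask (¬ · < i) (fun j => (x j).2))), ent_timeShare hn hQ (fun i x => ((x i).1,
        mask (· < i) (fun j => (x j).1), c.msg x, mask (¬ · < i) (fun j => (x j).2)))]
    rw [h1] at hchain
    rw [h2] at h3
    have hn' : (0 : ℝ) < n := by positivity
    rw [sumRate₁, ← sub_nonneg]
    have h4 : (0 : ℝ) ≤ (n : ℝ)⁻¹ := by positivity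
    have h5 := mul_nonneg h4 (sub_nonneg.2 hchain)
    have h6 := mul_nonneg h4 (sub_nonneg.2 h3)
    have h7 : (n : ℝ)⁻¹ * n = 1 := inv_mul_cancel₀ hn'.ne'
    rw [div_eq_inv_mul]
    linear_combination h5 + h6 - (ent p (fun a => (a.1, a.2)) - ent p Prod.snd) * h7

/-- As `ent_aux_le₁`, with the chain rule running backwards through the second sequence. -/
theorem ent_aux_le₂ (hn : n ≠ 0) (hp : p ∈ stdSimplex ℝ (X₁ × X₂)) :
    ent (timeShare n (iid (Fin n) p)) (fun z => (c.aux z, (z.2 z.1).1)) -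
      ent (timeShare n (iid (Fin n) p)) (fun z => ((z.2 z.1).2, c.aux z, (z.2 z.1).1)) ≤
      c.sumRate₂ + ent p Prod.fst - ent p (fun a => (a.1, a.2)) := by
  set q := timeShare n (iid (Fin n) p) with hq
  have hQ : iid (Fin n) p ∈ stdSimplex ℝ (Fin n → X₁ × X₂) := iid_mem_stdSimplex hp
  have hqs := timeShare_mem_stdSimplex hn hQ
  rcases Nat.eq_zero_or_pos K with rfl | hK
  · have e1 : ent q (fun z => (c.aux z, (z.2 z.1).1)) = ent p Prod.fst := by
      rw [← ent_timeShare_iid hn hp]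
      exact ent_congr fun z z' _ _ => by simp [eq_iff_true_of_subsingleton]
    have e2 : ent q (fun z => ((z.2 z.1).2, c.aux z, (z.2 z.1).1)) =
        ent p (fun a => (a.1, a.2)) := by
      rw [← ent_timeShare_iid hn hp]
      exact ent_congr fun z z' _ _ => by
        simp [eq_iff_true_of_subsingleton, Prod.ext_iff, and_comm]
    rw [e1, e2]
    simp [sumRate₂]
  · have e1 : ent q (fun z => (c.aux z, (z.2 z.1).1)) = ent q (fun z => (z.1,
        mask (z.1 < ·) (fun j => (z.2 j).2), c.msg z.2,
        mask (¬ z.1 < ·) (fun j => (z.2 j).1))) := by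
      refine ent_congr fun z z' _ _ => ?_
      obtain ⟨i, x⟩ := z
      obtain ⟨i', x'⟩ := z'
      simp only [Prod.mk.injEq]
      constructor
      · rintro ⟨h1, h2⟩
        have h3 := fun l => c.aux_eq_aux_iff.1 (congrFun h1 l)
        obtain ⟨rfl, h5, h6, -⟩ := h3 ⟨0, hK⟩
        refine ⟨rfl, mask_eq_mask_iff.2 h6, funext fun l => (h3 l).2.2.2,
          mask_eq_mask_iff.2 fun j hj => ?_⟩
        rcases (not_lt.1 hj).lt_or_eq with hj | rfl
        exacts [h5 j hj, h2]
      · rintro ⟨rfl, h1, h2, h3⟩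
        rw [mask_eq_mask_iff] at h1 h3
        exact ⟨funext fun l => c.aux_eq_aux_iff.2 ⟨rfl, fun j hj => h3 j (not_lt.2 hj.le), h1,
          congrFun h2 l⟩, h3 i (lt_irrefl _)⟩
    have e2 : ent q (fun z => ((z.2 z.1).2, c.aux z, (z.2 z.1).1)) = ent q (fun z => (z.1,
        (z.2 z.1).2, mask (z.1 < ·) (fun j => (z.2 j).2), c.msg z.2,
        mask (¬ z.1 < ·) (fun j => (z.2 j).1))) := by
      refine ent_congr fun z z' _ _ => ?_
      obtain ⟨i, x⟩ := z
      obtain ⟨i', x'⟩ := z'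
      simp only [Prod.mk.injEq]
      constructor
      · rintro ⟨h0, h1, h2⟩
        have h3 := fun l => c.aux_eq_aux_iff.1 (congrFun h1 l)
        obtain ⟨rfl, h5, h6, -⟩ := h3 ⟨0, hK⟩
        refine ⟨rfl, h0, mask_eq_mask_iff.2 h6, funext fun l => (h3 l).2.2.2,
          mask_eq_mask_iff.2 fun j hj => ?_⟩
        rcases (not_lt.1 hj).lt_or_eq with hj | rfl
        exacts [h5 j hj, h2]
      · rintro ⟨rfl, h0, h1, h2, h3⟩
        rw [mask_eq_mask_iff] at h1 h3
        exact ⟨h0, funext fun l => c.aux_eq_aux_iff.2 ⟨rfl, fun j hj => h3 j (not_lt.2 hj.le), h1,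
          congrFun h2 l⟩, h3 i (lt_irrefl _)⟩
    have hchain := ent_chain_le hQ Fin.revPerm (fun x j => (x j).2) (fun x j => (x j).1)
      c.msg
    simp only [Fin.revPerm_apply, Fin.rev_lt_rev] at hchain
    rw [sum_sub_distrib] at hchain
    have h1 : ent (iid (Fin n) p) (fun x => ((fun j => (x j).2), c.msg x, fun j => (x j).1)) =
        n * ent p (fun a => (a.1, a.2)) := by
      have := ent_iid (ι := Fin n) hp (fun a => (a.1, a.2))
      rw [Fintype.card_fin] at this
      rw [← this]
      refine ent_congr fun x x' _ _ => ?_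
      simp only [Prod.mk.injEq, funext_iff]
      constructor
      · rintro ⟨h1, -, h2⟩
        exact fun j => ⟨h2 j, h1 j⟩
      · intro h
        have : x = x' := funext fun j => Prod.ext (h j).1 (h j).2
        subst this
        simp
    have h2 : ent (iid (Fin n) p) (fun x j => (x j).1) = n * ent p Prod.fst := by
      have := ent_iid (ι := Fin n) hp Prod.fst
      rwa [Fintype.card_fin] at this
    have h3 := c.ent_msg_le₂ hQ
    rw [e1, e2, hq, ent_timeShare hn hQ (fun i x => (mask (i < ·) (fun j => (x j).2), c.msg x,
        mask (¬ i < ·) (fun j => (x j).1))), ent_timeShare hn hQ (fun i x => ((x i).2,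
        mask (i < ·) (fun j => (x j).2), c.msg x, mask (¬ i < ·) (fun j => (x j).1)))]
    rw [h1] at hchain
    rw [h2] at h3
    have hn' : (0 : ℝ) < n := by positivity
    rw [sumRate₂, ← sub_nonneg]
    have h4 : (0 : ℝ) ≤ (n : ℝ)⁻¹ := by positivity
    have h5 := mul_nonneg h4 (sub_nonneg.2 hchain)
    have h6 := mul_nonneg h4 (sub_nonneg.2 h3)
    have h7 : (n : ℝ)⁻¹ * n = 1 := inv_mul_cancel₀ hn'.ne'
    rw [div_eq_inv_mul]
    linear_combination h5 + h6 - (ent p (fun a => (a.1, a.2)) - ent p Prod.fst) * h7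

theorem sum_sum_eq_sum_iid (F : (Fin n → X₁) → (Fin n → X₂) → ℝ) :
    ∑ x₁ : Fin n → X₁, ∑ x₂ : Fin n → X₂, (∏ i, p (x₁ i, x₂ i)) * F x₁ x₂ =
      ∑ x, iid (Fin n) p x * F (fun j => (x j).1) (fun j => (x j).2) := by
  rw [← Fintype.sum_prod_type', ← Equiv.sum_comp (Equiv.arrowProdEquivProdArrow (Fin n)
    (fun _ => X₁) (fun _ => X₂))]
  rfl

theorem distortion₁_eq (d₁ : X₁ → X'₁ → ℝ) : c.distortion₁ p d₁ =
    ∑ z, timeShare n (iid (Fin n) p) z *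
      d₁ (z.2 z.1).1 (c.dec₁ (fun j => (z.2 j).2) (c.msg z.2) z.1) := by
  rw [distortion₁, sum_sum_eq_sum_iid (fun x₁ x₂ =>
    (∑ i, d₁ (x₁ i) (c.dec₁ x₂ (c.message x₁ x₂) i)) / n), sum_timeShare_mul (iid (Fin n) p)
      (fun i x => d₁ (x i).1 (c.dec₁ (fun j => (x j).2) (c.msg x) i)), sum_comm, mul_sum]
  refine sum_congr rfl fun x _ => ?_
  rw [← mul_sum, div_eq_inv_mul]
  simp only [msg]
  ring

theorem distortion₂_eq (d₂ : X₂ → X'₂ → ℝ) : c.distortion₂ p d₂ =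
    ∑ z, timeShare n (iid (Fin n) p) z *
      d₂ (z.2 z.1).2 (c.dec₂ (fun j => (z.2 j).1) (c.msg z.2) z.1) := by
  rw [distortion₂, sum_sum_eq_sum_iid (fun x₁ x₂ =>
    (∑ i, d₂ (x₂ i) (c.dec₂ x₁ (c.message x₁ x₂) i)) / n), sum_timeShare_mul (iid (Fin n) p)
      (fun i x => d₂ (x i).2 (c.dec₂ (fun j => (x j).1) (c.msg x) i)), sum_comm, mul_sum]
  refine sum_congr rfl fun x _ => ?_
  rw [← mul_sum, div_eq_inv_mul]
  simp only [msg]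
  ring

/-- The rates and distortions of any code satisfy the constraints of the tradeoff region. -/
theorem mem_tradeoffRegion (hn : n ≠ 0) (hp : p ∈ stdSimplex ℝ (X₁ × X₂)) (d₁ : X₁ → X'₁ → ℝ)
    (d₂ : X₂ → X'₂ → ℝ) {t : ℝ × ℝ × ℝ × ℝ}
    (h₁ : c.sumRate₁ + mutualInfo p Prod.fst Prod.snd ≤ t.1)
    (h₂ : c.sumRate₂ + mutualInfo p Prod.fst Prod.snd ≤ t.2.1)
    (h₃ : c.distortion₁ p d₁ ≤ t.2.2.1) (h₄ : c.distortion₂ p d₂ ≤ t.2.2.2) :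
    t ∈ tradeoffRegion K (privateEqPublic p) d₁ d₂ := by
  have hqs := timeShare_mem_stdSimplex hn (iid_mem_stdSimplex (ι := Fin n) hp)
  have hI : mutualInfo p Prod.fst Prod.snd =
      ent p Prod.fst + ent p Prod.snd - ent p (fun a => (a.1, a.2)) :=
    mutualInfo_eq_ent hp.1 _ _
  refine IsTestChannel.mem_tradeoffRegion (q := timeShare n (iid (Fin n) p))
    (V := fun z => (z.2 z.1).1) (W := fun z => (z.2 z.1).2) (U := c.aux)
    ⟨hqs, law_timeShare_iid hn hp, c.aux_markov_odd, c.aux_markov_even, ?_, ?_, ?_, ?_⟩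
  · rw [mutualInfo_eq_ent hqs.1, ent_timeShare_iid hn hp Prod.fst]
    have := c.ent_aux_le₁ hn hp
    linarith
  · rw [mutualInfo_eq_ent hqs.1, ent_timeShare_iid hn hp Prod.snd]
    have := c.ent_aux_le₂ hn hp
    linarith
  · obtain ⟨g, hg⟩ := c.aux_markov_dec₁.exists_reconstruction hqs d₁
      (fun b h => c.dec₁ h.2 (fun l => (b.2 l).2) h.1)
    rw [distortion₁_eq] at h₃
    exact ⟨fun x u => g (x, u), hg.trans h₃⟩
  · obtain ⟨g, hg⟩ := c.aux_markov_dec₂.exists_reconstruction hqs d₂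
      (fun b h => c.dec₂ h.2 (fun l => (b.2 l).2) h.1)
    rw [distortion₂_eq] at h₄
    exact ⟨fun x u => g (x, u), hg.trans h₄⟩

end Converse

end InteractiveCode

/-! ### Random binning -/

section Binning

theorem sum_iid_mul_sq {ι Ω : Type*} [Fintype ι] [DecidableEq ι] [Fintype Ω] {q : Ω → ℝ}
    (hq : q ∈ stdSimplex ℝ Ω) (w : ι → ℝ) (y : Ω → ℝ) (hy : ∑ ω, q ω * y ω = 0) :
    ∑ x, iid ι q x * (∑ i, w i * y (x i)) ^ 2 = (∑ i, w i ^ 2) * ∑ ω, q ω * y ω ^ 2 := by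
  have h1 : ∀ x : ι → Ω, iid ι q x * (∑ i, w i * y (x i)) ^ 2 =
      ∑ i, ∑ j, w i * w j * (iid ι q x * (y (x i) * y (x j))) := by
    intro x
    rw [sq, sum_mul_sum, mul_sum]
    refine sum_congr rfl fun i _ => ?_
    rw [mul_sum]
    exact sum_congr rfl fun j _ => by ring
  simp_rw [h1]
  rw [sum_comm, sum_mul]
  refine sum_congr rfl fun i _ => ?_
  rw [sum_comm, sum_eq_single i]
  · rw [← mul_sum, ← sq]
    congr 1
    have := sum_iid_mul_apply hq i (fun ω => y ω ^ 2)
    rw [← this]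
    exact sum_congr rfl fun x _ => by ring
  · intro j _ hj
    rw [← mul_sum, sum_iid_mul_apply_mul hq hj.symm, hy]
    ring
  · simp

theorem exists_le_of_sum_mul_le {ι : Type*} [Fintype ι] {w : ι → ℝ} (hw : w ∈ stdSimplex ℝ ι)
    {F : ι → ℝ} {c : ℝ} (h : ∑ i, w i * F i ≤ c) : ∃ i, F i ≤ c := by
  by_contra hc
  push Not at hc
  have h1 : ∀ i ∈ univ, w i * c ≤ w i * F i := fun i _ =>
    mul_le_mul_of_nonneg_left (hc i).le (hw.1 i)
  have h2 : ∑ i, w i * c = c := by rw [← sum_mul, hw.2, one_mul]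
  obtain ⟨i, hi⟩ : ∃ i, w i ≠ 0 := by
    by_contra h0
    push Not at h0
    simpa [h0] using hw.2
  have h3 : ∑ i, w i * c < ∑ i, w i * F i :=
    sum_lt_sum h1 ⟨i, mem_univ i, mul_lt_mul_of_pos_left (hc i)
      (lt_of_le_of_ne (hw.1 i) hi.symm)⟩
  linarith

variable {𝒰 : Type*} [Fintype 𝒰]

/-- The uniform law. -/
def unif (α : Type*) [Fintype α] (_ : α) : ℝ := (Fintype.card α : ℝ)⁻¹

theorem unif_mem_stdSimplex (α : Type*) [Fintype α] [Nonempty α] : unif α ∈ stdSimplex ℝ α :=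
  ⟨fun _ => by unfold unif; positivity, by simp [unif]⟩

/-- Under a uniformly random binning `B`, the first bin index is almost uniform, given that most of
the probability `κ` is made up of small weights: its law is close to uniform in total variation.
Only pairwise independence of the bin indices enters, through the variance. -/
theorem sum_abs_bin_sub_le {a b : ℕ} [NeZero a] [NeZero b] {κ : 𝒰 → ℝ} (hκ : κ ∈ stdSimplex ℝ 𝒰)
    {γ η : ℝ} (hγ : 0 ≤ γ) (hη : 0 < η) (h : γ * (a - 1) ≤ η ^ 2) :
    ∑ B : 𝒰 → Fin a × Fin b, iid 𝒰 (unif (Fin a × Fin b)) B *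
      ∑ f : Fin a, |(a : ℝ)⁻¹ - ∑ u, if (B u).1 = f then κ u else 0| ≤
      η + 2 * ∑ u, if κ u ≤ γ then 0 else κ u := by
  set w := iid 𝒰 (unif (Fin a × Fin b)) with hw
  have hu := unif_mem_stdSimplex (Fin a × Fin b)
  have hws : w ∈ stdSimplex ℝ (𝒰 → Fin a × Fin b) := iid_mem_stdSimplex hu
  have ha : (0 : ℝ) < a := by exact_mod_cast Nat.pos_of_ne_zero (NeZero.ne a)
  have ha1 : (1 : ℝ) ≤ a := by exact_mod_cast Nat.pos_of_ne_zero (NeZero.ne a)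
  have hb : (0 : ℝ) < b := by exact_mod_cast Nat.pos_of_ne_zero (NeZero.ne b)
  set κt : 𝒰 → ℝ := fun u => if κ u ≤ γ then κ u else 0 with hκt
  set κo : 𝒰 → ℝ := fun u => if κ u ≤ γ then 0 else κ u with hκo
  have hκo0 : ∀ u, 0 ≤ κo u := fun u => by simp only [hκo]; split_ifs; exacts [le_rfl, hκ.1 u]
  have hκt0 : ∀ u, 0 ≤ κt u := fun u => by simp only [hκt]; split_ifs; exacts [hκ.1 u, le_rfl]
  have hsplit : ∀ u, κ u = κt u + κo u := fun u => by simp only [hκt, hκo]; split_ifs <;> simp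
  let y : Fin a → Fin a × Fin b → ℝ := fun f v => (a : ℝ)⁻¹ - if v.1 = f then 1 else 0
  have hEind : ∀ f : Fin a, ∑ v : Fin a × Fin b, (if v.1 = f then (1 : ℝ) else 0) = b := by
    intro f
    rw [Fintype.sum_prod_type, sum_eq_single f]
    · simp
    · intro i _ hi
      simp [hi]
    · simp
  have hy0 : ∀ f, ∑ v, unif (Fin a × Fin b) v * y f v = 0 := by
    intro f
    simp only [unif, y, ← mul_sum, sum_sub_distrib, hEind]
    simp
    right
    field_simp
    ring
  have hy2 : ∀ f, ∑ v, unif (Fin a × Fin b) v * y f v ^ 2 = (a - 1) / a ^ 2 := by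
    intro f
    have : ∀ v, y f v ^ 2 = (a : ℝ)⁻¹ ^ 2 + (1 - 2 * (a : ℝ)⁻¹) * if v.1 = f then 1 else 0 := by
      intro v
      simp only [y]
      split_ifs <;> ring
    simp_rw [this]
    simp only [unif, ← mul_sum, sum_add_distrib, hEind]
    simp
    field_simp
    ring
  -- the part of `κ` made up of small weights
  have hsmall : ∀ f : Fin a, ∑ B, w B * |∑ u, κt u * y f (B u)| ≤ η / a := by
    intro f
    have h1 := sum_iid_mul_sq (ι := 𝒰) hu κt (y f) (hy0 f)
    rw [hy2] at h1
    have h2 : ∑ u, κt u ^ 2 ≤ γ := by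
      calc ∑ u, κt u ^ 2 ≤ ∑ u, γ * κ u := by
            refine sum_le_sum fun u _ => ?_
            simp only [hκt]
            split_ifs with hu
            · rw [sq]
              exact mul_le_mul_of_nonneg_right hu (hκ.1 u)
            · simpa using mul_nonneg hγ (hκ.1 u)
        _ = γ := by rw [← mul_sum, hκ.2, mul_one]
    have h3 : ∑ B, w B * (∑ u, κt u * y f (B u)) ^ 2 ≤ (η / a) ^ 2 := by
      rw [h1, div_pow, ← mul_div_assoc]
      refine div_le_div_of_nonneg_right (le_trans ?_ h) (by positivity)
      exact mul_le_mul_of_nonneg_right h2 (by linarith)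
    have hs : 0 < η / a := by positivity
    have h4 : ∀ Z : ℝ, |Z| ≤ Z ^ 2 / (2 * (η / a)) + η / a / 2 := by
      intro Z
      rw [div_add_div _ _ (by positivity) (by norm_num), le_div_iff₀ (by positivity)]
      nlinarith [sq_nonneg (|Z| - η / a), sq_abs Z]
    calc ∑ B, w B * |∑ u, κt u * y f (B u)|
        ≤ ∑ B, w B * ((∑ u, κt u * y f (B u)) ^ 2 / (2 * (η / a)) + η / a / 2) :=
          sum_le_sum fun B _ => mul_le_mul_of_nonneg_left (h4 _) (hws.1 B)
      _ = (∑ B, w B * (∑ u, κt u * y f (B u)) ^ 2) / (2 * (η / a)) + η / a / 2 := by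
          simp_rw [mul_add, sum_add_distrib, ← sum_mul, hws.2, one_mul, ← mul_div_assoc, ← sum_div]
      _ ≤ (η / a) ^ 2 / (2 * (η / a)) + η / a / 2 := by gcongr
      _ = η / a := by field_simp; ring
  have hpt : ∀ (B : 𝒰 → Fin a × Fin b) (f : Fin a),
      |(a : ℝ)⁻¹ - ∑ u, if (B u).1 = f then κ u else 0| ≤ |∑ u, κt u * y f (B u)| +
        ((∑ u, κo u) * (a : ℝ)⁻¹ + ∑ u, κo u * if (B u).1 = f then 1 else 0) := by
    intro B f
    have e : (a : ℝ)⁻¹ - ∑ u, (if (B u).1 = f then κ u else 0) = ∑ u, κt u * y f (B u) +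
        ((∑ u, κo u) * (a : ℝ)⁻¹ - ∑ u, κo u * if (B u).1 = f then 1 else 0) := by
      have e1 : (a : ℝ)⁻¹ = ∑ u, (κt u + κo u) * (a : ℝ)⁻¹ := by
        rw [← sum_mul, ← sum_congr rfl fun u _ => hsplit u, hκ.2, one_mul]
      rw [e1]
      rw [sum_mul, ← sum_sub_distrib, ← sum_sub_distrib, ← sum_add_distrib]
      rw [← e1]
      refine sum_congr rfl fun u _ => ?_
      rw [hsplit u]
      simp only [y]
      split_ifs <;> ring
    have hA : 0 ≤ (∑ u, κo u) * (a : ℝ)⁻¹ :=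
      mul_nonneg (sum_nonneg fun u _ => hκo0 u) (by positivity)
    have hB : 0 ≤ ∑ u, κo u * (if (B u).1 = f then (1 : ℝ) else 0) :=
      sum_nonneg fun u _ => mul_nonneg (hκo0 u) (by split_ifs <;> simp)
    rw [e]
    refine (abs_add_le _ _).trans (add_le_add le_rfl ?_)
    rw [abs_le]
    constructor <;> linarith
  have hrest : ∀ B : 𝒰 → Fin a × Fin b, ∑ f : Fin a, ((∑ u, κo u) * (a : ℝ)⁻¹ +
      ∑ u, κo u * if (B u).1 = f then 1 else 0) = 2 * ∑ u, κo u := by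
    intro B
    rw [sum_add_distrib, sum_comm]
    simp_rw [← mul_sum]
    simp only [sum_const, card_univ, Fintype.card_fin, nsmul_eq_mul, sum_ite_eq, mem_univ, if_true]
    have : (a : ℝ) * (a : ℝ)⁻¹ = 1 := mul_inv_cancel₀ ha.ne'
    simp only [mul_one]
    linear_combination (∑ u, κo u) * this
  calc ∑ B, w B * ∑ f : Fin a, |(a : ℝ)⁻¹ - ∑ u, if (B u).1 = f then κ u else 0|
      ≤ ∑ B, w B * (∑ f : Fin a, |∑ u, κt u * y f (B u)| + 2 * ∑ u, κo u) := by
        refine sum_le_sum fun B _ => mul_le_mul_of_nonneg_left ?_ (hws.1 B)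
        rw [← hrest B, ← sum_add_distrib]
        exact sum_le_sum fun f _ => hpt B f
    _ = ∑ f : Fin a, ∑ B, w B * |∑ u, κt u * y f (B u)| + 2 * ∑ u, κo u := by
        simp_rw [mul_add, sum_add_distrib, ← sum_mul, hws.2, one_mul, mul_sum]
        rw [sum_comm]
    _ ≤ ∑ f : Fin a, η / a + 2 * ∑ u, κo u := by
        gcongr with f _
        exact hsmall f
    _ = η + 2 * ∑ u, κo u := by
        simp only [sum_const, card_univ, Fintype.card_fin, nsmul_eq_mul]
        field_simp

/-- A decoder that searches a list for an element with a given label. -/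
def listDecode {β : Type*} [Nonempty 𝒰] (D : Finset 𝒰) (B : 𝒰 → β) (v : β) : 𝒰 :=
  if h : ∃ u ∈ D, B u = v then h.choose else Classical.arbitrary 𝒰

/-- The expected error of a list decoder under random binning. -/
theorem sum_listDecode_error_le {β : Type*} [Fintype β] [Nonempty β] [Nonempty 𝒰] (D : Finset 𝒰)
    (u : 𝒰) :
    ∑ B : 𝒰 → β, iid 𝒰 (unif β) B * (if listDecode D B (B u) = u then 0 else 1) ≤
      (if u ∈ D then 0 else 1) + D.card / Fintype.card β := by
  have hu := unif_mem_stdSimplex β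
  have hws : iid 𝒰 (unif β) ∈ stdSimplex ℝ (𝒰 → β) := iid_mem_stdSimplex hu
  have hpt : ∀ B : 𝒰 → β, (if listDecode D B (B u) = u then (0 : ℝ) else 1) ≤
      (if u ∈ D then 0 else 1) + ∑ u' ∈ D.erase u, if B u' = B u then 1 else 0 := by
    intro B
    have hnn : (0 : ℝ) ≤ ∑ u' ∈ D.erase u, if B u' = B u then 1 else 0 :=
      sum_nonneg fun _ _ => by split_ifs <;> simp
    by_cases h1 : listDecode D B (B u) = u
    · rw [if_pos h1]
      split_ifs <;> linarith
    · by_cases h2 : u ∈ D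
      · rw [if_neg h1, if_pos h2, zero_add]
        have hex : ∃ u' ∈ D, B u' = B u := ⟨u, h2, rfl⟩
        have hspec := hex.choose_spec
        have h3 : listDecode D B (B u) = hex.choose := by rw [listDecode, dif_pos hex]
        rw [← h3] at hspec
        refine le_trans ?_ (single_le_sum (f := fun u' => if B u' = B u then (1 : ℝ) else 0)
          (fun _ _ => by split_ifs <;> simp) (mem_erase.2 ⟨h1, hspec.1⟩))
        rw [if_pos hspec.2]
      · rw [if_neg h1, if_neg h2]
        linarith
  have hpair : ∀ u' ∈ D.erase u, ∑ B : 𝒰 → β, iid 𝒰 (unif β) B *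
      (if B u' = B u then (1 : ℝ) else 0) = (Fintype.card β : ℝ)⁻¹ := by
    intro u' hu'
    have e : ∀ B : 𝒰 → β, iid 𝒰 (unif β) B * (if B u' = B u then (1 : ℝ) else 0) =
        ∑ v, iid 𝒰 (unif β) B *
          ((if B u' = v then (1 : ℝ) else 0) * (if B u = v then 1 else 0)) := by
      intro B
      rw [← mul_sum]
      congr 1
      simp only [ite_mul, one_mul, zero_mul, sum_ite_eq, mem_univ, if_true]
      simp only [eq_comm]
    simp_rw [e]
    rw [sum_comm, sum_congr rfl fun v _ => sum_iid_mul_apply_mul hu (ne_of_mem_erase hu')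
      (fun ω => if ω = v then (1 : ℝ) else 0) (fun ω => if ω = v then (1 : ℝ) else 0)]
    simp [unif]
  calc _ ≤ ∑ B : 𝒰 → β, iid 𝒰 (unif β) B * ((if u ∈ D then 0 else 1) +
        ∑ u' ∈ D.erase u, if B u' = B u then 1 else 0) :=
        sum_le_sum fun B _ => mul_le_mul_of_nonneg_left (hpt B) (hws.1 B)
    _ = (if u ∈ D then 0 else 1) + ∑ u' ∈ D.erase u, ∑ B : 𝒰 → β, iid 𝒰 (unif β) B *
        (if B u' = B u then (1 : ℝ) else 0) := by
        simp_rw [mul_add, sum_add_distrib, ← sum_mul, hws.2, one_mul, mul_sum]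
        rw [sum_comm]
    _ = (if u ∈ D then 0 else 1) + (D.erase u).card * (Fintype.card β : ℝ)⁻¹ := by
        rw [sum_congr rfl hpair, sum_const, nsmul_eq_mul]
    _ ≤ _ := by
        rw [div_eq_mul_inv]
        gcongr
        exact erase_subset _ _

end Binning

/-! ### One-shot compression with side information at the receiver -/

section OneShot

variable {𝒳 𝒴 𝒰 : Type*} [Fintype 𝒳] [Fintype 𝒴] [Fintype 𝒰]

/-- Restricting a law to one bin and choosing the cheapest element of the bin is, after averaging
over the bins, almost as good as drawing from the law, if the bins are almost equally likely. -/
theorem exists_choice_in_bin [Nonempty 𝒰] {κ : 𝒰 → ℝ} (hκ : ∀ u, 0 ≤ κ u) (P : 𝒰 → Prop)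
    [DecidablePred P] {C C' : 𝒰 → ℝ} (hC : ∀ u, P u → C' u = C u) {m : ℝ}
    (hm : ∀ u, 0 ≤ C' u ∧ C' u ≤ m) {s : ℝ} (hs : 0 ≤ s) :
    ∃ u, s * C' u ≤ (∑ u, if P u then κ u * C u else 0) +
      m * |s - ∑ u, if P u then κ u else 0| := by
  set S := ∑ u, if P u then κ u else 0 with hS
  have hm0 : 0 ≤ m := (hm (Classical.arbitrary 𝒰)).1.trans (hm _).2
  have hterm : ∀ u, 0 ≤ if P u then κ u else 0 := fun u => by
    split_ifs
    exacts [hκ u, le_rfl]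
  by_cases h0 : S = 0
  · refine ⟨Classical.arbitrary 𝒰, ?_⟩
    have h1 : ∀ u, (if P u then κ u else 0) = 0 := fun u =>
      (sum_eq_zero_iff_of_nonneg fun u _ => hterm u).1 h0 u (mem_univ u)
    have h2 : (∑ u, if P u then κ u * C u else 0) = 0 := sum_eq_zero fun u _ => by
      have := h1 u
      split_ifs with hu
      · rw [if_pos hu] at this
        rw [this, zero_mul]
      · rfl
    rw [h0, h2, sub_zero, abs_of_nonneg hs, zero_add, mul_comm m]
    exact mul_le_mul_of_nonneg_left (hm _).2 hs
  · obtain ⟨u₁, hu₁⟩ : ∃ u, P u := by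
      by_contra hc
      push Not at hc
      exact h0 (sum_eq_zero fun u _ => if_neg (hc u))
    obtain ⟨u₀, hu₀, hmin⟩ := exists_min_image (univ.filter P) C ⟨u₁, by simpa using hu₁⟩
    simp only [mem_filter, mem_univ, true_and] at hu₀ hmin
    refine ⟨u₀, ?_⟩
    have h1 : S * C' u₀ ≤ ∑ u, if P u then κ u * C u else 0 := by
      rw [hC u₀ hu₀, hS, sum_mul]
      refine sum_le_sum fun u _ => ?_
      split_ifs with hu
      · exact mul_le_mul_of_nonneg_left (hmin u hu) (hκ u)
      · simp
    have h2 : (s - S) * C' u₀ ≤ m * |s - S| := by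
      calc (s - S) * C' u₀ ≤ |s - S| * C' u₀ :=
            mul_le_mul_of_nonneg_right (le_abs_self _) (hm u₀).1
        _ ≤ |s - S| * m := mul_le_mul_of_nonneg_left (hm u₀).2 (abs_nonneg _)
        _ = m * |s - S| := mul_comm _ _
    linarith

/-- One round in one shot. The sender observes `x` and chooses `φ x`, the receiver observes `y` and
the message `enc x`, and tries to find `φ x`. Compared to `u` drawn from `κ x`, any cost `V` grows
little, and the receiver rarely fails. Both the bin that the choice of `φ x` is restricted to and
the message stem from one random binning, whose two indices have `a` and `b` values. -/
theorem exists_binning [Nonempty 𝒰] {a b : ℕ} [NeZero a] [NeZero b] {p : 𝒳 → 𝒴 → ℝ}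
    (hp0 : ∀ x y, 0 ≤ p x y) (hp1 : ∑ x, ∑ y, p x y = 1) {κ : 𝒳 → 𝒰 → ℝ}
    (hκ : ∀ x, κ x ∈ stdSimplex ℝ 𝒰) {V : 𝒳 → 𝒴 → 𝒰 → ℝ}
    (hV : ∀ x y u, 0 ≤ V x y u ∧ V x y u ≤ 1) {γ η N : ℝ} (hγ : 0 ≤ γ) (hη : 0 < η)
    (h : γ * (a - 1) ≤ η ^ 2) (D : 𝒴 → Finset 𝒰) (hD : ∀ y, ((D y).card : ℝ) ≤ N) :
    ∃ (enc : 𝒳 → Fin b) (φ : 𝒳 → 𝒰) (dec : 𝒴 → Fin b → 𝒰),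
      ∑ x, ∑ y, p x y * (V x y (φ x) + if dec y (enc x) = φ x then 0 else 1) ≤
        ∑ x, ∑ y, ∑ u, p x y * κ x u * V x y u +
        2 * (η + 2 * ∑ x, ∑ y, ∑ u, p x y * κ x u * if κ x u ≤ γ then 0 else 1) +
        (∑ x, ∑ y, ∑ u, p x y * κ x u * (if u ∈ D y then 0 else 1) + N / (a * b)) := by
  let w := iid 𝒰 (unif (Fin a × Fin b))
  have hws : w ∈ stdSimplex ℝ (𝒰 → Fin a × Fin b) :=
    iid_mem_stdSimplex (unif_mem_stdSimplex (Fin a × Fin b))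
  have ha : (0 : ℝ) < a := by exact_mod_cast Nat.pos_of_ne_zero (NeZero.ne a)
  let px : 𝒳 → ℝ := fun x => ∑ y, p x y
  have hpx : ∀ x, 0 ≤ px x := fun x => sum_nonneg fun y _ => hp0 x y
  let err : (𝒰 → Fin a × Fin b) → 𝒴 → Fin a × Fin b → 𝒰 → ℝ := fun B y v u =>
    if listDecode (D y) B v = u then 0 else 1
  have herr : ∀ B y v u, 0 ≤ err B y v u ∧ err B y v u ≤ 1 := fun B y v u => by
    simp only [err]
    split_ifs <;> simp
  -- `C` is the cost if the decoder is told both indices of the bin of `u`; in `C'` the first index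
  -- is replaced by `f`, which agrees with it whenever `u` is chosen from the bin `f`
  let C : (𝒰 → Fin a × Fin b) → 𝒳 → 𝒰 → ℝ := fun B x u =>
    ∑ y, p x y * (V x y u + err B y (B u) u)
  let C' : (𝒰 → Fin a × Fin b) → Fin a → 𝒳 → 𝒰 → ℝ := fun B f x u =>
    ∑ y, p x y * (V x y u + err B y (f, (B u).2) u)
  have hch : ∀ B f x, ∃ u, (a : ℝ)⁻¹ * C' B f x u ≤
      (∑ u, if (B u).1 = f then κ x u * C B x u else 0) +
        2 * px x * |(a : ℝ)⁻¹ - ∑ u, if (B u).1 = f then κ x u else 0| := by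
    intro B f x
    refine exists_choice_in_bin (hκ x).1 (fun u => (B u).1 = f) (fun u hu => ?_)
      (fun u => ⟨?_, ?_⟩) (inv_nonneg.2 ha.le)
    · simp only [C, C', ← hu]
    · exact sum_nonneg fun y _ => mul_nonneg (hp0 x y) (add_nonneg (hV x y u).1 (herr _ _ _ _).1)
    · rw [mul_comm, sum_mul]
      exact sum_le_sum fun y _ => mul_le_mul_of_nonneg_left
        (by linarith [(hV x y u).2, (herr B y (f, (B u).2) u).2]) (hp0 x y)
  choose φ hφ using hch
  have hsumf : ∀ B, ∑ f : Fin a, (a : ℝ)⁻¹ * ∑ x, C' B f x (φ B f x) ≤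
      ∑ x, ∑ u, κ x u * C B x u +
        ∑ x, 2 * px x * ∑ f : Fin a, |(a : ℝ)⁻¹ - ∑ u, if (B u).1 = f then κ x u else 0| := by
    intro B
    have e1 : ∑ x, ∑ u, κ x u * C B x u =
        ∑ f : Fin a, ∑ x, ∑ u, if (B u).1 = f then κ x u * C B x u else 0 := by
      refine Eq.symm (sum_comm.trans (sum_congr rfl fun x _ => sum_comm.trans
        (sum_congr rfl fun u _ => ?_)))
      simp
    have e2 : ∑ x, 2 * px x * ∑ f : Fin a, |(a : ℝ)⁻¹ - ∑ u, if (B u).1 = f then κ x u else 0| =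
        ∑ f : Fin a, ∑ x, 2 * px x * |(a : ℝ)⁻¹ - ∑ u, if (B u).1 = f then κ x u else 0| := by
      rw [sum_comm]
      exact sum_congr rfl fun x _ => mul_sum _ _ _
    rw [e1, e2, ← sum_add_distrib]
    refine sum_le_sum fun f _ => ?_
    rw [mul_sum, ← sum_add_distrib]
    exact sum_le_sum fun x _ => hφ B f x
  -- the average of the costs over the random binning
  have havg : ∑ B, w B * ∑ f : Fin a, (a : ℝ)⁻¹ * ∑ x, C' B f x (φ B f x) ≤
      ∑ x, ∑ y, ∑ u, p x y * κ x u * V x y u +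
        2 * (η + 2 * ∑ x, ∑ y, ∑ u, p x y * κ x u * if κ x u ≤ γ then 0 else 1) +
        (∑ x, ∑ y, ∑ u, p x y * κ x u * (if u ∈ D y then 0 else 1) + N / (a * b)) := by
    have h1 : ∑ B, w B * ∑ x, ∑ u, κ x u * C B x u ≤ ∑ x, ∑ y, ∑ u, p x y * κ x u * V x y u +
        (∑ x, ∑ y, ∑ u, p x y * κ x u * (if u ∈ D y then 0 else 1) + N / (a * b)) := by
      have e2 : ∑ B, w B * ∑ x, ∑ u, κ x u * C B x u =
          ∑ x, ∑ y, ∑ u, p x y * κ x u * (V x y u + ∑ B, w B * err B y (B u) u) := by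
        have e3 : ∀ x y u, p x y * κ x u * (V x y u + ∑ B, w B * err B y (B u) u) =
            ∑ B, w B * (κ x u * (p x y * (V x y u + err B y (B u) u))) := by
          intro x y u
          have : V x y u = ∑ B, w B * V x y u := by rw [← sum_mul, hws.2, one_mul]
          nth_rw 1 [this]
          rw [← sum_add_distrib, mul_sum]
          exact sum_congr rfl fun B _ => by ring
        simp_rw [e3, C, mul_sum]
        exact sum_comm.trans (sum_congr rfl fun x _ => sum_comm.trans
          ((sum_congr rfl fun u _ => sum_comm).trans sum_comm))
      have hpκ : ∑ x, ∑ y, ∑ u, p x y * κ x u * (N / (a * b)) = N / (a * b) := by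
        simp_rw [← sum_mul, ← mul_sum, (hκ _).2, mul_one, hp1, one_mul]
      rw [e2]
      rw [← hpκ]
      simp_rw [← sum_add_distrib]
      refine sum_le_sum fun x _ => sum_le_sum fun y _ => sum_le_sum fun u _ => ?_
      rw [← mul_add, ← mul_add]
      refine mul_le_mul_of_nonneg_left (add_le_add le_rfl ?_) (mul_nonneg (hp0 x y) ((hκ x).1 u))
      refine (sum_listDecode_error_le (D y) u).trans ?_
      simp only [Fintype.card_prod, Fintype.card_fin, Nat.cast_mul]
      gcongr
      exact hD y
    have h2 : ∑ B, w B * ∑ x, 2 * px x * ∑ f : Fin a,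
        |(a : ℝ)⁻¹ - ∑ u, if (B u).1 = f then κ x u else 0| ≤
        2 * (η + 2 * ∑ x, ∑ y, ∑ u, p x y * κ x u * if κ x u ≤ γ then 0 else 1) := by
      have e4 : ∑ B, w B * ∑ x, 2 * px x * ∑ f : Fin a,
          |(a : ℝ)⁻¹ - ∑ u, if (B u).1 = f then κ x u else 0| =
          ∑ x, 2 * px x * ∑ B, w B * ∑ f : Fin a,
            |(a : ℝ)⁻¹ - ∑ u, if (B u).1 = f then κ x u else 0| := by
        simp_rw [mul_sum (univ : Finset 𝒳), mul_sum (univ : Finset (𝒰 → Fin a × Fin b))]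
        rw [sum_comm]
        exact sum_congr rfl fun x _ => sum_congr rfl fun B _ => by ring
      have e5 : 2 * (η + 2 * ∑ x, ∑ y, ∑ u, p x y * κ x u * if κ x u ≤ γ then 0 else 1) =
          ∑ x, 2 * px x * (η + 2 * ∑ u, if κ x u ≤ γ then 0 else κ x u) := by
        have e6 : ∀ x, ∑ y, ∑ u, p x y * κ x u * (if κ x u ≤ γ then 0 else 1) =
            px x * ∑ u, if κ x u ≤ γ then 0 else κ x u := by
          intro x
          simp only [px]
          rw [sum_mul]
          refine sum_congr rfl fun y _ => ?_
          rw [mul_sum]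
          refine sum_congr rfl fun u _ => ?_
          split_ifs <;> ring
        have e7 : ∑ x, px x * η = η := by rw [← sum_mul, hp1, one_mul]
        simp_rw [e6]
        nth_rw 1 [← e7]
        rw [mul_sum (univ : Finset 𝒳), ← sum_add_distrib, mul_sum]
        exact sum_congr rfl fun x _ => by ring
      rw [e4, e5]
      exact sum_le_sum fun x _ => mul_le_mul_of_nonneg_left (sum_abs_bin_sub_le (hκ x) hγ hη h)
        (mul_nonneg zero_le_two (hpx x))
    have h3 : ∑ B, w B * ∑ f : Fin a, (a : ℝ)⁻¹ * ∑ x, C' B f x (φ B f x) ≤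
        ∑ B, w B * ∑ x, ∑ u, κ x u * C B x u + ∑ B, w B * ∑ x, 2 * px x * ∑ f : Fin a,
          |(a : ℝ)⁻¹ - ∑ u, if (B u).1 = f then κ x u else 0| := by
      rw [← sum_add_distrib]
      refine sum_le_sum fun B _ => ?_
      rw [← mul_add]
      exact mul_le_mul_of_nonneg_left (hsumf B) (hws.1 B)
    linarith
  obtain ⟨B, hB⟩ := exists_le_of_sum_mul_le hws havg
  obtain ⟨f, hf⟩ := exists_le_of_sum_mul_le (w := fun _ : Fin a => (a : ℝ)⁻¹)
    ⟨fun _ => by positivity, by simp [ha.ne']⟩ hB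
  exact ⟨fun x => (B (φ B f x)).2, φ B f, fun y m => listDecode (D y) B (f, m), hf⟩

end OneShot

/-! ### One round of communication on long blocks -/

section Block

variable {Ω 𝒳 𝒴 𝒰 : Type*} [Fintype Ω] [Fintype 𝒰] {q : Ω → ℝ}

/-- Chebyshev's inequality for sums of independent variables. -/
theorem sum_iid_mul_indicator_le (hq : q ∈ stdSimplex ℝ Ω) (Z : Ω → ℝ) {n : ℕ} (hn : n ≠ 0) {δ : ℝ}
    (hδ : 0 < δ) (P : (Fin n → Ω) → Prop) [DecidablePred P]
    (hP : ∀ ω, iid (Fin n) q ω ≠ 0 → P ω → n * δ ≤ |∑ i, Z (ω i) - n * ∑ ω, q ω * Z ω|) :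
    ∑ ω, iid (Fin n) q ω * (if P ω then 1 else 0) ≤
      (∑ ω, q ω * (Z ω - ∑ ω, q ω * Z ω) ^ 2) / δ ^ 2 * (n : ℝ)⁻¹ := by
  set μ := ∑ ω, q ω * Z ω with hμ
  have hn' : (0 : ℝ) < n := by exact_mod_cast Nat.pos_of_ne_zero hn
  have h0 : ∑ ω, q ω * (Z ω - μ) = 0 := by
    simp_rw [mul_sub, sum_sub_distrib, ← sum_mul, hq.2, one_mul, ← hμ, sub_self]
  have h1 := sum_iid_mul_sq (ι := Fin n) hq (fun _ => 1) (fun ω => Z ω - μ) h0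
  simp only [one_mul, one_pow, sum_const, card_univ, Fintype.card_fin, nsmul_eq_mul,
    mul_one, sum_sub_distrib] at h1
  have hw := (iid_mem_stdSimplex (ι := Fin n) hq).1
  have hpos : 0 < (n * δ) ^ 2 := by positivity
  calc ∑ ω, iid (Fin n) q ω * (if P ω then 1 else 0)
      ≤ ∑ ω, iid (Fin n) q ω * (∑ i, Z (ω i) - n * μ) ^ 2 / (n * δ) ^ 2 := by
        refine sum_le_sum fun ω _ => ?_
        by_cases hω : iid (Fin n) q ω = 0
        · simp [hω]
        · rw [mul_div_assoc]
          refine mul_le_mul_of_nonneg_left ?_ (hw ω)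
          split_ifs with h
          · rw [le_div_iff₀ hpos, one_mul, ← sq_abs (_ - _)]
            exact pow_le_pow_left₀ (by positivity) (hP ω hω h) 2
          · positivity
    _ = n * (∑ ω, q ω * (Z ω - μ) ^ 2) / (n * δ) ^ 2 := by rw [← sum_div, h1]
    _ = _ := by field_simp

/-- The conditional law of `h` given `f`, with an arbitrary choice where `f` has probability
zero. -/
def condLaw (q : Ω → ℝ) (f : Ω → 𝒳) (h : Ω → 𝒰) (x : 𝒳) (u : 𝒰) : ℝ :=
  if law q f x = 0 then unif 𝒰 u else law q (fun ω => (f ω, h ω)) (x, u) / law q f x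

theorem condLaw_mem_stdSimplex [Nonempty 𝒰] (hq : ∀ ω, 0 ≤ q ω) (f : Ω → 𝒳) (h : Ω → 𝒰) (x : 𝒳) :
    condLaw q f h x ∈ stdSimplex ℝ 𝒰 := by
  by_cases hx : law q f x = 0
  · have : condLaw q f h x = unif 𝒰 := funext fun u => by rw [condLaw, if_pos hx]
    rw [this]
    exact unif_mem_stdSimplex 𝒰
  · refine ⟨fun u => ?_, ?_⟩
    · rw [condLaw, if_neg hx]
      exact div_nonneg (law_nonneg hq _ _) (law_nonneg hq _ _)
    · simp_rw [condLaw, if_neg hx]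
      rw [← sum_div, ← law_fst_eq_sum, div_self hx]

theorem condLaw_pos [Nonempty 𝒰] (hq : ∀ ω, 0 ≤ q ω) (f : Ω → 𝒳) (h : Ω → 𝒰) {ω : Ω}
    (hω : q ω ≠ 0) : 0 < condLaw q f h (f ω) (h ω) := by
  rw [condLaw, if_neg (law_pos hq f hω).ne']
  exact div_pos (law_pos hq (fun ω => (f ω, h ω)) hω) (law_pos hq f hω)

theorem sum_mul_neg_logb_condLaw (hq : ∀ ω, 0 ≤ q ω) (f : Ω → 𝒳) (h : Ω → 𝒰) :
    ∑ ω, q ω * -Real.logb 2 (condLaw q f h (f ω) (h ω)) =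
      ent q (fun ω => (f ω, h ω)) - ent q f := by
  unfold ent
  rw [neg_sub_neg, ← sum_sub_distrib]
  refine sum_congr rfl fun ω _ => ?_
  by_cases hω : q ω = 0
  · simp [hω]
  · have h1 := (law_pos hq f hω).ne'
    rw [condLaw, if_neg h1, Real.logb_div (law_pos hq (fun ω => (f ω, h ω)) hω).ne' h1]
    ring

theorem logb_prod_condLaw [Nonempty 𝒰] (hq : ∀ ω, 0 ≤ q ω) (f : Ω → 𝒳) (h : Ω → 𝒰) {n : ℕ}
    {ω : Fin n → Ω} (hω : iid (Fin n) q ω ≠ 0) :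
    0 < ∏ i, condLaw q f h (f (ω i)) (h (ω i)) ∧
      Real.logb 2 (∏ i, condLaw q f h (f (ω i)) (h (ω i))) =
        -∑ i, -Real.logb 2 (condLaw q f h (f (ω i)) (h (ω i))) := by
  have h1 : ∀ i, 0 < condLaw q f h (f (ω i)) (h (ω i)) := fun i =>
    condLaw_pos hq f h (prod_ne_zero_iff.1 hω i (mem_univ i))
  refine ⟨prod_pos fun i _ => h1 i, ?_⟩
  rw [Real.logb, Real.log_prod (fun i _ => (h1 i).ne'), sum_div, sum_neg_distrib, neg_neg]
  rfl

theorem sum_prod_kernel {n : ℕ} (τ : Fin n → 𝒰 → ℝ) :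
    ∑ u : Fin n → 𝒰, ∏ i, τ i (u i) = ∏ i, ∑ u, τ i u := by
  rw [prod_univ_sum, Fintype.piFinset_univ]

theorem law_triple_eq (hq : ∀ ω, 0 ≤ q ω) {f : Ω → 𝒳} {g : Ω → 𝒴} {h : Ω → 𝒰}
    (hM : IsMarkovChain q g f h) (x : 𝒳) (y : 𝒴) (u : 𝒰) :
    law q (fun ω => (f ω, g ω, h ω)) (x, y, u) =
      law q (fun ω => (f ω, g ω)) (x, y) * condLaw q f h x u := by
  have e1 : law q (fun ω => (f ω, g ω, h ω)) (x, y, u) =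
      law q (fun ω => (g ω, f ω, h ω)) (y, x, u) := law_congr fun ω _ => by simp; tauto
  have e2 : law q (fun ω => (f ω, g ω)) (x, y) = law q (fun ω => (g ω, f ω)) (y, x) :=
    law_congr fun ω _ => by simp; tauto
  by_cases hx : law q f x = 0
  · have h1 : law q (fun ω => (f ω, g ω, h ω)) (x, y, u) = 0 :=
      le_antisymm (hx ▸ law_mono hq (fun ω hω => (Prod.mk.inj hω).1)) (law_nonneg hq _ _)
    have h2 : law q (fun ω => (f ω, g ω)) (x, y) = 0 :=
      le_antisymm (hx ▸ law_mono hq (fun ω hω => (Prod.mk.inj hω).1)) (law_nonneg hq _ _)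
    rw [h1, h2, zero_mul]
  · rw [condLaw, if_neg hx, e1, e2, ← mul_div_assoc, eq_div_iff hx, hM]

theorem prod_condLaw_mem_stdSimplex [Nonempty 𝒰] (hq : ∀ ω, 0 ≤ q ω) (f : Ω → 𝒳) (h : Ω → 𝒰) {n : ℕ}
    (x : Fin n → 𝒳) :
    (fun u : Fin n → 𝒰 => ∏ i, condLaw q f h (x i) (u i)) ∈ stdSimplex ℝ (Fin n → 𝒰) :=
  ⟨fun u => prod_nonneg fun i _ => (condLaw_mem_stdSimplex hq f h _).1 _, by
    rw [sum_prod_kernel (fun i => condLaw q f h (x i))]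
    exact prod_eq_one fun i _ => (condLaw_mem_stdSimplex hq f h _).2⟩

variable [Fintype 𝒳] [Fintype 𝒴]

theorem sum_block_triple (hq : ∀ ω, 0 ≤ q ω) {f : Ω → 𝒳} {g : Ω → 𝒴} {h : Ω → 𝒰}
    (hM : IsMarkovChain q g f h) {n : ℕ}
    (F : (Fin n → 𝒳) → (Fin n → 𝒴) → (Fin n → 𝒰) → ℝ) :
    ∑ x, ∑ y, ∑ u, (∏ i, law q (fun ω => (f ω, g ω)) (x i, y i)) *
      (∏ i, condLaw q f h (x i) (u i)) * F x y u =
      ∑ ω, iid (Fin n) q ω * F (fun i => f (ω i)) (fun i => g (ω i)) (fun i => h (ω i)) := by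
  rw [← sum_law_mul (iid (Fin n) q)
    (fun ω => ((fun i => f (ω i)), (fun i => g (ω i)), fun i => h (ω i)))
    (fun z => F z.1 z.2.1 z.2.2), Fintype.sum_prod_type]
  refine sum_congr rfl fun x _ => ?_
  rw [Fintype.sum_prod_type]
  refine sum_congr rfl fun y _ => sum_congr rfl fun u _ => ?_
  congr 1
  rw [law_congr (f' := fun ω i => (f (ω i), g (ω i), h (ω i))) (a' := fun i => (x i, y i, u i)),
    law_iid q (fun ω => (f ω, g ω, h ω)), iid, ← prod_mul_distrib]
  · exact prod_congr rfl fun i _ => (law_triple_eq hq hM _ _ _).symm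
  · intro ω _
    simp only [Prod.mk.injEq, funext_iff, forall_and]

theorem sum_block_pair {f : Ω → 𝒳} {g : Ω → 𝒴} {n : ℕ} (F : (Fin n → 𝒳) → (Fin n → 𝒴) → ℝ) :
    ∑ x, ∑ y, (∏ i, law q (fun ω => (f ω, g ω)) (x i, y i)) * F x y =
      ∑ ω, iid (Fin n) q ω * F (fun i => f (ω i)) (fun i => g (ω i)) := by
  rw [← sum_law_mul (iid (Fin n) q) (fun ω => ((fun i => f (ω i)), fun i => g (ω i)))
    (fun z => F z.1 z.2), Fintype.sum_prod_type]
  refine sum_congr rfl fun x _ => sum_congr rfl fun y _ => ?_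
  congr 1
  rw [law_congr (f' := fun ω i => (f (ω i), g (ω i))) (a' := fun i => (x i, y i)),
    law_iid q (fun ω => (f ω, g ω)), iid]
  intro ω _
  simp only [Prod.mk.injEq, funext_iff, forall_and]

/-- Binning on blocks, with the sums over all sequences written as expectations. -/
theorem exists_block_binning [Nonempty 𝒰] (hq : q ∈ stdSimplex ℝ Ω) {f : Ω → 𝒳} {g : Ω → 𝒴}
    {h : Ω → 𝒰} (hM : IsMarkovChain q g f h) {n a b : ℕ} [NeZero a] [NeZero b] {γ η N : ℝ}
    (hγ : 0 ≤ γ) (hη : 0 < η) (haγ : γ * (a - 1) ≤ η ^ 2) (D : (Fin n → 𝒴) → Finset (Fin n → 𝒰))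
    (hD : ∀ y, ((D y).card : ℝ) ≤ N) {V : (Fin n → 𝒳) → (Fin n → 𝒴) → (Fin n → 𝒰) → ℝ}
    (hV : ∀ x y u, 0 ≤ V x y u ∧ V x y u ≤ 1) :
    ∃ (enc : (Fin n → 𝒳) → Fin b) (φ : (Fin n → 𝒳) → Fin n → 𝒰)
      (dec : (Fin n → 𝒴) → Fin b → Fin n → 𝒰),
      ∑ ω, iid (Fin n) q ω * (V (fun i => f (ω i)) (fun i => g (ω i)) (φ fun i => f (ω i)) +
        if dec (fun i => g (ω i)) (enc fun i => f (ω i)) = φ (fun i => f (ω i)) then 0 else 1) ≤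
      ∑ ω, iid (Fin n) q ω * V (fun i => f (ω i)) (fun i => g (ω i)) (fun i => h (ω i)) +
      2 * (η + 2 * ∑ ω, iid (Fin n) q ω *
        if ∏ i, condLaw q f h (f (ω i)) (h (ω i)) ≤ γ then 0 else 1) +
      (∑ ω, iid (Fin n) q ω * (if (fun i => h (ω i)) ∈ D (fun i => g (ω i)) then 0 else 1) +
        N / (a * b)) := by
  have hp1 : ∑ x : Fin n → 𝒳, ∑ y : Fin n → 𝒴,
      ∏ i, law q (fun ω => (f ω, g ω)) (x i, y i) = 1 := by
    have := sum_block_pair (q := q) (f := f) (g := g) (n := n) (fun _ _ => 1)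
    simp only [mul_one] at this
    rw [this, (iid_mem_stdSimplex hq).2]
  obtain ⟨enc, φ, dec, hmain⟩ := exists_binning (𝒳 := Fin n → 𝒳) (𝒴 := Fin n → 𝒴)
    (𝒰 := Fin n → 𝒰) (a := a) (b := b)
    (p := fun x y => ∏ i, law q (fun ω => (f ω, g ω)) (x i, y i))
    (fun x y => prod_nonneg fun i _ => law_nonneg hq.1 _ _) hp1
    (κ := fun x u => ∏ i, condLaw q f h (x i) (u i))
    (prod_condLaw_mem_stdSimplex hq.1 f h) hV hγ hη haγ D hD
  refine ⟨enc, φ, dec, ?_⟩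
  have e1 := sum_block_pair (q := q) (f := f) (g := g)
    (fun x y => V x y (φ x) + if dec y (enc x) = φ x then 0 else 1)
  have e2 := sum_block_triple hq.1 hM V
  have e3 := sum_block_triple hq.1 hM (n := n)
    (fun x _ u => if ∏ i, condLaw q f h (x i) (u i) ≤ γ then 0 else 1)
  have e4 := sum_block_triple hq.1 hM (n := n) (fun _ y u => if u ∈ D y then 0 else 1)
  rw [← e1, ← e2, ← e3, ← e4]
  convert hmain

theorem card_filter_le_mul_le_one {κ : 𝒰 → ℝ} (hκ : κ ∈ stdSimplex ℝ 𝒰) (γ : ℝ) :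
    ((univ.filter fun u => γ ≤ κ u).card : ℝ) * γ ≤ 1 := by
  rw [← nsmul_eq_mul, ← sum_const, ← hκ.2]
  exact (sum_le_sum fun u hu => (mem_filter.1 hu).2).trans
    (sum_le_sum_of_subset_of_nonneg (subset_univ _) fun u _ _ => hκ.1 u)

/-- One round on a long block: if `h` depends on `g` only through `f`, then
`n (H(h | g) - H(h | f) + δ)` bits suffice to let the terminal that observes `g` know a sequence
chosen by the terminal that observes `f`, such that costs `V` are essentially the same as for the
i.i.d. sequence `h`. -/
theorem eventually_exists_round (hq : q ∈ stdSimplex ℝ Ω) {f : Ω → 𝒳} {g : Ω → 𝒴} {h : Ω → 𝒰}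
    (hM : IsMarkovChain q g f h) {δ ε : ℝ} (hδ : 0 < δ) (hε : 0 < ε) :
    ∀ᶠ n : ℕ in atTop, ∃ b : ℕ, 0 < b ∧
      Real.logb 2 b ≤ n * (ent q (fun ω => (g ω, h ω)) - ent q g -
        (ent q (fun ω => (f ω, h ω)) - ent q f) + δ) ∧
      ∀ V : (Fin n → 𝒳) → (Fin n → 𝒴) → (Fin n → 𝒰) → ℝ, (∀ x y u, 0 ≤ V x y u ∧ V x y u ≤ 1) →
        ∃ (enc : (Fin n → 𝒳) → Fin b) (φ : (Fin n → 𝒳) → Fin n → 𝒰)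
          (dec : (Fin n → 𝒴) → Fin b → Fin n → 𝒰),
          ∑ ω, iid (Fin n) q ω * (V (fun i => f (ω i)) (fun i => g (ω i)) (φ fun i => f (ω i)) +
            if dec (fun i => g (ω i)) (enc fun i => f (ω i)) = φ (fun i => f (ω i)) then 0 else 1) ≤
          ∑ ω, iid (Fin n) q ω * V (fun i => f (ω i)) (fun i => g (ω i)) (fun i => h (ω i)) +
            ε := by
  obtain ⟨ω₀⟩ : Nonempty Ω := by
    by_contra hc
    rw [not_nonempty_iff] at hc
    simpa using hq.2
  have hU : Nonempty 𝒰 := ⟨h ω₀⟩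
  set H := ent q (fun ω => (f ω, h ω)) - ent q f with hH
  set HY := ent q (fun ω => (g ω, h ω)) - ent q g with hHY
  have hHle : H ≤ HY := by
    have h1 := hM.ent_eq hq.1
    have h2 := ent_submodular hq h g f
    have e1 : ent q (fun ω => (h ω, g ω, f ω)) = ent q (fun ω => (g ω, f ω, h ω)) :=
      ent_congr fun _ _ _ _ => by simp; tauto
    have e2 : ent q (fun ω => (h ω, g ω)) = ent q (fun ω => (g ω, h ω)) :=
      ent_congr fun _ _ _ _ => by simp; tauto
    linarith
  set δ' := δ / 5 with hδ'
  have hδ'0 : 0 < δ' := by positivity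
  let Z₁ : Ω → ℝ := fun ω => -Real.logb 2 (condLaw q f h (f ω) (h ω))
  let Z₂ : Ω → ℝ := fun ω => -Real.logb 2 (condLaw q g h (g ω) (h ω))
  have hZ₁ : ∑ ω, q ω * Z₁ ω = H := sum_mul_neg_logb_condLaw hq.1 f h
  have hZ₂ : ∑ ω, q ω * Z₂ ω = HY := sum_mul_neg_logb_condLaw hq.1 g h
  set v₁ := (∑ ω, q ω * (Z₁ ω - ∑ ω, q ω * Z₁ ω) ^ 2) / δ' ^ 2 with hv₁
  set v₂ := (∑ ω, q ω * (Z₂ ω - ∑ ω, q ω * Z₂ ω) ^ 2) / δ' ^ 2 with hv₂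
  have hlim : Tendsto (fun n : ℕ => 2 * ((2 : ℝ) ^ (-(n * (δ' / 2))) + 2 * (v₁ * (n : ℝ)⁻¹)) +
      (v₂ * (n : ℝ)⁻¹ + (2 : ℝ) ^ (-(n * δ')))) atTop (nhds 0) := by
    have h1 : Tendsto (fun n : ℕ => (n : ℝ)⁻¹) atTop (nhds 0) := tendsto_inv_atTop_nhds_zero_nat
    have h2 : ∀ c : ℝ, 0 < c → Tendsto (fun n : ℕ => (2 : ℝ) ^ (-(n * c))) atTop (nhds 0) := by
      intro c hc
      refine (tendsto_rpow_atBot_of_base_gt_one 2 one_lt_two).comp ?_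
      exact tendsto_neg_atTop_atBot.comp (tendsto_natCast_atTop_atTop.atTop_mul_const hc)
    have := ((((h2 (δ' / 2) (by positivity)).add ((h1.const_mul v₁).const_mul 2)).const_mul 2).add
      ((h1.const_mul v₂).add (h2 δ' hδ'0)))
    simpa using this
  have hlarge : ∀ᶠ n : ℕ in atTop, 1 ≤ n * δ' :=
    (tendsto_natCast_atTop_atTop.atTop_mul_const hδ'0).eventually_ge_atTop 1
  filter_upwards [hlim.eventually_le_const hε, hlarge] with n hεn hn1
  have hn : n ≠ 0 := by
    rintro rfl
    norm_num at hn1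
  have hceil : ∀ x : ℝ, ∃ a : ℕ, 0 < a ∧ (a : ℝ) ≤ (2 : ℝ) ^ x + 1 ∧ (2 : ℝ) ^ x ≤ a := fun x =>
    ⟨⌈(2 : ℝ) ^ x⌉₊, Nat.ceil_pos.2 (by positivity), (Nat.ceil_lt_add_one (by positivity)).le,
      Nat.le_ceil _⟩
  -- `a` is slightly below `2 ^ (n H(h | f))`, so that the first bin index is almost uniform, and
  -- `a b` is slightly above `2 ^ (n H(h | g))`, so that typical sequences rarely share a bin
  obtain ⟨a, ha0, ha1, ha2⟩ := hceil (n * (H - 2 * δ'))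
  obtain ⟨b, hb0, hb1, hb2⟩ := hceil (n * (HY - H + 4 * δ'))
  have : NeZero a := ⟨ha0.ne'⟩
  have : NeZero b := ⟨hb0.ne'⟩
  refine ⟨b, hb0, ?_, fun V hV => ?_⟩
  · have h1 : (b : ℝ) ≤ (2 : ℝ) ^ (n * (HY - H + 4 * δ') + 1) := by
      have h3 : (1 : ℝ) ≤ (2 : ℝ) ^ (n * (HY - H + 4 * δ')) :=
        Real.one_le_rpow one_le_two (mul_nonneg (by positivity) (by linarith))
      rw [Real.rpow_add two_pos, Real.rpow_one]
      linarith
    rw [Real.logb_le_iff_le_rpow one_lt_two (by exact_mod_cast hb0)]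
    refine h1.trans (Real.rpow_le_rpow_of_exponent_le one_le_two ?_)
    have : δ = 5 * δ' := by rw [hδ']; ring
    rw [this]
    linarith
  · let γ : ℝ := (2 : ℝ) ^ (-(n * (H - δ')))
    let γ' : ℝ := (2 : ℝ) ^ (-(n * (HY + δ')))
    let D : (Fin n → 𝒴) → Finset (Fin n → 𝒰) := fun y =>
      univ.filter fun u => γ' ≤ ∏ i, condLaw q g h (y i) (u i)
    have hD : ∀ y, ((D y).card : ℝ) ≤ (2 : ℝ) ^ (n * (HY + δ')) := by
      intro y
      have h1 := card_filter_le_mul_le_one (prod_condLaw_mem_stdSimplex hq.1 g h y) γ'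
      have h2 : γ' * (2 : ℝ) ^ (n * (HY + δ')) = 1 := by
        simp only [γ']
        rw [← Real.rpow_add two_pos, neg_add_cancel, Real.rpow_zero]
      have h3 : 0 < γ' := by positivity
      exact le_of_mul_le_mul_right (h1.trans (by rw [mul_comm, h2])) h3
    have haγ : γ * (a - 1) ≤ ((2 : ℝ) ^ (-(n * (δ' / 2)))) ^ 2 := by
      calc γ * (a - 1) ≤ γ * (2 : ℝ) ^ (n * (H - 2 * δ')) :=
            mul_le_mul_of_nonneg_left (by linarith) (by positivity)
        _ = _ := by
            simp only [γ]
            rw [← Real.rpow_add two_pos, ← Real.rpow_natCast, ← Real.rpow_mul zero_le_two]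
            congr 1
            push_cast
            ring
    have hNab : (2 : ℝ) ^ (n * (HY + δ')) / (a * b) ≤ (2 : ℝ) ^ (-(n * δ')) := by
      rw [div_le_iff₀ (by positivity)]
      calc (2 : ℝ) ^ (n * (HY + δ')) = (2 : ℝ) ^ (-(n * δ')) *
            ((2 : ℝ) ^ (n * (H - 2 * δ')) * (2 : ℝ) ^ (n * (HY - H + 4 * δ'))) := by
            rw [← Real.rpow_add two_pos, ← Real.rpow_add two_pos]
            congr 1
            ring
        _ ≤ _ := by
            gcongr
    obtain ⟨enc, φ, dec, hmain⟩ := exists_block_binning (a := a) (b := b) hq hM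
      (by positivity : 0 ≤ γ) (by positivity) haγ D hD hV
    refine ⟨enc, φ, dec, hmain.trans ?_⟩
    have hP1 := sum_iid_mul_indicator_le hq Z₁ hn hδ'0
      (fun ω => ¬ ∏ i, condLaw q f h (f (ω i)) (h (ω i)) ≤ γ) (fun ω hω hc => by
        obtain ⟨hpos, hlog⟩ := logb_prod_condLaw hq.1 f h hω
        have h1 := (Real.lt_logb_iff_rpow_lt one_lt_two hpos).2 (not_le.1 hc)
        rw [hlog] at h1
        rw [hZ₁, abs_sub_comm]
        refine le_trans ?_ (le_abs_self _)
        simp only [Z₁]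
        linarith)
    have hP2 := sum_iid_mul_indicator_le hq Z₂ hn hδ'0
      (fun ω => ¬ (fun i => h (ω i)) ∈ D fun i => g (ω i)) (fun ω hω hc => by
        obtain ⟨hpos, hlog⟩ := logb_prod_condLaw hq.1 g h hω
        simp only [D, mem_filter, mem_univ, true_and, not_le] at hc
        have h1 := (Real.logb_lt_iff_lt_rpow one_lt_two hpos).2 hc
        rw [hlog] at h1
        rw [hZ₂]
        refine le_trans ?_ (le_abs_self _)
        simp only [Z₂]
        linarith)
    simp only [ite_not] at hP1 hP2
    linarith

end Block

/-! ### Chaining the rounds into an interactive code -/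

section Scheme

variable {K : ℕ} {S₁ S₂ : Type*} {T : Fin K → Type*} {b : Fin K → ℕ}

/-- The observation of the terminal that acts in round `l`. -/
def activeObs (l : Fin K) (x : S₁ × S₂) : S₁ ⊕ S₂ :=
  if Even (l : ℕ) then Sum.inl x.1 else Sum.inr x.2

/-- The observation of the terminal that listens in round `l`. -/
def passiveObs (l : Fin K) (x : S₁ × S₂) : S₁ ⊕ S₂ :=
  if Even (l : ℕ) then Sum.inr x.2 else Sum.inl x.1

/-- What the terminals do in round `l`, given the auxiliary values of the earlier rounds and their
own observation: the acting terminal picks the new value `pick` and sends `enc`; the listening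
terminal recovers a value by `dec`. -/
structure RoundMap (S₁ S₂ : Type*) (T : Fin K → Type*) (b : Fin K → ℕ) (l : Fin K) where
  /-- the message sent -/
  enc : ((j : {j : Fin K // j < l}) → T j) → S₁ ⊕ S₂ → Fin (b l)
  /-- the value chosen by the acting terminal -/
  pick : ((j : {j : Fin K // j < l}) → T j) → S₁ ⊕ S₂ → T l
  /-- the value recovered by the listening terminal -/
  dec : ((j : {j : Fin K // j < l}) → T j) → S₁ ⊕ S₂ → Fin (b l) → T l

/-- In round `j` the value `u j` is the one chosen by the acting terminal, and the listening
terminal recovers it. -/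
def RoundSucceeds (σ : (l : Fin K) → RoundMap S₁ S₂ T b l) (x : S₁ × S₂) (u : (l : Fin K) → T l)
    (j : Fin K) : Prop :=
  u j = (σ j).pick (past j u) (activeObs j x) ∧
    (σ j).dec (past j u) (passiveObs j x) ((σ j).enc (past j u) (activeObs j x)) = u j

/-- Continuing from the values of `u` before round `k`, all rounds succeed and the outcome is not
in `bad`. -/
def SucceedsFrom (σ : (l : Fin K) → RoundMap S₁ S₂ T b l)
    (bad : S₁ × S₂ → ((l : Fin K) → T l) → Prop) (k : ℕ) (x : S₁ × S₂)
    (u : (l : Fin K) → T l) : Prop :=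
  ∃ u' : (l : Fin K) → T l, (∀ j : Fin K, (j : ℕ) < k → u' j = u j) ∧
    (∀ j : Fin K, k ≤ (j : ℕ) → RoundSucceeds σ x u' j) ∧ ¬ bad x u'

variable {Ω : Type*} [Fintype Ω] {Q : Ω → ℝ}

/-- Each round costs at most `ε` in the probability that the rest of the protocol fails. The rounds
are chosen from the last one backwards: the cost function of a round is the failure of the later
rounds, which are already fixed. -/
theorem exists_rounds [∀ l, Nonempty (T l)] (hQ : ∀ ω, 0 ≤ Q ω) (hb : ∀ l, 0 < b l)
    (x : Ω → S₁ × S₂) (u : Ω → (l : Fin K) → T l) {ε : ℝ}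
    (hround : ∀ (l : Fin K) (V : ((j : {j : Fin K // j < l}) → T j) → S₁ × S₂ → T l → ℝ),
      (∀ v x t, 0 ≤ V v x t ∧ V v x t ≤ 1) → ∃ ρ : RoundMap S₁ S₂ T b l,
        ∑ ω, Q ω * (V (past l (u ω)) (x ω) (ρ.pick (past l (u ω)) (activeObs l (x ω))) +
          if ρ.dec (past l (u ω)) (passiveObs l (x ω))
            (ρ.enc (past l (u ω)) (activeObs l (x ω))) =
            ρ.pick (past l (u ω)) (activeObs l (x ω)) then 0 else 1) ≤
        ∑ ω, Q ω * V (past l (u ω)) (x ω) (u ω l) + ε)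
    (bad : S₁ × S₂ → ((l : Fin K) → T l) → Prop) :
    ∃ σ : (l : Fin K) → RoundMap S₁ S₂ T b l,
      ∑ ω, Q ω * (if SucceedsFrom σ bad 0 (x ω) (u ω) then 0 else 1) ≤
        ∑ ω, Q ω * (if bad (x ω) (u ω) then 1 else 0) + K * ε := by
  suffices H : ∀ d k : ℕ, k + d = K → ∃ σ : (l : Fin K) → RoundMap S₁ S₂ T b l,
      ∑ ω, Q ω * (if SucceedsFrom σ bad k (x ω) (u ω) then 0 else 1) ≤
        ∑ ω, Q ω * (if bad (x ω) (u ω) then 1 else 0) + d * ε from H K 0 (zero_add K)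
  intro d
  induction d with
  | zero =>
    intro k hk
    refine ⟨fun l => ⟨fun _ _ => ⟨0, hb l⟩, fun _ _ => Classical.arbitrary _,
      fun _ _ _ => Classical.arbitrary _⟩, ?_⟩
    rw [Nat.cast_zero, zero_mul, add_zero]
    refine sum_le_sum fun ω _ => mul_le_mul_of_nonneg_left ?_ (hQ ω)
    by_cases hω : bad (x ω) (u ω)
    · rw [if_pos hω]
      split_ifs <;> simp
    · rw [if_pos, if_neg hω]
      exact ⟨u ω, fun _ _ => rfl, fun j hj => by omega, hω⟩
  | succ d ih =>
    intro k hk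
    obtain ⟨σ, hσ⟩ := ih (k + 1) (by omega)
    let l : Fin K := ⟨k, by omega⟩
    -- `SucceedsFrom` after round `l`, as a function of the values up to round `l`
    let G : ((j : {j : Fin K // j < l}) → T j) → S₁ × S₂ → T l → Prop := fun v y t =>
      ∃ u' : (l : Fin K) → T l, past l u' = v ∧ u' l = t ∧
        (∀ j : Fin K, l < j → RoundSucceeds σ y u' j) ∧ ¬ bad y u'
    have hG : ∀ y w, G (past l w) y (w l) ↔ SucceedsFrom σ bad (k + 1) y w := by
      intro y w
      constructor
      · rintro ⟨u', h1, h2, h3, h4⟩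
        refine ⟨u', fun j hj => ?_, fun j hj => h3 j (Fin.lt_def.2 hj), h4⟩
        rcases Nat.lt_succ_iff_lt_or_eq.1 hj with hj | hj
        · exact congrFun h1 ⟨j, Fin.lt_def.2 hj⟩
        · have : j = l := Fin.ext hj
          rw [this, h2]
      · rintro ⟨u', h1, h2, h3⟩
        exact ⟨u', funext fun j => h1 j (Nat.lt_succ_of_lt j.2), h1 l (Nat.lt_succ_self k),
          fun j hj => h2 j hj, h3⟩
    obtain ⟨ρ, hρ⟩ := hround l (fun v y t => if G v y t then 0 else 1)
      (fun v y t => by split_ifs <;> simp)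
    simp only [hG] at hρ
    refine ⟨Function.update σ l ρ, ?_⟩
    have hle := hρ.trans (add_le_add_left hσ ε)
    push_cast
    rw [add_mul, one_mul, ← add_assoc]
    refine le_trans (sum_le_sum fun ω _ => mul_le_mul_of_nonneg_left ?_ (hQ ω)) hle
    by_cases h1 : G (past l (u ω)) (x ω) (ρ.pick (past l (u ω)) (activeObs l (x ω)))
    · by_cases h2 : ρ.dec (past l (u ω)) (passiveObs l (x ω))
            (ρ.enc (past l (u ω)) (activeObs l (x ω))) =
            ρ.pick (past l (u ω)) (activeObs l (x ω))
      · rw [if_pos]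
        · split_ifs
          simp
        obtain ⟨u', e1, e2, e3, e4⟩ := h1
        refine ⟨u', fun j hj => congrFun e1 ⟨j, Fin.lt_def.2 hj⟩, fun j hj => ?_, e4⟩
        by_cases hjl : j = l
        · subst hjl
          rw [RoundSucceeds, Function.update_self, e1, e2]
          exact ⟨rfl, h2⟩
        · have hlj : l < j := lt_of_le_of_ne (Fin.le_def.2 hj) (Ne.symm hjl)
          have := e3 j hlj
          rw [RoundSucceeds] at this ⊢
          rwa [Function.update_of_ne hjl]
      · rw [if_neg h2]
        split_ifs <;> norm_num
    · rw [if_neg h1]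
      split_ifs <;> norm_num

/-- The auxiliary values as seen by the terminal with observation `z`, given the messages `m`: its
own choices when it acts, and the recovered values when it listens. -/
def estimate (σ : (l : Fin K) → RoundMap S₁ S₂ T b l) (z : S₁ ⊕ S₂) (m : (l : Fin K) → Fin (b l))
    (l : Fin K) : T l :=
  if z.isLeft ↔ Even (l : ℕ) then (σ l).pick (fun j => estimate σ z m j.1) z
  else (σ l).dec (fun j => estimate σ z m j.1) z (m l)
termination_by (l : ℕ)
decreasing_by all_goals exact j.2

/-- If all rounds succeed and the messages agree with the scheme, both terminals track the same
values. -/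
theorem estimate_eq {σ : (l : Fin K) → RoundMap S₁ S₂ T b l} {x : S₁ × S₂}
    {u : (l : Fin K) → T l} (hu : ∀ l, RoundSucceeds σ x u l) {z : S₁ ⊕ S₂}
    (hz : z = Sum.inl x.1 ∨ z = Sum.inr x.2) (m : (l : Fin K) → Fin (b l)) {k : ℕ}
    (hm : ∀ l : Fin K, (l : ℕ) < k → m l = (σ l).enc (past l u) (activeObs l x)) :
    ∀ l : Fin K, (l : ℕ) < k → estimate σ z m l = u l := by
  intro l
  induction hN : (l : ℕ) using Nat.strong_induction_on generalizing l with
  | _ N ih =>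
  intro hl
  have hpast : (fun j : {j : Fin K // j < l} => estimate σ z m j.1) = past l u := by
    funext j
    have hj : (j.1 : ℕ) < l := j.2
    exact ih j.1 (hN ▸ hj) j.1 rfl (by omega)
  obtain ⟨h1, h2⟩ := hu l
  rw [← hm l (by omega)] at h2
  rw [estimate, hpast]
  by_cases he : Even (l : ℕ)
  · simp only [activeObs, passiveObs, he, if_true] at h1 h2
    rcases hz with rfl | rfl
    · simp [he, ← h1]
    · simp [he, h2]
  · simp only [activeObs, passiveObs, he, if_false] at h1 h2
    rcases hz with rfl | rfl
    · simp [he, h2]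
    · simp [he, ← h1]

end Scheme

section Code

variable {K n : ℕ} {X₁ X₂ X'₁ X'₂ : Type*} {A : Fin K → Type*} {b : Fin K → ℕ}

/-- Messages known only before round `l`, padded arbitrarily. -/
def padMessages (hb : ∀ l, 0 < b l) (l : Fin K) (m : (j : {j : Fin K // j < l}) → Fin (b j))
    (j : Fin K) : Fin (b j) :=
  if h : j < l then m ⟨j, h⟩ else ⟨0, hb j⟩

/-- The interactive code in which both terminals track the auxiliary values with `estimate`. -/
def codeOfRounds (hb : ∀ l, 0 < b l)
    (σ : (l : Fin K) → RoundMap (Fin n → X₁) (Fin n → X₂) (fun l => Fin n → A l) b l)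
    (g₁ : X₂ → ((l : Fin K) → A l) → X'₁) (g₂ : X₁ → ((l : Fin K) → A l) → X'₂) :
    InteractiveCode K n X₁ X₂ X'₁ X'₂ where
  M := b
  enc₁ l _ x m := (σ l).enc (past l (estimate σ (Sum.inl x) (padMessages hb l m))) (Sum.inl x)
  enc₂ l _ x m := (σ l).enc (past l (estimate σ (Sum.inr x) (padMessages hb l m))) (Sum.inr x)
  dec₁ x m i := g₁ (x i) fun l => estimate σ (Sum.inr x) m l i
  dec₂ x m i := g₂ (x i) fun l => estimate σ (Sum.inl x) m l i

variable {hb : ∀ l, 0 < b l}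
  {σ : (l : Fin K) → RoundMap (Fin n → X₁) (Fin n → X₂) (fun l => Fin n → A l) b l}
  {g₁ : X₂ → ((l : Fin K) → A l) → X'₁} {g₂ : X₁ → ((l : Fin K) → A l) → X'₂}
  {x : (Fin n → X₁) × (Fin n → X₂)} {u : (l : Fin K) → Fin n → A l}

theorem codeOfRounds_message (hu : ∀ l, RoundSucceeds σ x u l) (l : Fin K) :
    (codeOfRounds hb σ g₁ g₂).message x.1 x.2 l = (σ l).enc (past l u) (activeObs l x) := by
  induction hN : (l : ℕ) using Nat.strong_induction_on generalizing l with
  | _ N ih =>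
  have hpast : ∀ z, (z = Sum.inl x.1 ∨ z = Sum.inr x.2) → past l (estimate σ z (padMessages hb l
      (past l ((codeOfRounds hb σ g₁ g₂).message x.1 x.2)))) = past l u := by
    intro z hz
    funext j
    have hj : (j.1 : ℕ) < l := j.2
    refine estimate_eq hu hz _ (k := l) (fun i hi => ?_) j.1 hj
    have hil : i < l := hi
    refine (dif_pos hil).trans ?_
    exact ih i (hN ▸ hi) i rfl
  by_cases he : Even (l : ℕ)
  · rw [InteractiveCode.message_of_even _ he]
    simp only [activeObs, he, if_true]
    rw [← hpast _ (Or.inl rfl)]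
    rfl
  · rw [InteractiveCode.message_of_not_even _ he]
    simp only [activeObs, he, if_false]
    rw [← hpast _ (Or.inr rfl)]
    rfl

theorem codeOfRounds_dec₁ (hu : ∀ l, RoundSucceeds σ x u l) (i : Fin n) :
    (codeOfRounds hb σ g₁ g₂).dec₁ x.2 ((codeOfRounds hb σ g₁ g₂).message x.1 x.2) i =
      g₁ (x.2 i) fun l => u l i := by
  have := estimate_eq hu (Or.inr rfl) ((codeOfRounds hb σ g₁ g₂).message x.1 x.2) (k := K)
    (fun l _ => codeOfRounds_message hu l)
  change g₁ (x.2 i) (fun l => estimate σ (Sum.inr x.2) _ l i) = _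
  congr 1
  funext l
  rw [this l l.2]

theorem codeOfRounds_dec₂ (hu : ∀ l, RoundSucceeds σ x u l) (i : Fin n) :
    (codeOfRounds hb σ g₁ g₂).dec₂ x.1 ((codeOfRounds hb σ g₁ g₂).message x.1 x.2) i =
      g₂ (x.1 i) fun l => u l i := by
  have := estimate_eq hu (Or.inl rfl) ((codeOfRounds hb σ g₁ g₂).message x.1 x.2) (k := K)
    (fun l _ => codeOfRounds_message hu l)
  change g₂ (x.1 i) (fun l => estimate σ (Sum.inl x.1) _ l i) = _
  congr 1
  funext l
  rw [this l l.2]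

end Code

/-! ### Rates of the rounds -/

section RoundRates

variable {Ω X Y α β γ δ : Type*} [Fintype Ω] {q : Ω → ℝ} {K : ℕ} {A : Fin K → Type*}

/-- A function of the middle variable can be adjoined to an end of a Markov chain. -/
theorem IsMarkovChain.adjoin {f : Ω → α} {g : Ω → β} {h : Ω → γ} (H : IsMarkovChain q f g h)
    (k : β → δ) : IsMarkovChain q (fun ω => (k (g ω), f ω)) g h := by
  rintro ⟨c, a⟩ b d
  by_cases hc : c = k b
  · have e1 : law q (fun ω => ((k (g ω), f ω), g ω, h ω)) ((c, a), b, d) =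
        law q (fun ω => (f ω, g ω, h ω)) (a, b, d) := law_congr fun ω _ => by
      simp only [Prod.mk.injEq, hc]
      constructor
      · rintro ⟨⟨_, h2⟩, h3, h4⟩
        exact ⟨h2, h3, h4⟩
      · rintro ⟨h2, h3, h4⟩
        exact ⟨⟨by rw [h3], h2⟩, h3, h4⟩
    have e2 : law q (fun ω => ((k (g ω), f ω), g ω)) ((c, a), b) =
        law q (fun ω => (f ω, g ω)) (a, b) := law_congr fun ω _ => by
      simp only [Prod.mk.injEq, hc]
      constructor
      · rintro ⟨⟨_, h2⟩, h3⟩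
        exact ⟨h2, h3⟩
      · rintro ⟨h2, h3⟩
        exact ⟨⟨by rw [h3], h2⟩, h3⟩
    rw [e1, e2, H]
  · rw [law_eq_zero, law_eq_zero (a := ((c, a), b)), zero_mul, zero_mul]
    · intro ω _ e
      simp only [Prod.mk.injEq] at e
      exact hc (by rw [← e.1.1, e.2])
    · intro ω _ e
      simp only [Prod.mk.injEq] at e
      exact hc (by rw [← e.1.1, e.2.1])

/-- The rate of round `l` when the acting terminal observes `V` and the listening one `W`:
`H(U_l | U_{<l}, W) - H(U_l | U_{<l}, V)`. -/
def roundRate (q : Ω → ℝ) (V : Ω → X) (W : Ω → Y) (U : Ω → (l : Fin K) → A l) (l : Fin K) : ℝ :=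
  ent q (fun ω => ((past l (U ω), W ω), U ω l)) - ent q (fun ω => (past l (U ω), W ω)) -
    (ent q (fun ω => ((past l (U ω), V ω), U ω l)) - ent q (fun ω => (past l (U ω), V ω)))

/-- The rates of the rounds in which the terminal with observation `V` acts add up to
`I(V; U, W) - I(V; W)`, by the chain rule: in the other rounds `I(V; U_{≤ l}, W)` does not grow. -/
theorem sum_roundRate (hq : ∀ ω, 0 ≤ q ω) (V : Ω → X) (W : Ω → Y) (U : Ω → (l : Fin K) → A l)
    (P : Fin K → Prop) [DecidablePred P]
    (hP : ∀ l, P l → IsMarkovChain q W (fun ω => (past l (U ω), V ω)) (fun ω => U ω l))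
    (hP' : ∀ l, ¬ P l → IsMarkovChain q V (fun ω => (past l (U ω), W ω)) (fun ω => U ω l)) :
    ∑ l ∈ univ.filter P, roundRate q V W U l =
      mutualInfo q V (fun ω => (U ω, W ω)) - mutualInfo q V W := by
  let pre : (k : ℕ) → Ω → (j : {j : Fin K // (j : ℕ) < k}) → A j := fun k ω j => U ω j
  -- up to the constant `H(V)`, the mutual information `I(V; U_{< k}, W)`
  let c : ℕ → ℝ := fun k => ent q (fun ω => (pre k ω, W ω)) - ent q (fun ω => (V ω, pre k ω, W ω))
  have hpre : ∀ (l : Fin K) (ω ω' : Ω), past l (U ω) = past l (U ω') ↔ pre l ω = pre l ω' :=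
    fun l ω ω' => Iff.rfl
  have hsucc : ∀ (l : Fin K) (ω ω' : Ω),
      pre (l + 1) ω = pre (l + 1) ω' ↔ past l (U ω) = past l (U ω') ∧ U ω l = U ω' l := by
    intro l ω ω'
    constructor
    · intro h
      exact ⟨funext fun j => congrFun h ⟨j, Nat.lt_succ_of_lt j.2⟩,
        congrFun h ⟨l, Nat.lt_succ_self l⟩⟩
    · rintro ⟨h1, h2⟩
      funext j
      rcases Nat.lt_succ_iff_lt_or_eq.1 j.2 with hj | hj
      · exact congrFun h1 ⟨j, hj⟩
      · have : j.1 = l := Fin.ext hj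
        change U ω j.1 = U ω' j.1
        rw [this, h2]
  have hinc : ∀ l : Fin K, c (l + 1) - c l = if P l then roundRate q V W U l else 0 := by
    intro l
    have e1 : ent q (fun ω => ((past l (U ω), W ω), U ω l)) =
        ent q (fun ω => (pre (l + 1) ω, W ω)) :=
      ent_congr fun ω ω' _ _ => by simp only [Prod.mk.injEq, hsucc]; tauto
    have e2 : ent q (fun ω => (W ω, (past l (U ω), V ω), U ω l)) =
        ent q (fun ω => (V ω, pre (l + 1) ω, W ω)) :=
      ent_congr fun ω ω' _ _ => by simp only [Prod.mk.injEq, hsucc]; tauto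
    have e3 : ent q (fun ω => (V ω, (past l (U ω), W ω), U ω l)) =
        ent q (fun ω => (V ω, pre (l + 1) ω, W ω)) :=
      ent_congr fun ω ω' _ _ => by simp only [Prod.mk.injEq, hsucc]; tauto
    have e4 : ent q (fun ω => (past l (U ω), W ω)) = ent q (fun ω => (pre l ω, W ω)) := rfl
    have e5 : ent q (fun ω => (V ω, (past l (U ω), W ω))) = ent q (fun ω => (V ω, pre l ω, W ω)) :=
      rfl
    have e6 : ent q (fun ω => (W ω, (past l (U ω), V ω))) = ent q (fun ω => (V ω, pre l ω, W ω)) :=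
      ent_congr fun ω ω' _ _ => by simp only [Prod.mk.injEq, hpre]; tauto
    simp only [c]
    split_ifs with h
    · have := (hP l h).ent_eq hq
      rw [e2, e6] at this
      rw [roundRate, e1, e4]
      linarith
    · have := (hP' l h).ent_eq hq
      rw [e1, e3, e4, e5] at this
      linarith
  have htel : ∑ l : Fin K, (c (l + 1) - c l) = c K - c 0 := by
    rw [Fin.sum_univ_eq_sum_range (fun k => c (k + 1) - c k) K, sum_range_sub]
  have hK : ∀ ω ω', pre K ω = pre K ω' ↔ U ω = U ω' := fun ω ω' =>
    ⟨fun h => funext fun j => congrFun h ⟨j, j.2⟩, fun h => funext fun j => congrFun h j.1⟩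
  have h0 : ∀ ω ω', pre 0 ω = pre 0 ω' := fun ω ω' => funext fun j => absurd j.2 (Nat.not_lt_zero _)
  have k1 : ent q (fun ω => (pre K ω, W ω)) = ent q (fun ω => (U ω, W ω)) :=
    ent_congr fun ω ω' _ _ => by simp only [Prod.mk.injEq, hK]
  have k2 : ent q (fun ω => (V ω, pre K ω, W ω)) = ent q (fun ω => (V ω, U ω, W ω)) :=
    ent_congr fun ω ω' _ _ => by simp only [Prod.mk.injEq, hK]
  have k3 : ent q (fun ω => (pre 0 ω, W ω)) = ent q W :=
    ent_congr fun ω ω' _ _ => by simp only [Prod.mk.injEq, h0 ω ω', true_and]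
  have k4 : ent q (fun ω => (V ω, pre 0 ω, W ω)) = ent q (fun ω => (V ω, W ω)) :=
    ent_congr fun ω ω' _ _ => by simp only [Prod.mk.injEq, h0 ω ω', true_and]
  rw [sum_filter, ← sum_congr rfl fun l _ => hinc l, htel, mutualInfo_eq_ent hq,
    mutualInfo_eq_ent hq]
  simp only [c]
  rw [k1, k2, k3, k4]
  ring

/-- One round of the interactive scheme on long blocks, with the rate of `roundRate`. -/
theorem eventually_exists_roundMap [Fintype X] [Fintype Y] [∀ l, Fintype (A l)]
    (hq : q ∈ stdSimplex ℝ Ω) (V : Ω → X) (W : Ω → Y) (U : Ω → (l : Fin K) → A l) (l : Fin K)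
    (he : Even (l : ℕ) → IsMarkovChain q W (fun ω => (past l (U ω), V ω)) (fun ω => U ω l))
    (ho : ¬ Even (l : ℕ) → IsMarkovChain q V (fun ω => (past l (U ω), W ω)) (fun ω => U ω l))
    {δ ε : ℝ} (hδ : 0 < δ) (hε : 0 < ε) :
    ∀ᶠ n : ℕ in atTop, ∃ bl : ℕ, 0 < bl ∧
      Real.logb 2 bl ≤ n *
        ((if Even (l : ℕ) then roundRate q V W U l else roundRate q W V U l) + δ) ∧
      ∀ b : Fin K → ℕ, b l = bl →
        ∀ F : ((j : {j : Fin K // j < l}) → Fin n → A j) → (Fin n → X) × (Fin n → Y) →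
          (Fin n → A l) → ℝ, (∀ v x t, 0 ≤ F v x t ∧ F v x t ≤ 1) →
        ∃ ρ : RoundMap (Fin n → X) (Fin n → Y) (fun l => Fin n → A l) b l,
          ∑ ω : Fin n → Ω, iid (Fin n) q ω *
            (F (fun j i => U (ω i) j) (fun i => V (ω i), fun i => W (ω i))
              (ρ.pick (fun j i => U (ω i) j)
                (activeObs l (fun i => V (ω i), fun i => W (ω i)))) +
            if ρ.dec (fun j i => U (ω i) j) (passiveObs l (fun i => V (ω i), fun i => W (ω i)))
              (ρ.enc (fun j i => U (ω i) j)
                (activeObs l (fun i => V (ω i), fun i => W (ω i)))) =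
              ρ.pick (fun j i => U (ω i) j)
                (activeObs l (fun i => V (ω i), fun i => W (ω i))) then 0 else 1) ≤
          ∑ ω, iid (Fin n) q ω * F (fun j i => U (ω i) j)
            (fun i => V (ω i), fun i => W (ω i)) (fun i => U (ω i) l) + ε := by
  obtain ⟨ω₀⟩ : Nonempty Ω := by
    by_contra hc
    rw [not_nonempty_iff] at hc
    simpa using hq.2
  by_cases hl : Even (l : ℕ)
  · filter_upwards [eventually_exists_round hq ((he hl).adjoin Prod.fst) hδ hε] with n hn
    obtain ⟨bl, hbl, hrate, H⟩ := hn
    refine ⟨bl, hbl, by rw [if_pos hl]; exact hrate, ?_⟩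
    rintro b rfl F hF
    obtain ⟨enc, φ, dec, hmain⟩ := H (fun x y t => F (fun j i => (x i).1 j)
      (fun i => (x i).2, fun i => (y i).2) t) (fun x y t => hF _ _ _)
    refine ⟨⟨fun v z => z.elim (fun x => enc fun i => (fun j => v j i, x i)) fun _ => ⟨0, hbl⟩,
      fun v z => z.elim (fun x => φ fun i => (fun j => v j i, x i)) fun _ i => U ω₀ l,
      fun v z m => z.elim (fun _ i => U ω₀ l) fun y => dec (fun i => (fun j => v j i, y i)) m⟩, ?_⟩
    simp only [activeObs, passiveObs, if_pos hl, Sum.elim_inl, Sum.elim_inr]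
    exact hmain
  · filter_upwards [eventually_exists_round hq ((ho hl).adjoin Prod.fst) hδ hε] with n hn
    obtain ⟨bl, hbl, hrate, H⟩ := hn
    refine ⟨bl, hbl, by rw [if_neg hl]; exact hrate, ?_⟩
    rintro b rfl F hF
    obtain ⟨enc, φ, dec, hmain⟩ := H (fun x y t => F (fun j i => (x i).1 j)
      (fun i => (y i).2, fun i => (x i).2) t) (fun x y t => hF _ _ _)
    refine ⟨⟨fun v z => z.elim (fun _ => ⟨0, hbl⟩) fun x => enc fun i => (fun j => v j i, x i),
      fun v z => z.elim (fun _ i => U ω₀ l) fun x => φ fun i => (fun j => v j i, x i),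
      fun v z m => z.elim (fun y => dec (fun i => (fun j => v j i, y i)) m) fun _ i => U ω₀ l⟩, ?_⟩
    simp only [activeObs, passiveObs, if_neg hl, Sum.elim_inl, Sum.elim_inr]
    exact hmain

end RoundRates

/-! ### Achievability -/

section Achievability

theorem sum_mul_le_add_mul {Ω : Type*} [Fintype Ω] {q : Ω → ℝ} (hq : q ∈ stdSimplex ℝ Ω)
    {F : Ω → ℝ} {S : Ω → Prop} {D B : ℝ} (h1 : ∀ ω, S ω → F ω ≤ D) (h2 : ∀ ω, F ω ≤ D + B) :
    ∑ ω, q ω * F ω ≤ D + B * ∑ ω, q ω * (if S ω then 0 else 1) := by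
  have h : ∀ ω, q ω * F ω ≤ q ω * D + B * (q ω * (if S ω then 0 else 1)) := by
    intro ω
    split_ifs with hS
    · simpa using mul_le_mul_of_nonneg_left (h1 ω hS) (hq.1 ω)
    · have := mul_le_mul_of_nonneg_left (h2 ω) (hq.1 ω)
      linarith
  refine (sum_le_sum fun ω _ => h ω).trans (le_of_eq ?_)
  rw [sum_add_distrib, ← sum_mul, hq.2, one_mul, ← mul_sum]

/-- The probability that an empirical mean exceeds a bound on the mean by `δ` decays like
`1 / n`. -/
theorem exists_sum_iid_exceeds_le {Ω : Type*} [Fintype Ω] {q : Ω → ℝ} (hq : q ∈ stdSimplex ℝ Ω)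
    (Z : Ω → ℝ) {D δ : ℝ} (hD : ∑ ω, q ω * Z ω ≤ D) (hδ : 0 < δ) :
    ∃ v : ℝ, ∀ n : ℕ, n ≠ 0 →
      ∑ ω, iid (Fin n) q ω * (if n * (D + δ) < ∑ i, Z (ω i) then 1 else 0) ≤ v * (n : ℝ)⁻¹ := by
  refine ⟨_, fun n hn => sum_iid_mul_indicator_le hq Z hn hδ _ fun ω _ hω => ?_⟩
  refine le_trans ?_ (le_abs_self _)
  have : (n : ℝ) * ∑ ω, q ω * Z ω ≤ n * D := mul_le_mul_of_nonneg_left hD (Nat.cast_nonneg n)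
  linarith

theorem exists_abs_le {α β : Type*} [Finite α] [Finite β] (d : α → β → ℝ) :
    ∃ C, ∀ x y, |d x y| ≤ C := by
  obtain ⟨C, hC⟩ := (Set.finite_range fun z : α × β => |d z.1 z.2|).bddAbove
  exact ⟨C, fun x y => hC ⟨(x, y), rfl⟩⟩

theorem sum_div_le_of_abs_le {n : ℕ} {F : Fin n → ℝ} {C : ℝ} (hn : n ≠ 0) (h : ∀ i, |F i| ≤ C) :
    (∑ i, F i) / n ≤ C := by
  have hn' : (0 : ℝ) < n := by exact_mod_cast Nat.pos_of_ne_zero hn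
  rw [div_le_iff₀ hn']
  refine (sum_le_sum fun i _ => (le_abs_self _).trans (h i)).trans (le_of_eq ?_)
  simp [mul_comm]

theorem mutualInfo_comm {Ω α β : Type*} [Fintype Ω] {q : Ω → ℝ} (hq : ∀ ω, 0 ≤ q ω) (f : Ω → α)
    (g : Ω → β) : mutualInfo q f g = mutualInfo q g f := by
  rw [mutualInfo_eq_ent hq, mutualInfo_eq_ent hq,
    ent_congr (f := fun ω => (f ω, g ω)) (f' := fun ω => (g ω, f ω))
      (fun _ _ _ _ => by simp only [Prod.mk.injEq]; tauto)]
  ring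

variable {Ω X₁ X₂ X'₁ X'₂ : Type*} [Fintype Ω] [Fintype X₁] [Fintype X₂] [Finite X'₁] [Finite X'₂]
  {K : ℕ} {A : Fin K → Type*} [∀ l, Fintype (A l)] {p : X₁ × X₂ → ℝ}
  {d₁ : X₁ → X'₁ → ℝ} {d₂ : X₂ → X'₂ → ℝ} {q : Ω → ℝ} {V : Ω → X₁} {W : Ω → X₂}
  {U : Ω → (l : Fin K) → A l} {t : ℝ × ℝ × ℝ × ℝ}

/-- Codes of all large block lengths nearly attain the rates and distortions of a test channel. -/
theorem IsTestChannel.eventually_exists_code (h : IsTestChannel p d₁ d₂ q V W U t) {ε : ℝ}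
    (hε : 0 < ε) :
    ∀ᶠ n : ℕ in atTop, ∃ c : InteractiveCode K n X₁ X₂ X'₁ X'₂,
      c.sumRate₁ ≤ t.1 - mutualInfo p Prod.fst Prod.snd + ε ∧
      c.sumRate₂ ≤ t.2.1 - mutualInfo p Prod.fst Prod.snd + ε ∧
      c.distortion₁ p d₁ ≤ t.2.2.1 + ε ∧ c.distortion₂ p d₂ ≤ t.2.2.2 + ε := by
  have hq := h.mem
  have hp : law q (fun ω => (V ω, W ω)) = p := funext h.law_eq
  obtain ⟨ω₀⟩ : Nonempty Ω := by
    by_contra hc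
    rw [not_nonempty_iff] at hc
    simpa using hq.2
  have hI : mutualInfo q V W = mutualInfo p Prod.fst Prod.snd := by
    rw [← hp, mutualInfo_law]
  obtain ⟨g₁, hg₁⟩ := h.dist₁
  obtain ⟨g₂, hg₂⟩ := h.dist₂
  obtain ⟨C₁, hC₁⟩ := exists_abs_le d₁
  obtain ⟨C₂, hC₂⟩ := exists_abs_le d₂
  have hε2 : 0 < ε / 2 := by positivity
  obtain ⟨v₁, hv₁⟩ := exists_sum_iid_exceeds_le hq (fun ω => d₁ (V ω) (g₁ (W ω) (U ω))) hg₁ hε2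
  obtain ⟨v₂, hv₂⟩ := exists_sum_iid_exceeds_le hq (fun ω => d₂ (W ω) (g₂ (V ω) (U ω))) hg₂ hε2
  -- a bound for the excess distortion when the protocol fails
  obtain ⟨B, hB0, hB₁, hB₂⟩ : ∃ B : ℝ, 0 < B ∧ C₁ ≤ t.2.2.1 + ε / 2 + B ∧
      C₂ ≤ t.2.2.2 + ε / 2 + B :=
    ⟨|C₁ - (t.2.2.1 + ε / 2)| + |C₂ - (t.2.2.2 + ε / 2)| + 1, by positivity,
      by linarith [le_abs_self (C₁ - (t.2.2.1 + ε / 2)), abs_nonneg (C₂ - (t.2.2.2 + ε / 2))],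
      by linarith [le_abs_self (C₂ - (t.2.2.2 + ε / 2)), abs_nonneg (C₁ - (t.2.2.1 + ε / 2))]⟩
  have hε' : 0 < ε / (4 * B * (K + 1)) := by positivity
  have hδ : 0 < ε / (K + 1) := by positivity
  have hlim : ∀ᶠ n : ℕ in atTop, B * ((v₁ + v₂) * (n : ℝ)⁻¹) ≤ ε / 4 := by
    have h1 : Tendsto (fun n : ℕ => B * ((v₁ + v₂) * (n : ℝ)⁻¹)) atTop (nhds 0) := by
      simpa using (tendsto_inv_atTop_nhds_zero_nat (𝕜 := ℝ)).const_mul (v₁ + v₂) |>.const_mul B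
    exact h1.eventually_le_const (by positivity)
  have hrounds := eventually_all.2 fun l : Fin K =>
    eventually_exists_roundMap hq V W U l (h.markov_even l)
      (fun hl => h.markov_odd l (Nat.not_even_iff_odd.1 hl)) hδ hε'
  filter_upwards [hlim, hrounds, eventually_ne_atTop 0] with n hn hrounds hn0
  have hn' : (0 : ℝ) < n := by exact_mod_cast Nat.pos_of_ne_zero hn0
  choose b hb hrate hround using hrounds
  have : ∀ l, Nonempty (Fin n → A l) := fun l => ⟨fun _ => U ω₀ l⟩
  let x : (Fin n → Ω) → (Fin n → X₁) × (Fin n → X₂) := fun ω =>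
    (fun i => V (ω i), fun i => W (ω i))
  let u : (Fin n → Ω) → (l : Fin K) → Fin n → A l := fun ω l i => U (ω i) l
  let bad₁ : (Fin n → X₁) × (Fin n → X₂) → ((l : Fin K) → Fin n → A l) → Prop := fun x u =>
    n * (t.2.2.1 + ε / 2) < ∑ i, d₁ (x.1 i) (g₁ (x.2 i) fun l => u l i)
  let bad₂ : (Fin n → X₁) × (Fin n → X₂) → ((l : Fin K) → Fin n → A l) → Prop := fun x u =>
    n * (t.2.2.2 + ε / 2) < ∑ i, d₂ (x.2 i) (g₂ (x.1 i) fun l => u l i)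
  have hQ := iid_mem_stdSimplex (ι := Fin n) hq
  obtain ⟨σ, hσ⟩ := exists_rounds (b := b) (ε := ε / (4 * B * (K + 1))) hQ.1 hb x u
    (fun l F hF => by
      obtain ⟨ρ, hρ⟩ := hround l b rfl F hF
      refine ⟨ρ, ?_⟩
      convert hρ <;> rfl) (fun x u => bad₁ x u ∨ bad₂ x u)
  set S : (Fin n → Ω) → Prop := fun ω =>
    SucceedsFrom σ (fun x u => bad₁ x u ∨ bad₂ x u) 0 (x ω) (u ω) with hS
  have hfail : B * ∑ ω, iid (Fin n) q ω * (if S ω then 0 else 1) ≤ ε / 2 := by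
    have h1 : ∑ ω, iid (Fin n) q ω * (if bad₁ (x ω) (u ω) ∨ bad₂ (x ω) (u ω) then 1 else 0) ≤
        (v₁ + v₂) * (n : ℝ)⁻¹ := by
      rw [add_mul]
      refine le_trans ?_ (add_le_add (hv₁ n hn0) (hv₂ n hn0))
      rw [← sum_add_distrib]
      refine sum_le_sum fun ω _ => ?_
      rw [← mul_add]
      refine mul_le_mul_of_nonneg_left ?_ (hQ.1 ω)
      change _ ≤ (if bad₁ (x ω) (u ω) then (1 : ℝ) else 0) + if bad₂ (x ω) (u ω) then 1 else 0
      by_cases h1 : bad₁ (x ω) (u ω) <;> by_cases h2 : bad₂ (x ω) (u ω) <;> simp [h1, h2]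
    have h2 : B * (K * (ε / (4 * B * (K + 1)))) ≤ ε / 4 := by
      have e : B * (K * (ε / (4 * B * (K + 1)))) = ε / 4 * (K / (K + 1)) := by
        field_simp
      rw [e]
      refine mul_le_of_le_one_right (by positivity) ?_
      rw [div_le_one (by positivity)]
      linarith
    have h3 : ∑ ω, iid (Fin n) q ω * (if S ω then 0 else 1) ≤
        (v₁ + v₂) * (n : ℝ)⁻¹ + K * (ε / (4 * B * (K + 1))) := by
      refine hσ.trans (add_le_add_left (le_of_eq_of_le (sum_congr rfl fun ω _ => ?_) h1) _)
      congr
    have h4 := mul_le_mul_of_nonneg_left h3 hB0.le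
    rw [mul_add] at h4
    linarith
  have hsum : ∀ F : (Fin n → X₁) → (Fin n → X₂) → ℝ,
      ∑ x₁, ∑ x₂, (∏ i, p (x₁ i, x₂ i)) * F x₁ x₂ =
        ∑ ω, iid (Fin n) q ω * F (x ω).1 (x ω).2 := fun F => by
    rw [← hp]
    exact sum_block_pair F
  have hratesum : ∀ (P : Fin K → Prop) [DecidablePred P] (r : Fin K → ℝ) (R : ℝ),
      (∀ l, P l → Real.logb 2 (b l) ≤ n * (r l + ε / (K + 1))) → ∑ l ∈ univ.filter P, r l ≤ R →
      (∑ l ∈ univ.filter P, Real.logb 2 (b l)) / n ≤ R + ε := by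
    intro P _ r R h1 h2
    rw [div_le_iff₀ hn']
    refine (sum_le_sum fun l hl => h1 l (mem_filter.1 hl).2).trans ?_
    rw [← mul_sum, mul_comm, sum_add_distrib, sum_const, nsmul_eq_mul]
    refine mul_le_mul_of_nonneg_right (add_le_add h2 ?_) hn'.le
    have h3 : ((univ.filter P).card : ℝ) ≤ K := by
      exact_mod_cast (card_filter_le _ _).trans (by simp)
    calc ((univ.filter P).card : ℝ) * (ε / (K + 1)) ≤ (K + 1) * (ε / (K + 1)) := by
          gcongr
          linarith
      _ = ε := by field_simp
  refine ⟨codeOfRounds hb σ g₁ g₂, ?_, ?_, ?_, ?_⟩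
  · refine hratesum _ (fun l => roundRate q V W U l) _ (fun l hl => ?_) ?_
    · have := hrate l
      rwa [if_pos hl] at this
    · rw [sum_roundRate hq.1 V W U _ (fun l hl => h.markov_even l hl)
        (fun l hl => h.markov_odd l (Nat.not_even_iff_odd.1 hl)), hI]
      linarith [h.info₁]
  · refine hratesum _ (fun l => roundRate q W V U l) _ (fun l hl => ?_) ?_
    · have := hrate l
      rwa [if_neg hl] at this
    · rw [sum_roundRate hq.1 W V U _ (fun l hl => h.markov_odd l (Nat.not_even_iff_odd.1 hl))
        (fun l hl => h.markov_even l (not_not.1 hl)), mutualInfo_comm hq.1 W V, hI]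
      linarith [h.info₂]
  · rw [InteractiveCode.distortion₁, hsum]
    refine (sum_mul_le_add_mul hQ (S := S) (D := t.2.2.1 + ε / 2) (B := B) ?_ ?_).trans
      (by linarith)
    · rintro ω ⟨u', -, hu', hbad⟩
      have h1 := not_lt.1 (not_or.1 hbad).1
      rw [div_le_iff₀' hn']
      refine le_trans (le_of_eq (sum_congr rfl fun i _ => ?_)) h1
      rw [codeOfRounds_dec₁ (fun l => hu' l (Nat.zero_le _))]
    · exact fun ω => (sum_div_le_of_abs_le hn0 fun i => hC₁ _ _).trans hB₁
  · rw [InteractiveCode.distortion₂, hsum]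
    refine (sum_mul_le_add_mul hQ (S := S) (D := t.2.2.2 + ε / 2) (B := B) ?_ ?_).trans
      (by linarith)
    · rintro ω ⟨u', -, hu', hbad⟩
      have h1 := not_lt.1 (not_or.1 hbad).2
      rw [div_le_iff₀' hn']
      refine le_trans (le_of_eq (sum_congr rfl fun i _ => ?_)) h1
      rw [codeOfRounds_dec₂ (fun l => hu' l (Nat.zero_le _))]
    · exact fun ω => (sum_div_le_of_abs_le hn0 fun i => hC₂ _ _).trans hB₂

end Achievability

/-! ### Equality of the regions -/

section Regions

/-- A diagonal choice: if every accuracy is attained from some index on, then a single sequence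
attains all accuracies in the limit. -/
theorem exists_seq_of_eventually_exists {C : ℕ → Type*} [∀ n, Nonempty (C n)]
    {P : (n : ℕ) → ℝ → C n → Prop} (hmono : ∀ n c ε ε', ε ≤ ε' → P n ε c → P n ε' c)
    (h : ∀ ε > (0 : ℝ), ∀ᶠ n in atTop, ∃ c, P n ε c) :
    ∃ c : (n : ℕ) → C n, ∀ ε > (0 : ℝ), ∀ᶠ n in atTop, P n ε (c n) := by
  -- at index `n`, use the best of the accuracies `1 / (k + 1)`, `k ≤ n`, that is attained there
  let G : ℕ → ℕ → Prop := fun n k => ∃ c, P n (1 / ((k : ℝ) + 1)) c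
  have hc : ∀ n, ∃ c : C n, G n (Nat.findGreatest (G n) n) →
      P n (1 / ((Nat.findGreatest (G n) n : ℕ) + 1)) c := by
    intro n
    by_cases hG : G n (Nat.findGreatest (G n) n)
    · obtain ⟨c, hc⟩ := hG
      exact ⟨c, fun _ => hc⟩
    · exact ⟨Classical.arbitrary _, fun h => absurd h hG⟩
  choose c hc using hc
  refine ⟨c, fun ε hε => ?_⟩
  obtain ⟨k, hk⟩ := exists_nat_one_div_lt hε
  filter_upwards [h _ (Nat.one_div_pos_of_nat (n := k)), eventually_ge_atTop k] with n hn hkn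
  have h1 : k ≤ Nat.findGreatest (G n) n := Nat.le_findGreatest hkn hn
  have h2 : G n (Nat.findGreatest (G n) n) := Nat.findGreatest_spec hkn hn
  exact hmono _ _ _ _ ((Nat.one_div_le_one_div h1).trans hk.le) (hc n h2)

variable {X₁ X₂ X'₁ X'₂ : Type*} [Fintype X₁] [Fintype X₂] [Fintype X'₁] [Fintype X'₂] {K : ℕ}
  {p : X₁ × X₂ → ℝ} {d₁ : X₁ → X'₁ → ℝ} {d₂ : X₂ → X'₂ → ℝ}

/-- Direct part: the tradeoff region yields achievable tuples. -/
theorem sub_mutualInfo_mem_sourceCodingRegion {t : ℝ × ℝ × ℝ × ℝ}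
    (ht : t ∈ tradeoffRegion K (privateEqPublic p) d₁ d₂) :
    (t.1 - mutualInfo p Prod.fst Prod.snd, t.2.1 - mutualInfo p Prod.fst Prod.snd, t.2.2.1,
      t.2.2.2) ∈ sourceCodingRegion K p d₁ d₂ := by
  obtain ⟨m, hm⟩ := Set.mem_iUnion.1 ht
  obtain ⟨q, hq⟩ := isTestChannel_of_mem_tradeoffTuples hm
  obtain ⟨ω₀⟩ : Nonempty ((X₁ × X₁ × X₂ × X₂) × ((l : Fin K) → Fin (m l))) := by
    by_contra hc
    rw [not_nonempty_iff] at hc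
    simpa using hq.mem.2
  obtain ⟨g₁, -⟩ := hq.dist₁
  obtain ⟨g₂, -⟩ := hq.dist₂
  have : ∀ n, Nonempty (InteractiveCode K n X₁ X₂ X'₁ X'₂) := fun n =>
    ⟨⟨fun _ => 1, fun _ _ _ _ => 0, fun _ _ _ _ => 0, fun _ _ _ => g₁ ω₀.1.2.2.1 ω₀.2,
      fun _ _ _ => g₂ ω₀.1.1 ω₀.2⟩⟩
  refine exists_seq_of_eventually_exists (C := fun n => InteractiveCode K n X₁ X₂ X'₁ X'₂)
    (P := fun n ε c => c.sumRate₁ ≤ t.1 - mutualInfo p Prod.fst Prod.snd + ε ∧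
      c.sumRate₂ ≤ t.2.1 - mutualInfo p Prod.fst Prod.snd + ε ∧
      c.distortion₁ p d₁ ≤ t.2.2.1 + ε ∧ c.distortion₂ p d₂ ≤ t.2.2.2 + ε)
    (fun n c ε ε' hε h => ⟨h.1.trans (by linarith), h.2.1.trans (by linarith),
      h.2.2.1.trans (by linarith), h.2.2.2.trans (by linarith)⟩)
    fun ε hε => hq.eventually_exists_code hε

/-- Converse part. A code only satisfies the constraints up to any `ε > 0`; the limit stays in the
region because the cardinality bounds make it closed. -/
theorem add_mutualInfo_mem_boundedTradeoffRegion (hp : p ∈ stdSimplex ℝ (X₁ × X₂))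
    {r : ℝ × ℝ × ℝ × ℝ} (hr : r ∈ sourceCodingRegion K p d₁ d₂) :
    (r.1 + mutualInfo p Prod.fst Prod.snd, r.2.1 + mutualInfo p Prod.fst Prod.snd, r.2.2.1,
      r.2.2.2) ∈ boundedTradeoffRegion K (privateEqPublic p) d₁ d₂ := by
  obtain ⟨c, hc⟩ := hr
  set I := mutualInfo p Prod.fst Prod.snd with hI
  let τ : ℕ → ℝ × ℝ × ℝ × ℝ := fun k =>
    (r.1 + 1 / ((k : ℝ) + 1) + I, r.2.1 + 1 / ((k : ℝ) + 1) + I, r.2.2.1 + 1 / ((k : ℝ) + 1),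
      r.2.2.2 + 1 / ((k : ℝ) + 1))
  have hτ : Tendsto τ atTop (nhds (r.1 + I, r.2.1 + I, r.2.2.1, r.2.2.2)) := by
    have h1 : ∀ a : ℝ, Tendsto (fun k : ℕ => a + 1 / ((k : ℝ) + 1)) atTop (nhds a) := fun a => by
      simpa using tendsto_const_nhds.add (tendsto_one_div_add_atTop_nhds_zero_nat (𝕜 := ℝ))
    exact ((h1 _).add_const I).prodMk_nhds (((h1 _).add_const I).prodMk_nhds
      ((h1 _).prodMk_nhds (h1 _)))
  refine (isClosed_boundedTradeoffRegion _ d₁ d₂).mem_of_tendsto hτ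
    (Eventually.of_forall fun k => ?_)
  obtain ⟨n, ⟨h1, h2, h3, h4⟩, hn⟩ :=
    ((hc _ (Nat.one_div_pos_of_nat (n := k))).and (eventually_ne_atTop 0)).exists
  exact tradeoffRegion_subset_bounded ((c n).mem_tradeoffRegion hn hp d₁ d₂
    (by simp only [τ]; linarith) (by simp only [τ]; linarith) h3 h4)

end Regions

end InteractiveCoding

end

theorem corollary1 {X₁ X₂ X'₁ X'₂ : Type*} [Fintype X₁] [Fintype X₂] [Fintype X'₁] [Fintype X'₂]
    (K : ℕ) (p : X₁ × X₂ → ℝ) (hp : p ∈ stdSimplex ℝ (X₁ × X₂))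
    (d₁ : X₁ → X'₁ → ℝ) (d₂ : X₂ → X'₂ → ℝ) :
    InteractiveCoding.sourceCodingRegion K p d₁ d₂ =
        (fun t : ℝ × ℝ × ℝ × ℝ =>
          (t.1 - InteractiveCoding.mutualInfo p Prod.fst Prod.snd,
            t.2.1 - InteractiveCoding.mutualInfo p Prod.fst Prod.snd, t.2.2.1, t.2.2.2)) ''
          InteractiveCoding.tradeoffRegion K (InteractiveCoding.privateEqPublic p) d₁ d₂ ∧
      InteractiveCoding.sourceCodingRegion K p d₁ d₂ =
        (fun t : ℝ × ℝ × ℝ × ℝ =>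
          (t.1 - InteractiveCoding.mutualInfo p Prod.fst Prod.snd,
            t.2.1 - InteractiveCoding.mutualInfo p Prod.fst Prod.snd, t.2.2.1, t.2.2.2)) ''
          InteractiveCoding.boundedTradeoffRegion K (InteractiveCoding.privateEqPublic p) d₁ d₂ := by
  open InteractiveCoding in
  constructor
  · refine Set.Subset.antisymm (fun r hr => ?_) (Set.image_subset_iff.2 fun t ht => ?_)
    · exact ⟨_, bounded_subset_tradeoffRegion (add_mutualInfo_mem_boundedTradeoffRegion hp hr),
        by simp⟩
    · exact sub_mutualInfo_mem_sourceCodingRegion ht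
  · refine Set.Subset.antisymm (fun r hr => ?_) (Set.image_subset_iff.2 fun t ht => ?_)
    · exact ⟨_, add_mutualInfo_mem_boundedTradeoffRegion hp hr, by simp⟩
    · exact sub_mutualInfo_mem_sourceCodingRegion (bounded_subset_tradeoffRegion ht)
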